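/- Let $K$ be a knot in $S^3$ with crossing number $c$ (the minimal number of crossings of a diagram of $K$), and let $a_m(K)$ denote the coefficient of $z^m$ in the Conway polynomial $\nabla_K(z)$, which is determined by $\nabla_{\mathrm{unknot}}=1$ and the skein relation $\nabla_{L_+}-\nabla_{L_-}=z\nabla_{L_0}$. For real $x$ and an integer $k\ge 0$ write $\binom{x}{k}=\frac{x(x-1)\cdots(x-k+1)}{k!}$. Then for every integer $n\ge 1$ with $2n\le c$, $$|a_{2n}(K)|\le \frac12\left(\binom{c}{2n}-2\binom{c/2}{2n}\right),$$ and $a_{2n}(K)=0$ for every $n$ with $2n>c$. In particular, $$a_2(K)\le \frac{c^2}{8}.$$ -/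

import Mathlib

open Polynomial

/-- A signed arrow on a set of points of oriented circles: the tail lies on the over-strand and the
head on the under-strand of a crossing, and `sign` is the sign of that crossing. -/
structure SignedArrow (P : Type) where
  tail : P
  head : P
  sign : ℤˣ

/-- A (signed) Gauss diagram on finitely many oriented circles.  The circles are recorded through a
finite set `P` of marked points: `next p` is the marked point that follows `p` on its circle, so
that the circles are the cycles of `next` (fixed points included), and `p` also stands for the edge
that runs from `p` to `next p`.  The arrows have pairwise distinct endpoints.  Marked points that
are no endpoints of arrows are allowed; they only subdivide the circles. -/
structure GaussDiagram (P : Type) where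
  finite : Finite P
  next : Equiv.Perm P
  arrows : Set (SignedArrow P)
  tail_inj : ∀ a ∈ arrows, ∀ b ∈ arrows, a.tail = b.tail → a = b
  head_inj : ∀ a ∈ arrows, ∀ b ∈ arrows, a.head = b.head → a = b
  tail_ne_head : ∀ a ∈ arrows, ∀ b ∈ arrows, a.tail ≠ b.head

namespace SignedArrow

variable {P : Type}

/-- At every crossing, rotate the picture so that one strand runs from west to east and the other
one from south to north.  At a positive crossing the eastward strand is the over-strand, at a
negative crossing it is the under-strand. -/
def east (a : SignedArrow P) : P := if a.sign = 1 then a.tail else a.head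

/-- The strand that runs from south to north at the crossing. -/
def north (a : SignedArrow P) : P := if a.sign = 1 then a.head else a.tail

/-- The arrow after exchanging the over-strand and the under-strand of the crossing. -/
def change (a : SignedArrow P) : SignedArrow P := ⟨a.head, a.tail, -a.sign⟩

/-- The image of an arrow under a map of the marked points. -/
def map {Q : Type} (f : P → Q) (a : SignedArrow P) : SignedArrow Q := ⟨f a.tail, f a.head, a.sign⟩

end SignedArrow

namespace GaussDiagram

variable {P : Type}

/-- A marked point that is no endpoint of an arrow. -/
def IsPlain (D : GaussDiagram P) (p : P) : Prop := ∀ a ∈ D.arrows, a.tail ≠ p ∧ a.head ≠ p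

/-- Sides of edges: `(p, true)` is the left-hand side and `(p, false)` the right-hand side of the
edge from `p` to `next p`.  `D.Corner a d e` says that the sides `d` and `e` meet in one of the
four corners (north-east, north-west, south-west, south-east) of the crossing `a`. -/
inductive Corner (D : GaussDiagram P) (a : SignedArrow P) : P × Bool → P × Bool → Prop
  | northEast : Corner D a (a.east, true) (a.north, false)
  | northWest : Corner D a (D.next.symm a.east, true) (a.north, true)
  | southWest : Corner D a (D.next.symm a.east, false) (D.next.symm a.north, true)
  | southEast : Corner D a (a.east, false) (D.next.symm a.north, false)

/-- Two sides of edges that are consecutive on the boundary of a region of the diagram: they share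
a corner of a crossing, or they are the same side before and after a plain point. -/
inductive SideAdj (D : GaussDiagram P) : P × Bool → P × Bool → Prop
  | corner {a : SignedArrow P} (ha : a ∈ D.arrows) {d e : P × Bool} (h : D.Corner a d e) :
      SideAdj D d e
  | plain {p : P} (hp : D.IsPlain p) (s : Bool) : SideAdj D (D.next.symm p, s) (p, s)

/-- Two marked points that are joined by an edge or that are the two passages of one crossing. -/
inductive PointAdj (D : GaussDiagram P) : P → P → Prop
  | edge (p : P) : PointAdj D p (D.next p)
  | crossing {a : SignedArrow P} (ha : a ∈ D.arrows) : PointAdj D a.tail a.head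

/-- The regions (faces) of the surface that carries the diagram. -/
def Region (D : GaussDiagram P) : Type := Quot D.SideAdj

/-- The connected components of the underlying four-valent graph (circles without crossings
included). -/
def Piece (D : GaussDiagram P) : Type := Quot D.PointAdj

/-- The number of crossings. -/
noncomputable def numCrossings (D : GaussDiagram P) : ℕ := D.arrows.ncard

/-- The Gauss diagram is that of a link diagram on the sphere: every connected piece has genus zero.
The underlying graph has `|P| - (number of crossings)` vertices and `|P|` edges, so its Euler
characteristic on the carrying surface is `#Region - #crossings`.  A connected piece contributes at
most `2`, with equality exactly if it lies on a sphere. -/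
def IsPlanar (D : GaussDiagram P) : Prop :=
  Nat.card D.Region = D.numCrossings + 2 * Nat.card D.Piece

end GaussDiagram

/-- An oriented link diagram on the sphere, recorded through its Gauss diagram.  A diagram that is not
connected is recorded through its connected pieces; how split pieces lie in the regions of one
another is not recorded, since the link does not depend on it. -/
structure LinkDiagram (P : Type) extends GaussDiagram P where
  planar : toGaussDiagram.IsPlanar

namespace LinkDiagram

variable {P Q : Type}

/-- The diagram has exactly one component. -/
def IsKnot (D : LinkDiagram P) : Prop := Nonempty P ∧ D.next.IsCycleOn Set.univ

/-- The same diagram with renamed points. -/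
def Relabel (D : LinkDiagram P) (E : LinkDiagram Q) : Prop :=
  ∃ f : P ≃ Q, (∀ p, E.next (f p) = f (D.next p)) ∧ E.arrows = SignedArrow.map f '' D.arrows

/-- `E` is obtained from `D` by placing one additional plain point `m` on an edge. -/
def Subdivide (D : LinkDiagram P) (E : LinkDiagram Q) : Prop :=
  ∃ (f : P → Q) (m : Q), Function.Injective f ∧ (∀ q, q = m ↔ q ∉ Set.range f) ∧
    E.next m ≠ m ∧
    (∀ p, E.next (f p) = f (D.next p) ∨ (E.next (f p) = m ∧ E.next m = f (D.next p))) ∧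
    E.arrows = SignedArrow.map f '' D.arrows

/-- First Reidemeister move: a kink, i.e. a crossing whose two passages follow one another, is
removed from `D`.  The two passages become plain points. -/
def Reidemeister1 (D E : LinkDiagram P) : Prop :=
  ∃ a ∈ D.arrows, (D.next a.tail = a.head ∨ D.next a.head = a.tail) ∧
    E.next = D.next ∧ E.arrows = D.arrows \ {a}

/-- Second Reidemeister move: two crossings of opposite signs that follow one another both on the
over-strand and on the under-strand (and so bound a bigon) are removed from `D`. -/
def Reidemeister2 (D E : LinkDiagram P) : Prop :=
  ∃ a ∈ D.arrows, ∃ b ∈ D.arrows, a.sign = -b.sign ∧ D.next a.tail = b.tail ∧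
    (D.next a.head = b.head ∨ D.next b.head = a.head) ∧
    E.next = D.next ∧ E.arrows = D.arrows \ {a, b}

/-- The edge `e` runs between `p` and `q`, in one of the two directions. -/
def Joins (D : LinkDiagram P) (e p q : P) : Prop :=
  (e = p ∧ D.next p = q) ∨ (e = q ∧ D.next q = p)

/-- The two sides `d` and `e` meet in a corner of the crossing `a`. -/
def Meet (D : LinkDiagram P) (a : SignedArrow P) (d e : P × Bool) : Prop :=
  D.Corner a d e ∨ D.Corner a e d

/-- Third Reidemeister move.  The crossing `a` is one of a top strand over a middle strand, `b` one of
the top strand over a bottom strand, and `c` one of the middle strand over the bottom strand.  An edge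
`t` of the top strand, `m` of the middle strand and `u` of the bottom strand bound a triangular
region.  The move exchanges the order of the two crossings on each of the three strands. -/
def Reidemeister3 (D E : LinkDiagram P) : Prop :=
  ∃ a ∈ D.arrows, ∃ b ∈ D.arrows, ∃ c ∈ D.arrows, a ≠ b ∧ b ≠ c ∧ a ≠ c ∧
    (∃ (t m u : P) (i j k : Bool),
      D.Joins t a.tail b.tail ∧ D.Joins m a.head c.tail ∧ D.Joins u b.head c.head ∧
      D.Meet a (t, i) (m, j) ∧ D.Meet c (m, j) (u, k) ∧ D.Meet b (u, k) (t, i)) ∧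
    E.next = D.next ∧
    E.arrows = (D.arrows \ {a, b, c}) ∪
      {⟨b.tail, c.tail, a.sign⟩, ⟨a.tail, c.head, b.sign⟩, ⟨a.head, b.head, c.sign⟩}

/-- Two diagrams represent the same oriented link: they are related by finitely many Reidemeister
moves (up to renaming and inserting or deleting plain points). -/
inductive SameLink : {P Q : Type} → LinkDiagram P → LinkDiagram Q → Prop
  | relabel {P Q : Type} {D : LinkDiagram P} {E : LinkDiagram Q} : Relabel D E → SameLink D E
  | subdivide {P Q : Type} {D : LinkDiagram P} {E : LinkDiagram Q} : Subdivide D E → SameLink D E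
  | reidemeister1 {P : Type} {D E : LinkDiagram P} : Reidemeister1 D E → SameLink D E
  | reidemeister2 {P : Type} {D E : LinkDiagram P} : Reidemeister2 D E → SameLink D E
  | reidemeister3 {P : Type} {D E : LinkDiagram P} : Reidemeister3 D E → SameLink D E
  | symm {P Q : Type} {D : LinkDiagram P} {E : LinkDiagram Q} : SameLink D E → SameLink E D
  | trans {P Q R : Type} {D : LinkDiagram P} {E : LinkDiagram Q} {F : LinkDiagram R} :
      SameLink D E → SameLink E F → SameLink D F

/-- The crossing number of the link represented by `D`: the least number of crossings of a diagram of
that link. -/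
noncomputable def crossingNumber (D : LinkDiagram P) : ℕ :=
  sInf {c | ∃ (Q : Type) (E : LinkDiagram Q), SameLink D E ∧ E.numCrossings = c}

open Classical in
/-- `A`, `B`, `C` differ only at one crossing, which is positive in `A`, negative in `B`, and smoothed
according to the orientation in `C`. -/
def SkeinTriple (A B C : LinkDiagram P) : Prop :=
  ∃ a ∈ A.arrows, a.sign = 1 ∧
    (B.next = A.next ∧ B.arrows = insert a.change (A.arrows \ {a})) ∧
    (C.next = A.next * Equiv.swap a.tail a.head ∧ C.arrows = A.arrows \ {a})

/-- `HasConwayPolynomial D p`: the polynomial `p = ∇(z)` is the Conway polynomial of the oriented link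
represented by `D`, i.e. it is computed by the rules that `∇` is a link invariant, that it is `1` for
the unknot, and that `∇(L₊) - ∇(L₋) = z ∇(L₀)` (two of the three terms determine the third one). -/
inductive HasConwayPolynomial : {P : Type} → LinkDiagram P → ℤ[X] → Prop
  | unknot {P : Type} {D : LinkDiagram P} : D.IsKnot → D.arrows = ∅ → HasConwayPolynomial D 1
  | sameLink {P Q : Type} {D : LinkDiagram P} {E : LinkDiagram Q} {p : ℤ[X]} :
      SameLink D E → HasConwayPolynomial D p → HasConwayPolynomial E p
  | positive {P : Type} {A B C : LinkDiagram P} {p q r : ℤ[X]} : SkeinTriple A B C →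
      HasConwayPolynomial B q → HasConwayPolynomial C r → p - q = X * r → HasConwayPolynomial A p
  | negative {P : Type} {A B C : LinkDiagram P} {p q r : ℤ[X]} : SkeinTriple A B C →
      HasConwayPolynomial A p → HasConwayPolynomial C r → p - q = X * r → HasConwayPolynomial B q
  | smoothed {P : Type} {A B C : LinkDiagram P} {p q r : ℤ[X]} : SkeinTriple A B C →
      HasConwayPolynomial A p → HasConwayPolynomial B q → p - q = X * r → HasConwayPolynomial C r

end LinkDiagram

/-!
The Conway polynomial of a diagram is computed as a state sum, and the bound is obtained by counting
the states that can contribute.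

Fix a base point of the diagram.  A *state* is a set `S` of crossings to be smoothed; it counts
(`StateSum.Good`) if the smoothed diagram has one component and if the walk along this component from
the base point meets every smoothed crossing first on its upper passage.  A state that counts
contributes the product of its signs times `X ^ |S|` to the sum (`StateSum.stateSum`,
`GaussDiagram.conway`).

*The sum satisfies the skein relation*, for a fixed base point, directly from the definition
(`StateSum.stateSum_skein`).

*It does not depend on the base point* (`StateSum.stateSum_base`).  This is where planarity is needed.
Consider a walk that, whenever it arrives at an upper passage, stays on its strand with weight `c` or
drops to the lower passage with weight `1 - c`, where `c` is `t` or `t⁻¹` according to the sign of the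
crossing.  The
determinant of the diagram cut open at the base point (`StateSum.basedDet`) satisfies a skein relation
as well, so that by induction along skein trees it agrees with the state sum at `z = s⁻¹ - s`,
`t = s ^ 2`, up to a power of `s` (`StateSum.stateSum_eq_basedDet`); it suffices to compare the two on
ascending knots and on layered links.  The dependence of the determinant on the base point is read off
from a left kernel vector of the uncut matrix, whose entries are powers of `t` given by an Alexander
numbering of the regions.  The normalising power of `s` requires that all states with one component
have the same turning (`StateSum.turning_eq`).  Both facts need that every flow on every smoothing is
the boundary of a function on the regions, which follows from the Euler characteristic in
`GaussDiagram.IsPlanar` by counting dimensions (`GaussDiagram.IsPlanar.hasPotentials`).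

*It is invariant under Reidemeister moves*.  Whether a state counts depends on the inside of the tangle
in which the move takes place only through the way in which the smoothed tangle connects its strands and
through the order in which the strands are entered.  So the second and the third move reduce to finite
tables (`Tangle.stateSum_tangle_congr`, `Tangle.bigon_table`, `Tangle.triangle_table`).  Therefore the
state sum is the Conway polynomial (`LinkDiagram.HasConwayPolynomial.eq_conway`).

*Counting*.  Exchanging the roles of the two passages of all crossings does not change the sum
(`StateSum.stateSum_flip`).  No non-empty state counts in both versions of the sum, and a state counts
in neither of them if its crossings are met all in the same order by the walk along the knot itself.  If
`t` crossings of a minimal diagram are met first on the upper passage and `u` of them first on the lower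
passage, this yields `2 * |a_k| ≤ c.choose k - t.choose k - u.choose k` with `t + u = c`
(`StateSum.two_mul_abs_coeff_add_choose_le`), and the last two terms are bounded by convexity of the
binomial coefficients.  This fails only if `c` is odd and less than `2 * k - 1`; then
`2 * Ring.choose (c / 2) k ≤ 1`, and it suffices to find one state that counts in neither version, for
a suitable base point (`StateSum.not_good_of_adjacent`).
-/

/-! ### Walks of a map -/

namespace Walk

variable {P Q : Type*}

/-- `Path g Z b p`: the walk `b, g b, g (g b), …` reaches `p`, and up to then none of its points after
the starting point lies in `Z`. -/
def Path (g : P → P) (Z : Set P) (b p : P) : Prop :=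
  Relation.ReflTransGen (fun x y => y = g x ∧ y ∉ Z) b p

/-- The walk of `g` that starts at `b` passes through every point. -/
def Covers (g : P → P) (b : P) : Prop := ∀ p, Path g ∅ b p

/-- The walk of `g` that starts at `b` reaches `p`, and has not met `q` up to then. -/
def Before (g : P → P) (b p q : P) : Prop := b ≠ q ∧ Path g {q} b p

/-- The number of steps after which the walk of `g` from `b` first reaches `p`; it has the junk value
`0` if `p` is not reached. -/
noncomputable def arrival (g : P → P) (b p : P) : ℕ := sInf {k | g^[k] b = p}

theorem path_iff {g : P → P} {Z : Set P} {b p : P} :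
    Path g Z b p ↔ ∃ k, g^[k] b = p ∧ ∀ j, j < k → g^[j + 1] b ∉ Z := by
  constructor
  · intro h
    induction h with
    | refl => exact ⟨0, rfl, by simp⟩
    | tail _ hxy ih =>
      obtain ⟨k, hk, hj⟩ := ih
      refine ⟨k + 1, by rw [Function.iterate_succ_apply', hk, hxy.1], fun j hjk => ?_⟩
      rcases Nat.lt_succ_iff_lt_or_eq.mp hjk with h | rfl
      · exact hj j h
      · rw [Function.iterate_succ_apply', hk, ← hxy.1]
        exact hxy.2
  · rintro ⟨k, rfl, hj⟩
    induction k with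
    | zero => exact .refl
    | succ k ih =>
      refine .tail (ih fun j hjk => hj j (by omega)) ⟨Function.iterate_succ_apply' .., hj k (by omega)⟩

theorem path_empty_iff {g : P → P} {b p : P} : Path g ∅ b p ↔ ∃ k, g^[k] b = p := by
  simp [path_iff]

theorem before_iff {g : P → P} {b p q : P} :
    Before g b p q ↔ ∃ k, g^[k] b = p ∧ ∀ j ≤ k, g^[j] b ≠ q := by
  rw [Before, path_iff]
  constructor
  · rintro ⟨hb, k, hk, hj⟩
    refine ⟨k, hk, fun j hjk => ?_⟩
    cases j with
    | zero => exact hb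
    | succ j => exact hj j (by omega)
  · rintro ⟨k, hk, hj⟩
    exact ⟨hj 0 (by omega), k, hk, fun j hjk => hj (j + 1) (by omega)⟩

theorem iterate_arrival {g : P → P} {b p : P} (h : Path g ∅ b p) : g^[arrival g b p] b = p :=
  Nat.sInf_mem (s := {k | g^[k] b = p}) (path_empty_iff.1 h)

theorem arrival_le {g : P → P} {b p : P} {k : ℕ} (h : g^[k] b = p) : arrival g b p ≤ k :=
  Nat.sInf_le h

theorem arrival_self (g : P → P) (b : P) : arrival g b b = 0 :=
  Nat.le_zero.1 (arrival_le rfl)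

theorem arrival_inj {g : P → P} {b p q : P} (hp : Path g ∅ b p) (hq : Path g ∅ b q)
    (h : arrival g b p = arrival g b q) : p = q := by
  rw [← iterate_arrival hp, ← iterate_arrival hq, h]

theorem Path.step {g : P → P} {b p : P} (h : Path g ∅ b p) : Path g ∅ b (g p) :=
  .tail h ⟨rfl, by simp⟩

theorem arrival_step {g : P → P} (hg : g.Injective) {b p : P} (hp : Path g ∅ b p)
    (hb : g p ≠ b) : arrival g b (g p) = arrival g b p + 1 := by
  apply le_antisymm
  · exact arrival_le (by rw [Function.iterate_succ_apply', iterate_arrival hp])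
  · have h := iterate_arrival hp.step
    cases hm : arrival g b (g p) with
    | zero => rw [hm] at h; exact absurd h.symm hb
    | succ m =>
      rw [hm, Function.iterate_succ_apply'] at h
      have := arrival_le (hg h)
      omega

theorem before_iff_arrival_lt {g : P → P} {b p q : P} (hp : Path g ∅ b p) (hq : Path g ∅ b q) :
    Before g b p q ↔ arrival g b p < arrival g b q := by
  rw [before_iff]
  constructor
  · rintro ⟨k, hk, hj⟩
    by_contra! hlt
    exact hj (arrival g b q) (hlt.trans (arrival_le hk)) (iterate_arrival hq)
  · intro h
    refine ⟨_, iterate_arrival hp, fun j hj hjq => ?_⟩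
    have := arrival_le hjq
    omega

/-- The arrival time is determined by its recursion along the walk. -/
theorem eq_arrival {g : P → P} (hg : g.Injective) {b : P} {f : P → ℕ} (h0 : f b = 0)
    (hs : ∀ p, Path g ∅ b p → g p ≠ b → f (g p) = f p + 1) {p : P} (hp : Path g ∅ b p) :
    f p = arrival g b p := by
  induction hp with
  | refl => rw [h0, arrival_self]
  | @tail x _ hx hxy ih =>
    obtain ⟨rfl, -⟩ := hxy
    by_cases hb : g x = b
    · rw [hb, h0, arrival_self]
    · rw [hs _ hx hb, arrival_step hg hx hb, ih]

/-- A set that contains the starting point and is preserved by the steps out of reached points of the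
set contains the whole walk. -/
theorem mem_of_path {g : P → P} {b p : P} {C : Set P} (hb : b ∈ C)
    (hC : ∀ x, Path g ∅ b x → x ∈ C → g x ∈ C) (hp : Path g ∅ b p) : p ∈ C := by
  induction hp with
  | refl => exact hb
  | tail hx hxy ih =>
    obtain ⟨rfl, -⟩ := hxy
    exact hC _ hx ih

/-- If `g'` is the return map of `g` to the complement of `I`, then every point on a walk of `g` is
passed on the way from a point on the walk of `g'` to the next one. -/
theorem exists_path_return {g g' : P → P} {I Z : Set P}
    (hsim : ∀ p ∉ I, g' p ∉ I ∧ ∃ k, g^[k + 1] p = g' p ∧ ∀ j < k, g^[j + 1] p ∈ I)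
    {b x : P} (hb : b ∉ I) (hx : Path g Z b x) :
    ∃ y ∉ I, Path g' Z b y ∧ ∃ j k, g^[k + 1] y = g' y ∧
      (∀ j < k, g^[j + 1] y ∈ I) ∧ j ≤ k ∧ x = g^[j] y := by
  induction hx with
  | refl =>
    obtain ⟨-, k, hk, hj⟩ := hsim b hb
    exact ⟨b, hb, .refl, 0, k, hk, hj, by omega, rfl⟩
  | @tail x x' _ hxy ih =>
    obtain ⟨y, hy, hby, j, k, hk, hI, hjk, rfl⟩ := ih
    obtain ⟨h1, h2⟩ := hxy
    rw [← Function.iterate_succ_apply' g] at h1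
    rcases hjk.lt_or_eq with hlt | rfl
    · exact ⟨y, hy, hby, j + 1, k, hk, hI, hlt, h1⟩
    · obtain ⟨h3, -⟩ := hsim y hy
      rw [hk] at h1
      obtain ⟨-, k', hk', hj'⟩ := hsim (g' y) h3
      exact ⟨g' y, h3, .tail hby ⟨rfl, h1 ▸ h2⟩, 0, k', hk', hj', by omega, h1⟩

/-- If `g'` is the return map of `g` to the complement of `I`, then the two walks visit the points
outside `I` in the same order. -/
theorem path_return {g g' : P → P} {I Z : Set P}
    (hsim : ∀ p ∉ I, g' p ∉ I ∧ ∃ k, g^[k + 1] p = g' p ∧ ∀ j < k, g^[j + 1] p ∈ I)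
    (hZ : ∀ x ∈ I, x ∉ Z) {b p : P} (hb : b ∉ I) (hp : p ∉ I) :
    Path g Z b p ↔ Path g' Z b p := by
  constructor
  · intro h
    obtain ⟨y, hy, hby, j, k, hk, hI, hjk, rfl⟩ := exists_path_return hsim hb h
    cases j with
    | zero => exact hby
    | succ j => exact absurd (hI j (by omega)) hp
  · intro h
    clear hp
    have key : ∀ x, Path g' Z b x → x ∉ I ∧ Path g Z b x := by
      intro x hx
      induction hx with
      | refl => exact ⟨hb, .refl⟩
      | @tail x x' _ hxy ih =>
        obtain ⟨hxI, hxp⟩ := ih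
        obtain ⟨rfl, hxZ⟩ := hxy
        obtain ⟨h1, k, hk, hI⟩ := hsim x hxI
        refine ⟨h1, hxp.trans (path_iff.2 ⟨k + 1, hk, fun j hj => ?_⟩)⟩
        rcases Nat.lt_succ_iff_lt_or_eq.mp hj with hlt | rfl
        · exact hZ _ (hI j hlt)
        · rwa [hk]
    exact (key p h).2

theorem path_semiconj {f : P → Q} (hf : f.Injective) {g : P → P} {h : Q → Q}
    (hfg : ∀ p, h (f p) = f (g p)) {Z : Set Q} {b p : P} :
    Path h Z (f b) (f p) ↔ Path g (f ⁻¹' Z) b p := by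
  have hit : ∀ k, h^[k] (f b) = f (g^[k] b) := by
    intro k
    induction k with
    | zero => rfl
    | succ k ih => rw [Function.iterate_succ_apply', ih, hfg, ← Function.iterate_succ_apply' g]
  simp only [path_iff, hit, hf.eq_iff, Set.mem_preimage]

theorem path_symm [Finite P] {g : Equiv.Perm P} {b p : P} (h : Path g ∅ b p) : Path g ∅ p b := by
  obtain ⟨k, rfl⟩ := path_empty_iff.1 h
  refine path_empty_iff.2 ⟨orderOf g * k - k, ?_⟩
  have ho := orderOf_pos g
  rw [← Function.iterate_add_apply, Nat.sub_add_cancel (Nat.le_mul_of_pos_left k ho),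
    ← Equiv.Perm.coe_pow, pow_mul, pow_orderOf_eq_one, one_pow]
  rfl

theorem Covers.symm [Finite P] {g : Equiv.Perm P} {b : P} (h : Covers g b) (c : P) :
    Covers g c :=
  fun p => (path_symm (h c)).trans (h p)

end Walk

/-! ### The state sum of a diagram with a base point -/

namespace StateSum
open Walk

variable {P Q ι κ R : Type*}

/-- The endpoints `tl i`, `hd i` of the crossings `i ∈ Y` are pairwise distinct points. -/
structure Distinct (tl hd : ι → P) (Y : Finset ι) : Prop where
  tl_inj : ∀ i ∈ Y, ∀ j ∈ Y, tl i = tl j → i = j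
  hd_inj : ∀ i ∈ Y, ∀ j ∈ Y, hd i = hd j → i = j
  ne : ∀ i ∈ Y, ∀ j ∈ Y, tl i ≠ hd j

theorem Distinct.mono {tl hd : ι → P} {Y S : Finset ι} (h : Distinct tl hd Y) (hS : S ⊆ Y) :
    Distinct tl hd S :=
  ⟨fun i hi j hj => h.tl_inj i (hS hi) j (hS hj), fun i hi j hj => h.hd_inj i (hS hi) j (hS hj),
    fun i hi j hj => h.ne i (hS hi) j (hS hj)⟩

theorem Distinct.swap {tl hd : ι → P} {Y : Finset ι} (h : Distinct tl hd Y) : Distinct hd tl Y :=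
  ⟨h.hd_inj, h.tl_inj, fun i hi j hj e => h.ne j hj i hi e.symm⟩

open scoped Classical in
/-- The permutation that exchanges the two endpoints of every crossing in `S`.  Composing the
successor permutation of a diagram with it smooths these crossings. -/
noncomputable def pairing (tl hd : ι → P) (S : Finset ι) : Equiv.Perm P :=
  (S.toList.map fun i => Equiv.swap (tl i) (hd i)).prod

section Pairing
variable {tl hd : ι → P} {Y S T : Finset ι} {i : ι} {p : P}

open scoped Classical in
theorem pairing_of_ne (h : ∀ i ∈ S, p ≠ tl i ∧ p ≠ hd i) : pairing tl hd S p = p := by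
  have key : ∀ l : List ι, (∀ i ∈ l, p ≠ tl i ∧ p ≠ hd i) →
      (l.map fun i => Equiv.swap (tl i) (hd i)).prod p = p := by
    intro l
    induction l with
    | nil => simp
    | cons a l ih =>
      intro hl
      rw [List.map_cons, List.prod_cons, Equiv.Perm.mul_apply,
        ih fun i hi => hl i (List.mem_cons_of_mem _ hi)]
      exact Equiv.swap_apply_of_ne_of_ne (hl a (by simp)).1 (hl a (by simp)).2
  exact key S.toList (by simpa using h)

open scoped Classical in
theorem pairing_tl (hY : Distinct tl hd S) (hi : i ∈ S) : pairing tl hd S (tl i) = hd i := by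
  have key : ∀ l : List ι, l.Nodup → (∀ j ∈ l, j ∈ S) → i ∈ l →
      (l.map fun i => Equiv.swap (tl i) (hd i)).prod (tl i) = hd i := by
    intro l
    induction l with
    | nil => simp
    | cons a l ih =>
      intro hn hl hil
      rw [List.map_cons, List.prod_cons, Equiv.Perm.mul_apply]
      obtain ⟨han, hn⟩ := List.nodup_cons.1 hn
      by_cases hia : i = a
      · subst hia
        have h2 : ∀ m : List ι, (∀ j ∈ m, j ∈ S ∧ j ≠ i) →
            (m.map fun i => Equiv.swap (tl i) (hd i)).prod (tl i) = tl i := by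
          intro m
          induction m with
          | nil => simp
          | cons b m ihm =>
            intro hm
            rw [List.map_cons, List.prod_cons, Equiv.Perm.mul_apply,
              ihm fun j hj => hm j (List.mem_cons_of_mem _ hj)]
            obtain ⟨hbS, hbi⟩ := hm b (by simp)
            exact Equiv.swap_apply_of_ne_of_ne (fun e => hbi (hY.tl_inj i hi b hbS e).symm)
              (hY.ne i hi b hbS)
        rw [h2 l fun j hj => ⟨hl j (by simp [hj]), fun e => han (e ▸ hj)⟩, Equiv.swap_apply_left]
      · rw [ih hn (fun j hj => hl j (by simp [hj])) (by simpa [hia] using hil)]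
        have haS := hl a (by simp)
        exact Equiv.swap_apply_of_ne_of_ne (fun e => hY.ne a haS i hi e.symm)
          (fun e => hia (hY.hd_inj i hi a haS e))
  exact key S.toList S.nodup_toList (by simp) (by simpa using hi)

theorem pairing_swap (tl hd : ι → P) (S : Finset ι) : pairing tl hd S = pairing hd tl S := by
  simp only [pairing, Equiv.swap_comm]

theorem pairing_hd (hY : Distinct tl hd S) (hi : i ∈ S) : pairing tl hd S (hd i) = tl i := by
  rw [pairing_swap]
  exact pairing_tl hY.swap hi

theorem pairing_cases (hY : Distinct tl hd S) (p : P) :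
    (∃ i ∈ S, p = tl i ∧ pairing tl hd S p = hd i) ∨
      (∃ i ∈ S, p = hd i ∧ pairing tl hd S p = tl i) ∨
        ((∀ i ∈ S, p ≠ tl i ∧ p ≠ hd i) ∧ pairing tl hd S p = p) := by
  by_cases h1 : ∃ i ∈ S, p = tl i
  · obtain ⟨i, hi, rfl⟩ := h1
    exact .inl ⟨i, hi, rfl, pairing_tl hY hi⟩
  by_cases h2 : ∃ i ∈ S, p = hd i
  · obtain ⟨i, hi, rfl⟩ := h2
    exact .inr (.inl ⟨i, hi, rfl, pairing_hd hY hi⟩)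
  push Not at h1 h2
  have h : ∀ i ∈ S, p ≠ tl i ∧ p ≠ hd i := fun i hi => ⟨h1 i hi, h2 i hi⟩
  exact .inr (.inr ⟨h, pairing_of_ne h⟩)

theorem pairing_pairing (hY : Distinct tl hd S) (p : P) :
    pairing tl hd S (pairing tl hd S p) = p := by
  rcases pairing_cases hY p with ⟨i, hi, rfl, h⟩ | ⟨i, hi, rfl, h⟩ | ⟨-, h⟩ <;> rw [h]
  · exact pairing_hd hY hi
  · exact pairing_tl hY hi
  · exact h

theorem pairing_tl_of_notMem (hY : Distinct tl hd Y) (hS : S ⊆ Y) (hi : i ∈ Y) (hiS : i ∉ S) :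
    pairing tl hd S (tl i) = tl i :=
  pairing_of_ne fun j hj => ⟨fun e => hiS (hY.tl_inj i hi j (hS hj) e ▸ hj), hY.ne i hi j (hS hj)⟩

theorem pairing_hd_of_notMem (hY : Distinct tl hd Y) (hS : S ⊆ Y) (hi : i ∈ Y) (hiS : i ∉ S) :
    pairing tl hd S (hd i) = hd i := by
  rw [pairing_swap]
  exact pairing_tl_of_notMem hY.swap hS hi hiS

theorem pairing_congr {tl' hd' : ι → P}
    (h : ∀ i ∈ S, (tl' i = tl i ∧ hd' i = hd i) ∨ (tl' i = hd i ∧ hd' i = tl i)) :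
    pairing tl' hd' S = pairing tl hd S := by
  classical
  unfold pairing
  congr 1
  refine List.map_congr_left fun i hi => ?_
  rcases h i (by simpa using hi) with ⟨h1, h2⟩ | ⟨h1, h2⟩
  · rw [h1, h2]
  · rw [h1, h2, Equiv.swap_comm]

theorem pairing_empty : pairing tl hd ∅ = 1 := by simp [pairing]

open scoped Classical in
theorem pairing_singleton : pairing tl hd {i} = Equiv.swap (tl i) (hd i) := by
  simp [pairing]

open scoped Classical in
theorem pairing_union (hY : Distinct tl hd Y) (hS : S ⊆ Y) (hT : T ⊆ Y) (hST : Disjoint S T) :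
    pairing tl hd (S ∪ T) = pairing tl hd S * pairing tl hd T := by
  have hU := hY.mono (Finset.union_subset hS hT)
  ext p
  rw [Equiv.Perm.mul_apply]
  rcases pairing_cases (hY.mono hT) p with ⟨i, hi, rfl, h⟩ | ⟨i, hi, rfl, h⟩ | ⟨h1, h⟩
  · have hiS : i ∉ S := fun h' => Finset.disjoint_left.1 hST h' hi
    rw [h, pairing_hd_of_notMem hY hS (hT hi) hiS, pairing_tl hU (by simp [hi])]
  · have hiS : i ∉ S := fun h' => Finset.disjoint_left.1 hST h' hi
    rw [h, pairing_tl_of_notMem hY hS (hT hi) hiS, pairing_hd hU (by simp [hi])]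
  · rw [h]
    rcases pairing_cases (hY.mono hS) p with ⟨i, hi, rfl, h'⟩ | ⟨i, hi, rfl, h'⟩ | ⟨h2, h'⟩
    · rw [h', pairing_tl hU (by simp [hi])]
    · rw [h', pairing_hd hU (by simp [hi])]
    · rw [h', pairing_of_ne]
      intro i hi
      rcases Finset.mem_union.1 hi with hi | hi
      exacts [h2 i hi, h1 i hi]

open scoped Classical in
theorem pairing_insert (hY : Distinct tl hd Y) (hS : S ⊆ Y) (hi : i ∈ Y) (hiS : i ∉ S) :
    pairing tl hd (insert i S) = Equiv.swap (tl i) (hd i) * pairing tl hd S := by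
  have h := pairing_union hY (Finset.singleton_subset_iff.2 hi) hS
    (Finset.disjoint_singleton_left.2 hiS)
  rwa [pairing_singleton, ← Finset.insert_eq] at h

end Pairing

/-- A state `S` (a set of crossings to be smoothed) counts if its smoothing has one component, and if
the walk from the base point `b` along it arrives at every smoothed crossing first at `tl`. -/
def Good (σ : Equiv.Perm P) (tl hd : ι → P) (b : P) (S : Finset ι) : Prop :=
  Covers (σ * pairing tl hd S) b ∧ ∀ i ∈ S, Before (σ * pairing tl hd S) b (tl i) (hd i)

open scoped Classical in
/-- The state sum of the diagram with successor permutation `σ`, crossings `Y` with passages `tl`, `hd`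
and signs `w`, and base point on the edge that ends in `b`. -/
noncomputable def stateSum [CommRing R] (z : R) (σ : Equiv.Perm P) (tl hd : ι → P) (w : ι → ℤˣ)
    (Y : Finset ι) (b : P) : R :=
  ∑ S ∈ Y.powerset, if Good σ tl hd b S then ∏ i ∈ S, (((w i : ℤ) : R) * z) else 0

section
variable [CommRing R] {z : R} {σ : Equiv.Perm P} {tl hd : ι → P} {w : ι → ℤˣ} {Y : Finset ι} {b : P}

theorem good_congr {tl' hd' : ι → P} {S : Finset ι} (h : ∀ i ∈ S, tl' i = tl i ∧ hd' i = hd i) :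
    Good σ tl' hd' b S ↔ Good σ tl hd b S := by
  unfold Good
  rw [pairing_congr fun i hi => .inl (h i hi)]
  refine and_congr_right fun _ => forall₂_congr fun i hi => ?_
  rw [(h i hi).1, (h i hi).2]

theorem stateSum_congr {tl' hd' : ι → P} {w' : ι → ℤˣ}
    (h : ∀ i ∈ Y, tl' i = tl i ∧ hd' i = hd i ∧ w' i = w i) :
    stateSum z σ tl' hd' w' Y b = stateSum z σ tl hd w Y b := by
  classical
  unfold stateSum
  refine Finset.sum_congr rfl fun S hS => ?_
  have hS' := Finset.mem_powerset.1 hS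
  rw [Finset.prod_congr rfl fun i hi => by rw [(h i (hS' hi)).2.2]]
  simp only [good_congr fun i hi => ⟨(h i (hS' hi)).1, (h i (hS' hi)).2.1⟩]

theorem before_or_before {g : P → P} {p q : P} (hg : Covers g b) (hpq : p ≠ q) :
    Before g b p q ↔ ¬ Before g b q p := by
  rw [before_iff_arrival_lt (hg p) (hg q), before_iff_arrival_lt (hg q) (hg p)]
  have : arrival g b p ≠ arrival g b q := fun h => hpq (arrival_inj (hg p) (hg q) h)
  omega

open scoped Classical in
/-- The skein relation for the state sum with a fixed base point. -/
theorem stateSum_skein (hY : Distinct tl hd Y) {i : ι} (hi : i ∈ Y) {tl' hd' : ι → P} {w' : ι → ℤˣ}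
    (hne : ∀ j ∈ Y, j ≠ i → tl' j = tl j ∧ hd' j = hd j ∧ w' j = w j)
    (htl : tl' i = hd i) (hhd : hd' i = tl i) (hw : w i = 1) (hw' : w' i = -1) :
    stateSum z σ tl hd w Y b - stateSum z σ tl' hd' w' Y b =
      z * stateSum z (σ * Equiv.swap (tl i) (hd i)) tl hd w (Y.erase i) b := by
  obtain ⟨Z, hiZ, rfl⟩ : ∃ Z, i ∉ Z ∧ Y = insert i Z :=
    ⟨Y.erase i, Finset.notMem_erase _ _, (Finset.insert_erase hi).symm⟩
  rw [Finset.erase_insert hiZ]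
  unfold stateSum
  rw [Finset.sum_powerset_insert hiZ, Finset.sum_powerset_insert hiZ, Finset.mul_sum]
  have h1 : ∀ S ∈ Z.powerset, (if Good σ tl' hd' b S then ∏ i ∈ S, (((w' i : ℤ) : R) * z) else 0) =
      if Good σ tl hd b S then ∏ i ∈ S, (((w i : ℤ) : R) * z) else 0 := by
    intro S hS
    have hS' := Finset.mem_powerset.1 hS
    have hj : ∀ j ∈ S, tl' j = tl j ∧ hd' j = hd j ∧ w' j = w j := fun j hj =>
      hne j (Finset.mem_insert_of_mem (hS' hj)) (fun e => hiZ (hS' (e ▸ hj)))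
    rw [Finset.prod_congr rfl fun i hi => by rw [(hj i hi).2.2]]
    simp only [good_congr fun i hi => ⟨(hj i hi).1, (hj i hi).2.1⟩]
  rw [Finset.sum_congr rfl h1, add_sub_add_left_eq_sub, ← Finset.sum_sub_distrib]
  refine Finset.sum_congr rfl fun S hS => ?_
  have hS' := Finset.mem_powerset.1 hS
  have hiS : i ∉ S := fun h => hiZ (hS' h)
  have hj : ∀ j ∈ S, tl' j = tl j ∧ hd' j = hd j ∧ w' j = w j := fun j hj =>
    hne j (Finset.mem_insert_of_mem (hS' hj)) (fun e => hiZ (hS' (e ▸ hj)))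
  have hg : σ * pairing tl hd (insert i S) = σ * Equiv.swap (tl i) (hd i) * pairing tl hd S := by
    rw [pairing_insert hY (hS'.trans (Finset.subset_insert _ _)) hi hiS, mul_assoc]
  have hg' : pairing tl' hd' (insert i S) = pairing tl hd (insert i S) := by
    refine pairing_congr fun j hj' => ?_
    rcases Finset.mem_insert.1 hj' with rfl | hj'
    · exact .inr ⟨htl, hhd⟩
    · exact .inl ⟨(hj j hj').1, (hj j hj').2.1⟩
  have hprod : ∏ j ∈ S, (((w' j : ℤ) : R) * z) = ∏ j ∈ S, (((w j : ℤ) : R) * z) :=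
    Finset.prod_congr rfl fun j hjS => by rw [(hj j hjS).2.2]
  rw [Finset.prod_insert hiS, Finset.prod_insert hiS, hw, hw', hprod]
  have e1 : Good σ tl hd b (insert i S) ↔ Good (σ * Equiv.swap (tl i) (hd i)) tl hd b S ∧
      Before (σ * pairing tl hd (insert i S)) b (tl i) (hd i) := by
    unfold Good
    rw [hg, Finset.forall_mem_insert]
    tauto
  have e2 : Good σ tl' hd' b (insert i S) ↔ Good (σ * Equiv.swap (tl i) (hd i)) tl hd b S ∧
      Before (σ * pairing tl hd (insert i S)) b (hd i) (tl i) := by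
    unfold Good
    rw [hg', hg, Finset.forall_mem_insert, htl, hhd,
      forall₂_congr fun j hj' => by rw [(hj j hj').1, (hj j hj').2.1]]
    tauto
  simp only [e1, e2]
  by_cases hgood : Good (σ * Equiv.swap (tl i) (hd i)) tl hd b S
  · have := before_or_before (g := ⇑(σ * pairing tl hd (insert i S))) (b := b) (hg ▸ hgood.1)
      (hY.ne i hi i hi)
    by_cases hB : Before (σ * pairing tl hd (insert i S)) b (hd i) (tl i)
    · simp only [hgood, hB, this, true_and, not_true_eq_false, if_true, if_false]
      push_cast
      ring
    · simp only [hgood, hB, this, true_and, not_false_eq_true, if_true, if_false]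
      push_cast
      ring
  · simp only [hgood, false_and, if_false, sub_zero, mul_zero]

/-- If the crossings lead from the component of the base point only into this component, then no state
of a diagram with further components counts. -/
theorem not_good_of_closed (hY : Distinct tl hd Y) {C : Set P} (hb : b ∈ C)
    (hσ : ∀ p ∈ C, σ p ∈ C) (hC : ∀ i ∈ Y, tl i ∈ C → hd i ∈ C) (hne : ∃ q, q ∉ C)
    {S : Finset ι} (hS : S ⊆ Y) : ¬ Good σ tl hd b S := by
  rintro ⟨hcov, hbef⟩
  obtain ⟨q, hq⟩ := hne
  have key : ∀ k, (⇑(σ * pairing tl hd S))^[k] b ∈ C := by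
    intro k
    induction k using Nat.strong_induction_on with
    | _ k ih =>
      cases k with
      | zero => exact hb
      | succ k =>
        rw [Function.iterate_succ_apply', Equiv.Perm.mul_apply]
        apply hσ
        have hk := ih k (by omega)
        rcases pairing_cases (hY.mono hS) ((⇑(σ * pairing tl hd S))^[k] b) with
          ⟨i, hi, h, h'⟩ | ⟨i, hi, h, h'⟩ | ⟨-, h'⟩
        · rw [h']
          exact hC i (hS hi) (h ▸ hk)
        · rw [h']
          obtain ⟨m, hm, hm'⟩ := before_iff.1 (hbef i hi)
          rw [← hm]
          refine ih m ?_
          by_contra! hlt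
          exact hm' k (by omega) h
        · rwa [h']
  obtain ⟨k, hk⟩ := path_empty_iff.1 (hcov q)
  exact hq (hk ▸ key k)

theorem stateSum_eq_zero (hY : Distinct tl hd Y) {C : Set P} (hb : b ∈ C)
    (hσ : ∀ p ∈ C, σ p ∈ C) (hC : ∀ i ∈ Y, tl i ∈ C → hd i ∈ C) (hne : ∃ q, q ∉ C) :
    stateSum z σ tl hd w Y b = 0 := by
  classical
  exact Finset.sum_eq_zero fun S hS =>
    if_neg (not_good_of_closed hY hb hσ hC hne (Finset.mem_powerset.1 hS))

/-- The first endpoint of a smoothed crossing that the walk meets is the same before and after the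
smoothing, so it has to be a `tl`. -/
theorem not_good_of_hd_first {S : Finset ι} (hS : S.Nonempty) (hcov : Covers σ b)
    (hfirst : ∀ i ∈ S, Before σ b (hd i) (tl i)) : ¬ Good σ tl hd b S := by
  rintro ⟨-, hbef⟩
  obtain ⟨i, hi, hmin⟩ := S.exists_min_image (fun i => arrival σ b (hd i)) hS
  have hlt : ∀ j ∈ S, arrival σ b (hd j) < arrival σ b (tl j) := fun j hj =>
    (before_iff_arrival_lt (hcov _) (hcov _)).1 (hfirst j hj)
  have key : ∀ k ≤ arrival σ b (hd i), (⇑(σ * pairing tl hd S))^[k] b = σ^[k] b := by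
    intro k
    induction k with
    | zero => simp
    | succ k ih =>
      intro hk
      rw [Function.iterate_succ_apply', Function.iterate_succ_apply', ih (by omega),
        Equiv.Perm.mul_apply, pairing_of_ne]
      intro j hj
      have h1 := hmin j hj
      have h2 := hlt j hj
      exact ⟨fun e => by have := arrival_le (g := σ) e; omega,
        fun e => by have := arrival_le (g := σ) e; omega⟩
  obtain ⟨m, hm, hm'⟩ := before_iff.1 (hbef i hi)
  have hmi : m < arrival σ b (hd i) := by
    by_contra! hle
    exact hm' _ hle (by rw [key _ le_rfl, iterate_arrival (hcov _)])
  rw [key m hmi.le] at hm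
  have h1 := arrival_le (g := σ) hm
  have h2 := hlt i hi
  omega

theorem stateSum_eq_one (hcov : Covers σ b) (hfirst : ∀ i ∈ Y, Before σ b (hd i) (tl i)) :
    stateSum z σ tl hd w Y b = 1 := by
  classical
  unfold stateSum
  rw [Finset.sum_eq_single ∅]
  · have : Good σ tl hd b ∅ := ⟨by simpa [pairing_empty] using hcov, by simp⟩
    simp [this]
  · intro S hS hne
    have hS' := Finset.mem_powerset.1 hS
    exact if_neg (not_good_of_hd_first (Finset.nonempty_iff_ne_empty.2 hne) hcov
      fun i hi => hfirst i (hS' hi))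
  · simp

/-- If the diagram is a knot that meets every crossing of `S` first at `tl`, then a walk that uses
these crossings from `tl` only jumps forward, so that it skips a part of the knot forever. -/
theorem not_good_of_tl_first {S : Finset ι} (hY : Distinct tl hd S) (hS : S.Nonempty)
    (hcov : Covers σ b) (hfirst : ∀ i ∈ S, Before σ b (tl i) (hd i)) : ¬ Good σ tl hd b S := by
  rintro ⟨hcov', hbef⟩
  set g := σ * pairing tl hd S with hg
  have hlt : ∀ j ∈ S, arrival σ b (tl j) < arrival σ b (hd j) := fun j hj =>
    (before_iff_arrival_lt (hcov _) (hcov _)).1 (hfirst j hj)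
  have nohd : ∀ K, (∀ j, 1 ≤ j → j ≤ K → g^[j] b ≠ b) →
      (∀ j ≤ K, arrival σ b (g^[j] b) ≤ arrival σ b (g^[K] b)) → ∀ i ∈ S, g^[K] b ≠ hd i := by
    intro K hK hinc i hi hKi
    obtain ⟨m, hm, hm'⟩ := before_iff.1 (hbef i hi)
    have hmK : m < K := by
      by_contra! hle
      exact hm' K hle hKi
    have h1 : g^[m + 1] b = σ (hd i) := by
      rw [Function.iterate_succ_apply', hm, hg, Equiv.Perm.mul_apply, pairing_tl hY hi]
    have h2 := hinc (m + 1) hmK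
    have h3 : σ (hd i) ≠ b := h1 ▸ hK (m + 1) (by omega) hmK
    rw [h1, hKi, arrival_step σ.injective (hcov _) h3] at h2
    omega
  have inc : ∀ K, (∀ j, 1 ≤ j → j ≤ K → g^[j] b ≠ b) →
      ∀ j ≤ K, arrival σ b (g^[j] b) ≤ arrival σ b (g^[K] b) := by
    intro K
    induction K with
    | zero =>
      intro _ j hj
      rw [Nat.le_zero.1 hj]
    | succ K ih =>
      intro hK
      have ihK := ih fun j h1 h2 => hK j h1 (by omega)
      have hstep : arrival σ b (g^[K] b) ≤ arrival σ b (g^[K + 1] b) := by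
        have hne := hK (K + 1) (by omega) le_rfl
        rw [Function.iterate_succ_apply'] at hne ⊢
        rcases pairing_cases hY (g^[K] b) with ⟨i, hi, h, h'⟩ | ⟨i, hi, h, -⟩ | ⟨-, h'⟩
        · have h2 : g (g^[K] b) = σ (hd i) := by rw [hg, Equiv.Perm.mul_apply, ← hg, h']
          rw [h2] at hne ⊢
          rw [arrival_step σ.injective (hcov _) hne, h]
          have := hlt i hi
          omega
        · exact absurd h (nohd K (fun j h1 h2 => hK j h1 (by omega)) ihK i hi)
        · have h2 : g (g^[K] b) = σ (g^[K] b) := by rw [hg, Equiv.Perm.mul_apply, ← hg, h']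
          rw [h2] at hne ⊢
          rw [arrival_step σ.injective (hcov _) hne]
          omega
      intro j hj
      rcases hj.lt_or_eq with h | rfl
      · exact (ihK j (by omega)).trans hstep
      · exact le_rfl
  obtain ⟨i, hi⟩ := hS
  have hK : ∀ j, 1 ≤ j → j ≤ arrival g b (hd i) → g^[j] b ≠ b := by
    intro j h1 h2 h3
    have h4 := iterate_arrival (hcov' (hd i))
    rw [← Nat.sub_add_cancel h2, Function.iterate_add_apply, h3] at h4
    have := arrival_le h4
    omega
  exact nohd _ hK (inc _ hK) i hi (iterate_arrival (hcov' (hd i)))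

end

/-- Induction along skein trees: a function of a state and of the signs of the crossings that are not
smoothed vanishes if it vanishes for one choice of signs in every state and if it does not change
with a sign as long as it vanishes after the smoothing of the crossing. -/
theorem skein_induction [DecidableEq ι] [Zero R] {Y : Finset ι} {Ψ : Finset ι → (ι → ℤˣ) → R}
    (hloc : ∀ S ⊆ Y, ∀ ε ε', (∀ i ∈ Y \ S, ε i = ε' i) → Ψ S ε = Ψ S ε')
    (hskein : ∀ S ⊆ Y, ∀ i ∈ Y \ S, ∀ ε, (∀ ε', Ψ (insert i S) ε' = 0) →
      Ψ S (Function.update ε i 1) = Ψ S (Function.update ε i (-1)))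
    (hbase : ∀ S ⊆ Y, ∃ ε, Ψ S ε = 0) {S : Finset ι} (hS : S ⊆ Y) (ε : ι → ℤˣ) : Ψ S ε = 0 := by
  induction hn : (Y \ S).card using Nat.strong_induction_on generalizing S ε with
  | _ n ih =>
    have h0 : ∀ i ∈ Y \ S, ∀ ε', Ψ (insert i S) ε' = 0 := by
      intro i hi ε'
      have hi' := Finset.mem_sdiff.1 hi
      refine ih _ ?_ (Finset.insert_subset hi'.1 hS) ε' rfl
      rw [← hn]
      refine Finset.card_lt_card ⟨Finset.sdiff_subset_sdiff le_rfl (Finset.subset_insert _ _), ?_⟩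
      exact fun h => (Finset.mem_sdiff.1 (h hi)).2 (Finset.mem_insert_self _ _)
    have hupd : ∀ i ∈ Y \ S, ∀ ε u v, Ψ S (Function.update ε i u) = Ψ S (Function.update ε i v) := by
      intro i hi ε u v
      have h := hskein S hS i hi ε (h0 i hi)
      rcases Int.units_eq_one_or u with rfl | rfl <;> rcases Int.units_eq_one_or v with rfl | rfl <;>
        simp [h]
    obtain ⟨ε₀, h₀⟩ := hbase S hS
    have hT : ∀ T ⊆ Y \ S, ∀ ε, (∀ i ∈ (Y \ S) \ T, ε i = ε₀ i) → Ψ S ε = 0 := by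
      intro T
      induction T using Finset.induction_on with
      | empty =>
        intro _ ε hε
        rw [hloc S hS ε ε₀ (by simpa using hε), h₀]
      | insert i T hiT ihT =>
        intro hT ε hε
        have hi := hT (Finset.mem_insert_self _ _)
        rw [← Function.update_eq_self i ε, hupd i hi ε (ε i) (ε₀ i)]
        refine ihT ((Finset.subset_insert _ _).trans hT) _ fun j hj => ?_
        by_cases hji : j = i
        · subst hji; simp
        · rw [Function.update_of_ne hji]
          refine hε j ?_
          simp only [Finset.mem_sdiff, Finset.mem_insert, not_or] at hj ⊢
          exact ⟨hj.1, hji, hj.2⟩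
    exact hT _ le_rfl ε (by simp)

end StateSum

/-! ### Walks under the smoothing of a crossing -/

namespace Walk

open scoped Classical

variable {P : Type*}

theorem arrival_le_last {g : P → P} {b p q : P} (hp : Path g ∅ b p) (hq : Path g ∅ b q)
    (hlast : g p = b) : arrival g b q ≤ arrival g b p := by
  by_contra! hlt
  have h1 := iterate_arrival hq
  rw [show arrival g b q = (arrival g b q - arrival g b p - 1) + (arrival g b p + 1) by omega,
    Function.iterate_add_apply, Function.iterate_succ_apply', iterate_arrival hp, hlast] at h1
  have := arrival_le h1
  omega

theorem path_apply_iff [Finite P] {g : Equiv.Perm P} {b p : P} :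
    Path g ∅ b (g p) ↔ Path g ∅ b p :=
  ⟨fun h => h.trans (path_symm (Path.step (g := g) .refl)), fun h => h.step⟩

section Join
variable {g : Equiv.Perm P} {b u v : P}

theorem mul_swap_of_ne {p : P} (h1 : p ≠ u) (h2 : p ≠ v) : (g * Equiv.swap u v) p = g p := by
  rw [Equiv.Perm.mul_apply, Equiv.swap_apply_of_ne_of_ne h1 h2]

theorem mul_swap_left : (g * Equiv.swap u v) u = g v := by simp

theorem mul_swap_right : (g * Equiv.swap u v) v = g u := by simp

/-- Up to the first arrival at `u` or `v`, the walk does not change under smoothing. -/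
theorem path_mul_swap_left (hu : Path g ∅ b u)
    (hv : ∀ k < arrival g b u, g^[k] b ≠ v) : Path (g * Equiv.swap u v) ∅ b u := by
  have key : ∀ k ≤ arrival g b u, (⇑(g * Equiv.swap u v))^[k] b = g^[k] b := by
    intro k
    induction k with
    | zero => simp
    | succ k ih =>
      intro hk
      rw [Function.iterate_succ_apply', Function.iterate_succ_apply', ih (by omega)]
      refine mul_swap_of_ne (fun e => ?_) (hv k (by omega))
      have := arrival_le e
      omega
  exact path_empty_iff.2 ⟨_, (key _ le_rfl).trans (iterate_arrival hu)⟩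

/-- Smoothing at two points of one cycle splits the cycle. -/
theorem split_of_covers (h : Covers g b) (huv : arrival g b u < arrival g b v) :
    Path (g * Equiv.swap u v) ∅ b u ∧ ¬ Path (g * Equiv.swap u v) ∅ b v ∧
      ∀ p, Path (g * Equiv.swap u v) ∅ b p ∨ Path (g * Equiv.swap u v) ∅ v p := by
  have hbu : Path (g * Equiv.swap u v) ∅ b u := by
    refine path_mul_swap_left (h u) fun k hk e => ?_
    have := arrival_le e
    omega
  refine ⟨hbu, fun hbv => ?_, fun p => ?_⟩
  · have := mem_of_path (C := {p | arrival g b p ≤ arrival g b u ∨ arrival g b v < arrival g b p})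
      (by simp [arrival_self]) ?_ hbv
    · simp only [Set.mem_ofPred_eq] at this
      omega
    · intro x _ hx
      simp only [Set.mem_ofPred_eq] at hx ⊢
      by_cases hxu : x = u
      · subst hxu
        rw [mul_swap_left]
        by_cases hb : g v = b
        · simp [hb, arrival_self]
        · rw [arrival_step g.injective (h v) hb]; omega
      · have hxv : x ≠ v := by rintro rfl; omega
        have hxu' : arrival g b x ≠ arrival g b u := fun e => hxu (arrival_inj (h _) (h _) e)
        rw [mul_swap_of_ne hxu hxv]
        by_cases hb : g x = b
        · simp [hb, arrival_self]
        · rw [arrival_step g.injective (h x) hb]; omega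
  · induction h p with
    | refl => exact .inl .refl
    | @tail x _ _ hxy ih =>
      obtain ⟨rfl, -⟩ := hxy
      by_cases hxu : x = u
      · subst hxu
        right
        have := Path.step (g := ⇑(g * Equiv.swap x v)) (b := v) .refl
        rwa [mul_swap_right] at this
      · by_cases hxv : x = v
        · subst hxv
          left
          have := hbu.step
          rwa [mul_swap_left] at this
        · rcases ih with ih | ih
          · left; have := ih.step; rwa [mul_swap_of_ne hxu hxv] at this
          · right; have := ih.step; rwa [mul_swap_of_ne hxu hxv] at this

/-- Smoothing at points of two different cycles joins the cycles. -/
theorem covers_join [Finite P] (hu : Path g ∅ b u) (hv : ¬ Path g ∅ b v)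
    (h : ∀ p, Path g ∅ b p ∨ Path g ∅ v p) : Covers (g * Equiv.swap u v) b := by
  have hbu : Path (g * Equiv.swap u v) ∅ b u :=
    path_mul_swap_left hu fun k _ e => hv (path_empty_iff.2 ⟨k, e⟩)
  have hK : ∀ p, Path g ∅ (g v) p → ¬ Path g ∅ b p ∧ Path (g * Equiv.swap u v) ∅ (g v) p := by
    intro p hp
    induction hp with
    | refl => exact ⟨fun h' => hv (path_apply_iff.1 h'), .refl⟩
    | @tail x _ _ hxy ih =>
      obtain ⟨rfl, -⟩ := hxy
      refine ⟨fun h' => ih.1 (path_apply_iff.1 h'), ?_⟩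
      by_cases hxv : x = v
      · subst hxv; exact .refl
      · have := ih.2.step
        rwa [mul_swap_of_ne (show x ≠ u from fun e => ih.1 (e ▸ hu)) hxv] at this
  have hbgv : Path (g * Equiv.swap u v) ∅ b (g v) := by
    have := hbu.step
    rwa [mul_swap_left] at this
  have hgv : ∀ p, Path g ∅ v p → Path (g * Equiv.swap u v) ∅ b p := fun p hp =>
    hbgv.trans (hK p ((path_symm (Path.step (g := g) .refl)).trans hp)).2
  have hbgu : Path (g * Equiv.swap u v) ∅ b (g u) := by
    have := (hgv v .refl).step
    rwa [mul_swap_right] at this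
  intro p
  rcases h p with hp | hp
  · have hO : ∀ q, Path g ∅ b q → Path (g * Equiv.swap u v) ∅ b q := by
      intro q hq
      induction hq with
      | refl => exact .refl
      | @tail x _ hx hxy ih =>
        obtain ⟨rfl, -⟩ := hxy
        by_cases hxu : x = u
        · subst hxu; exact hbgu
        · have := ih.step
          rwa [mul_swap_of_ne hxu (show x ≠ v from fun e => hv (e ▸ hx))] at this
    exact hO p hp
  · exact hgv p hp

/-- The arrival times after joining the cycle `O` of `b` and the cycle of `v`: the walk follows `O` up
to `u`, then the other cycle, which it enters behind `v`, and then the rest of `O`. -/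
theorem arrival_join [Finite P] (hu : Path g ∅ b u) (hv : ¬ Path g ∅ b v)
    (h : ∀ p, Path g ∅ b p ∨ Path g ∅ v p) (p : P) :
    arrival (g * Equiv.swap u v) b p =
      if Path g ∅ b p then
        if arrival g b p ≤ arrival g b u then arrival g b p
        else arrival g b p + (arrival g (g v) v + 1)
      else arrival g b u + 1 + arrival g (g v) p := by
  have hcov := covers_join hu hv h
  refine (eq_arrival (f := fun p => if Path g ∅ b p then
        if arrival g b p ≤ arrival g b u then arrival g b p
        else arrival g b p + (arrival g (g v) v + 1)
      else arrival g b u + 1 + arrival g (g v) p) (g * Equiv.swap u v).injective ?_ ?_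
      (hcov p)).symm
  · have : Path g ∅ b b := .refl
    simp [this, arrival_self]
  · intro x _ hxb
    have hvK : Path g ∅ (g v) v := path_symm (Path.step (g := g) .refl)
    by_cases hxu : x = u
    · subst hxu
      rw [mul_swap_left]
      have : ¬ Path g ∅ b (g v) := fun h' => hv (path_apply_iff.1 h')
      simp [this, hu, arrival_self]
    · by_cases hxv : x = v
      · subst hxv
        rw [mul_swap_right] at hxb ⊢
        have h1 : Path g ∅ b (g u) := hu.step
        have h2 := arrival_step g.injective hu hxb
        simp [h1, hv, h2]
        omega
      · rw [mul_swap_of_ne hxu hxv] at hxb ⊢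
        by_cases hx : Path g ∅ b x
        · have h1 := arrival_step g.injective hx hxb
          have h2 : arrival g b x ≠ arrival g b u := fun e => hxu (arrival_inj hx hu e)
          simp only [hx, hx.step, if_true, h1]
          split_ifs <;> omega
        · have hxK : Path g ∅ (g v) x :=
            (path_symm (Path.step (g := g) .refl)).trans ((h x).resolve_left hx)
          have h1 : ¬ Path g ∅ b (g x) := fun h' => hx (path_apply_iff.1 h')
          have h2 : g x ≠ g v := fun e => hxv (g.injective e)
          simp only [hx, h1, if_false, arrival_step g.injective hxK h2]
          omega

end Join

/-- Moving the base point one step ahead moves it from the first to the last place. -/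
theorem arrival_shift {g : P → P} {c p : P} (hp : Path g ∅ c p) (hpc : p ≠ c)
    (hcc : Path g ∅ (g c) c) :
    arrival g c p = arrival g (g c) p + 1 ∧ arrival g (g c) p < arrival g (g c) c := by
  have h0 : arrival g c p ≠ 0 := by
    intro h
    have := iterate_arrival hp
    rw [h] at this
    exact hpc this.symm
  have hp' : Path g ∅ (g c) p := hcc.trans hp
  have h1 : arrival g (g c) p ≤ arrival g c p - 1 := by
    apply arrival_le
    rw [← Function.iterate_succ_apply g, Nat.succ_eq_add_one, Nat.sub_add_cancel (by omega),
      iterate_arrival hp]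
  have h2 : arrival g c p ≤ arrival g (g c) p + 1 := by
    apply arrival_le
    rw [Function.iterate_succ_apply, iterate_arrival hp']
  refine ⟨by omega, ?_⟩
  exact lt_of_le_of_ne (arrival_le_last hcc hp' rfl) fun e => hpc (arrival_inj hp' hcc e)

end Walk

/-! ### Turning and intersection numbers -/

namespace StateSum
open Walk
open scoped Classical

variable {P ι : Type*}

/-- `ρ` is a potential of the flow `χ` on a diagram whose crossings `S ⊆ Y` are smoothed and which has
the successor permutation `g`.  The crossing `i` has the eastward passage `e i` and the northward
passage `n i`; `χ p` is the weight of the edge that ends in `p`, and `ρ p` is the value of the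
potential in the region on the right of this edge.  The value on the left is `ρ p + χ p`. -/
structure IsPotential (g : Equiv.Perm P) (e n : ι → P) (Y S : Finset ι) (χ ρ : P → ℤ) : Prop where
  corner : ∀ i ∈ Y, ρ (e i) = ρ (n i) + χ (n i)
  smooth_east : ∀ i ∈ S, ρ (g (e i)) = ρ (e i)
  smooth_north : ∀ i ∈ S, ρ (g (n i)) = ρ (n i)
  east : ∀ i ∈ Y, i ∉ S → ρ (g (e i)) = ρ (e i) - χ (n i)
  north : ∀ i ∈ Y, i ∉ S → ρ (g (n i)) = ρ (n i) + χ (e i)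
  plain : ∀ p, (∀ i ∈ Y, p ≠ e i ∧ p ≠ n i) → ρ (g p) = ρ p

/-- Every flow on every smoothing has a potential.  This is the form in which the planarity of a
diagram is used. -/
def HasPotentials (σ : Equiv.Perm P) (e n : ι → P) (Y : Finset ι) : Prop :=
  ∀ S ⊆ Y, ∀ χ : P → ℤ, (∀ p, χ ((σ * pairing e n S) p) = χ p) →
    ∃ ρ, IsPotential (σ * pairing e n S) e n Y S χ ρ

/-- `1` if the walk meets the crossing first on the northward passage, and `-1` otherwise.  This is the
sign of the crossing if the passage that is met first lies below. -/
noncomputable def turn (g : P → P) (e n : ι → P) (b : P) (i : ι) : ℤ :=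
  if arrival g b (n i) < arrival g b (e i) then 1 else -1

/-- The total turning of the component `K` with respect to its point `c`. -/
noncomputable def turning (g : P → P) (e n : ι → P) (U : Finset ι) (K : Set P) (c : P) : ℤ :=
  ∑ i ∈ U, if e i ∈ K ∧ n i ∈ K then turn g e n c i else 0

/-- Moving the base point along its component changes the turning by as much as twice the potential
of the component. -/
theorem turning_shift [Finite P] {g : Equiv.Perm P} {e n : ι → P} {Y S : Finset ι}
    (hY : Distinct e n Y) {K : Set P} {χ ρ : P → ℤ}
    (hχ : ∀ p, χ p = if p ∈ K then 1 else 0) (hρ : IsPotential g e n Y S χ ρ) {c : P} (hc : c ∈ K)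
    (hK : ∀ p ∈ K, Path g ∅ c p) :
    turning g e n (Y \ S) K (g c) + 2 * ρ (g c) = turning g e n (Y \ S) K c + 2 * ρ c := by
  have hcc : Path g ∅ (g c) c := path_symm (Path.step (g := g) .refl)
  have hdiff : ∀ i ∈ Y \ S, (if e i ∈ K ∧ n i ∈ K then turn g e n (g c) i else 0) =
      (if e i ∈ K ∧ n i ∈ K then turn g e n c i else 0) +
        ((if e i = c then 2 * χ (n i) else 0) - (if n i = c then 2 * χ (e i) else 0)) := by
    intro i hi
    have hiY := (Finset.mem_sdiff.1 hi).1
    have hen := hY.ne i hiY i hiY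
    rw [hχ, hχ]
    by_cases hK' : e i ∈ K ∧ n i ∈ K
    · obtain ⟨h1, h2⟩ := hK'
      simp only [h1, h2, and_self, if_true, turn]
      by_cases he : e i = c
      · have hn : n i ≠ c := fun h => hen (he.trans h.symm)
        have := (arrival_shift (hK _ h2) hn hcc).2
        rw [he, arrival_self]
        simp [hn, this]
      · by_cases hn : n i = c
        · have := (arrival_shift (hK _ h1) he hcc).2
          have h3 := (arrival_shift (hK _ h1) he hcc).1
          rw [hn, arrival_self]
          simp [he, this.not_gt, h3]
        · have h3 := (arrival_shift (hK _ h1) he hcc).1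
          have h4 := (arrival_shift (hK _ h2) hn hcc).1
          simp [he, hn, h3, h4]
    · simp only [hK', if_false]
      by_cases he : e i = c
      · have hn : n i ≠ c := fun h => hen (he.trans h.symm)
        have : n i ∉ K := fun h => hK' ⟨he ▸ hc, h⟩
        simp [hn, this]
      · by_cases hn : n i = c
        · have : e i ∉ K := fun h => hK' ⟨h, hn ▸ hc⟩
          simp [he, this]
        · simp [he, hn]
  unfold turning
  rw [Finset.sum_congr rfl hdiff, Finset.sum_add_distrib, Finset.sum_sub_distrib]
  have hρc : 2 * ρ (g c) + (∑ i ∈ Y \ S, (if e i = c then 2 * χ (n i) else 0) -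
      ∑ i ∈ Y \ S, (if n i = c then 2 * χ (e i) else 0)) = 2 * ρ c := by
    by_cases h1 : ∃ i ∈ Y, e i = c
    · obtain ⟨i, hi, rfl⟩ := h1
      have hn : ∀ j ∈ Y \ S, ¬ n j = e i := fun j hj h =>
        hY.ne i hi j (Finset.mem_sdiff.1 hj).1 h.symm
      have he : ∀ j ∈ Y \ S, (e j = e i ↔ j = i) := fun j hj =>
        ⟨fun h => hY.tl_inj j (Finset.mem_sdiff.1 hj).1 i hi h, fun h => h ▸ rfl⟩
      rw [Finset.sum_congr rfl fun j hj => if_neg (hn j hj),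
        Finset.sum_congr rfl fun j hj => if_congr (he j hj) rfl rfl, Finset.sum_ite_eq']
      by_cases hS : i ∈ S
      · simp [hS, hρ.smooth_east i hS]
      · simp [hS, hi, hρ.east i hi hS]
        ring
    by_cases h2 : ∃ i ∈ Y, n i = c
    · obtain ⟨i, hi, rfl⟩ := h2
      have hn : ∀ j ∈ Y \ S, ¬ e j = n i := fun j hj h =>
        hY.ne j (Finset.mem_sdiff.1 hj).1 i hi h
      have he : ∀ j ∈ Y \ S, (n j = n i ↔ j = i) := fun j hj =>
        ⟨fun h => hY.hd_inj j (Finset.mem_sdiff.1 hj).1 i hi h, fun h => h ▸ rfl⟩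
      rw [Finset.sum_congr rfl fun j hj => if_neg (hn j hj),
        Finset.sum_congr rfl fun j hj => if_congr (he j hj) rfl rfl, Finset.sum_ite_eq']
      by_cases hS : i ∈ S
      · simp [hS, hρ.smooth_north i hS]
      · simp [hS, hi, hρ.north i hi hS]
        ring
    push Not at h1 h2
    rw [hρ.plain c fun i hi => ⟨fun h => h1 i hi h.symm, fun h => h2 i hi h.symm⟩,
      Finset.sum_congr rfl fun j hj => if_neg (h1 j (Finset.mem_sdiff.1 hj).1),
      Finset.sum_congr rfl fun j hj => if_neg (h2 j (Finset.mem_sdiff.1 hj).1)]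
    simp
  linarith

theorem turning_path [Finite P] {g : Equiv.Perm P} {e n : ι → P} {Y S : Finset ι}
    (hY : Distinct e n Y) {K : Set P} {χ ρ : P → ℤ}
    (hχ : ∀ p, χ p = if p ∈ K then 1 else 0) (hρ : IsPotential g e n Y S χ ρ) {c d : P}
    (hK : ∀ p, p ∈ K ↔ Path g ∅ c p) (hd : Path g ∅ c d) :
    turning g e n (Y \ S) K d + 2 * ρ d = turning g e n (Y \ S) K c + 2 * ρ c := by
  induction hd with
  | refl => rfl
  | @tail x _ hx hxy ih =>
    obtain ⟨rfl, -⟩ := hxy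
    rw [turning_shift hY hχ hρ ((hK x).2 hx)
      (fun p hp => (path_symm hx).trans ((hK p).1 hp)), ih]

section Split
variable {g : Equiv.Perm P} {e n : ι → P} {Y S : Finset ι} {b : P}

/-- The change of the potential at the crossing `i` between the component of `b` and the rest, along
the component of `b`. -/
noncomputable def jump (g : P → P) (e n : ι → P) (b : P) (i : ι) : ℤ :=
  if Path g ∅ b (e i) then (if Path g ∅ b (n i) then 0 else -1)
  else (if Path g ∅ b (n i) then 1 else 0)

/-- The passage of the crossing `i` that lies on the component of `b`, for a crossing between this
component and the rest. -/
noncomputable def near (g : P → P) (e : ι → P) (n : ι → P) (b : P) (i : ι) : P :=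
  if Path g ∅ b (e i) then e i else n i

theorem potential_jump (hY : Distinct e n Y) {χ ρ : P → ℤ}
    (hχ : ∀ p, χ p = if Path g ∅ b p then 0 else 1) (hρ : IsPotential g e n Y S χ ρ) {p : P}
    (hp : Path g ∅ b p) :
    ρ (g p) - ρ p = ∑ i ∈ Y \ S, if near g e n b i = p then jump g e n b i else 0 := by
  by_cases h1 : ∃ i ∈ Y, e i = p
  · obtain ⟨i, hi, rfl⟩ := h1
    have hj : ∀ j ∈ Y \ S, (if near g e n b j = e i then jump g e n b j else 0) =
        if j = i then jump g e n b j else 0 := by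
      intro j hj
      have hjY := (Finset.mem_sdiff.1 hj).1
      by_cases hji : j = i
      · subst hji; simp [near, hp]
      · have : near g e n b j ≠ e i := by
          unfold near
          split_ifs
          · exact fun h => hji (hY.tl_inj j hjY i hi h)
          · exact fun h => hY.ne i hi j hjY h.symm
        rw [if_neg this, if_neg hji]
    rw [Finset.sum_congr rfl hj, Finset.sum_ite_eq']
    by_cases hS : i ∈ S
    · simp [hS, hρ.smooth_east i hS]
    · rw [hρ.east i hi hS, hχ]
      simp only [Finset.mem_sdiff, hi, hS, not_false_eq_true, and_self, if_true, jump, hp]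
      split_ifs <;> ring
  by_cases h2 : ∃ i ∈ Y, n i = p
  · obtain ⟨i, hi, rfl⟩ := h2
    have hj : ∀ j ∈ Y \ S, (if near g e n b j = n i then jump g e n b j else 0) =
        if j = i then jump g e n b j else 0 := by
      intro j hj
      have hjY := (Finset.mem_sdiff.1 hj).1
      by_cases hji : j = i
      · subst hji
        by_cases he : Path g ∅ b (e j)
        · simp [near, jump, hp, he]
        · simp [near, he]
      · have : near g e n b j ≠ n i := by
          unfold near
          split_ifs
          · exact fun h => hY.ne j hjY i hi h
          · exact fun h => hji (hY.hd_inj j hjY i hi h)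
        rw [if_neg this, if_neg hji]
    rw [Finset.sum_congr rfl hj, Finset.sum_ite_eq']
    by_cases hS : i ∈ S
    · simp [hS, hρ.smooth_north i hS]
    · rw [hρ.north i hi hS, hχ]
      simp only [Finset.mem_sdiff, hi, hS, not_false_eq_true, and_self, if_true, jump, hp]
      split_ifs <;> ring
  push Not at h1 h2
  rw [hρ.plain p fun i hi => ⟨fun h => h1 i hi h.symm, fun h => h2 i hi h.symm⟩, sub_self,
    Finset.sum_eq_zero]
  intro i hi
  have hiY := (Finset.mem_sdiff.1 hi).1
  refine if_neg ?_
  unfold near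
  split_ifs
  exacts [h1 i hiY, h2 i hiY]

theorem potential_sub [Finite P] (hY : Distinct e n Y) {χ ρ : P → ℤ}
    (hχ : ∀ p, χ p = if Path g ∅ b p then 0 else 1) (hρ : IsPotential g e n Y S χ ρ) {p : P}
    (hp : Path g ∅ b p) :
    ρ p - ρ b = ∑ i ∈ Y \ S, if arrival g b (near g e n b i) < arrival g b p
      then (if Path g ∅ b (near g e n b i) then jump g e n b i else 0) else 0 := by
  induction hp with
  | refl => simp [arrival_self]
  | @tail x _ hx hxy ih =>
    obtain ⟨rfl, -⟩ := hxy
    by_cases hb : g x = b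
    · rw [hb]; simp [arrival_self]
    · have h1 := potential_jump hY hχ hρ hx
      rw [← sub_add_sub_cancel (ρ (g x)) (ρ x) (ρ b), h1]
      erw [ih]
      rw [← Finset.sum_add_distrib]
      refine Finset.sum_congr rfl fun i _ => ?_
      rw [arrival_step g.injective hx hb]
      by_cases hnx : near g e n b i = x
      · simp [hnx, show Path g ∅ b x from hx]
      · by_cases hp : Path g ∅ b (near g e n b i)
        · have h2 : arrival g b (near g e n b i) ≠ arrival g b x := fun h =>
            hnx (arrival_inj hp hx h)
          have h3 : arrival g b (near g e n b i) < arrival g b x + 1 ↔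
              arrival g b (near g e n b i) < arrival g b x := by omega
          simp [hnx, hp, h3]
        · simp [hnx, hp]

theorem jump_eq_ite (i : ι) :
    (if Path g ∅ b (near g e n b i) then jump g e n b i else 0) = jump g e n b i := by
  unfold near jump
  by_cases h1 : Path g ∅ b (e i) <;> by_cases h2 : Path g ∅ b (n i) <;> simp [h1, h2]

/-- A component meets the rest of a planar diagram algebraically in zero points. -/
theorem sum_jump [Finite P] (hY : Distinct e n Y) {χ ρ : P → ℤ}
    (hχ : ∀ p, χ p = if Path g ∅ b p then 0 else 1) (hρ : IsPotential g e n Y S χ ρ) :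
    ∑ i ∈ Y \ S, jump g e n b i = 0 := by
  have hl : Path g ∅ b (g.symm b) := by
    rw [← path_apply_iff, Equiv.apply_symm_apply]
    exact .refl
  have h1 := potential_jump hY hχ hρ hl
  have h2 := potential_sub hY hχ hρ hl
  have h3 := congrArg₂ (· + ·) h1 h2
  simp only [Equiv.apply_symm_apply, sub_add_sub_cancel, sub_self, ← Finset.sum_add_distrib] at h3
  rw [h3]
  refine Finset.sum_congr rfl fun i _ => ?_
  by_cases hnx : near g e n b i = g.symm b
  · simp [hnx]
  · by_cases hp : Path g ∅ b (near g e n b i)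
    · have h2 : arrival g b (near g e n b i) ≠ arrival g b (g.symm b) := fun h =>
        hnx (arrival_inj hp hl h)
      have h3 := arrival_le_last hl hp (by simp)
      simp [hnx, hp, lt_of_le_of_ne h3 h2]
    · have := jump_eq_ite (g := g) (e := e) (n := n) (b := b) i
      simp [hnx, hp] at this ⊢
      exact this.symm

/-- The turning of a one-component state that arises by joining two components at the crossing `x`
does not depend on `x`. -/
theorem turning_join [Finite P] {x : ι} {O L : Set P} (hO : ∀ p, p ∈ O ↔ Path g ∅ b p)
    (hL : ∀ p, p ∈ L ↔ ¬ Path g ∅ b p) (hY : Distinct e n Y) (hx : x ∈ Y) {u v : P}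
    (huv : (u = e x ∧ v = n x) ∨ (u = n x ∧ v = e x)) (hu : Path g ∅ b u) (hv : ¬ Path g ∅ b v)
    (h : ∀ p, Path g ∅ b p ∨ Path g ∅ v p) {χ ρ : P → ℤ}
    (hχ : ∀ p, χ p = if Path g ∅ b p then 0 else 1) (hρ : IsPotential g e n Y S χ ρ) :
    turning (g * Equiv.swap u v) e n (Y \ symmDiff S {x}) Set.univ b =
      turning g e n (Y \ S) O b +
      (turning g e n (Y \ S) L v + 2 * ρ v) - 2 * ρ b + 1 := by
  set g' := g * Equiv.swap u v with hg'
  have hgv : ¬ Path g ∅ b (g v) := fun h' => hv (path_apply_iff.1 h')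
  have hχ' : ∀ p, χ p = if p ∈ L then 1 else 0 := by
    intro p; rw [hχ]; by_cases hp : Path g ∅ b p <;> simp [hp, hL]
  have hsh := turning_shift hY hχ' hρ ((hL v).2 hv) fun p hp => (h p).resolve_left ((hL p).1 hp)
  rw [← hsh]
  have hlast : ∀ p, ¬ Path g ∅ b p → arrival g (g v) p ≤ arrival g (g v) v := fun p hp =>
    have hgvv : Path g ∅ (g v) v := path_symm (Path.step (g := g) .refl)
    arrival_le_last hgvv (hgvv.trans ((h p).resolve_left hp)) rfl
  set δ : ℤ := if u = n x then 1 else -1 with hδ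
  have hen := hY.ne x hx x hx
  -- the turning of the crossings apart from `x`
  have hmain : ∀ i ∈ (Y \ S).erase x, turn g' e n b i =
      (if e i ∈ O ∧ n i ∈ O then turn g e n b i else 0) +
      (if e i ∈ L ∧ n i ∈ L then turn g e n (g v) i else 0) +
      (2 * (if arrival g b (near g e n b i) < arrival g b u then jump g e n b i else 0) -
        jump g e n b i) := by
    intro i hi
    obtain ⟨hix, hi⟩ := Finset.mem_erase.1 hi
    have hiY := (Finset.mem_sdiff.1 hi).1
    have heu : e i ≠ u := by
      rcases huv with ⟨rfl, -⟩ | ⟨rfl, -⟩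
      · exact fun h => hix (hY.tl_inj i hiY x hx h)
      · exact fun h => hY.ne i hiY x hx h
    have hnu : n i ≠ u := by
      rcases huv with ⟨rfl, -⟩ | ⟨rfl, -⟩
      · exact fun h => hY.ne x hx i hiY h.symm
      · exact fun h => hix (hY.hd_inj i hiY x hx h)
    simp only [turn, hg', arrival_join hu hv h, hO, hL, near, jump]
    by_cases he : Path g ∅ b (e i) <;> by_cases hn : Path g ∅ b (n i)
    · simp only [he, hn, and_self, if_true, not_true_eq_false, if_false]
      split_ifs <;> omega
    · have : arrival g b (e i) ≠ arrival g b u := fun h => heu (arrival_inj he hu h)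
      have := hlast _ hn
      simp only [he, hn, and_false, false_and, not_true_eq_false, if_true, if_false]
      split_ifs <;> omega
    · have : arrival g b (n i) ≠ arrival g b u := fun h => hnu (arrival_inj hn hu h)
      have := hlast _ he
      simp only [he, hn, and_false, false_and, not_true_eq_false, if_true, if_false]
      split_ifs <;> omega
    · simp only [he, hn, and_self, if_false, not_false_eq_true, if_true]
      split_ifs <;> omega
  have hxturn : turn g' e n b x = δ := by
    have h1 : arrival g' b u < arrival g' b v := by
      rw [hg', arrival_join hu hv h, arrival_join hu hv h]
      simp [hu, hv]
      omega
    unfold turn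
    rcases huv with ⟨rfl, rfl⟩ | ⟨rfl, rfl⟩
    · rw [if_neg h1.not_gt, hδ, if_neg hen]
    · rw [if_pos h1, hδ, if_pos rfl]
  have hρuv : 2 * ρ u + δ = 2 * ρ (g v) + 1 := by
    have h0 : ρ (g v) = ρ v := by
      rcases huv with ⟨rfl, rfl⟩ | ⟨rfl, rfl⟩
      · by_cases hxS : x ∈ S
        · exact hρ.smooth_north x hxS
        · rw [hρ.north x hx hxS, hχ, if_pos hu, add_zero]
      · by_cases hxS : x ∈ S
        · exact hρ.smooth_east x hxS
        · rw [hρ.east x hx hxS, hχ, if_pos hu, sub_zero]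
    have h1 := hρ.corner x hx
    rw [h0, hδ]
    rcases huv with ⟨rfl, rfl⟩ | ⟨rfl, rfl⟩
    · rw [hχ, if_neg hv] at h1
      rw [if_neg hen]; linarith
    · rw [hχ, if_pos hu] at h1
      rw [if_pos rfl]; linarith
  have hsub := potential_sub hY hχ hρ hu
  simp only [jump_eq_ite] at hsub
  have hsum := sum_jump hY hχ hρ (b := b)
  -- sums over the crossings that are not smoothed
  have hT : turning g' e n (Y \ symmDiff S {x}) Set.univ b =
      ∑ i ∈ (Y \ S).erase x, turn g' e n b i + if x ∈ S then δ else 0 := by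
    unfold turning
    simp only [Set.mem_univ, and_self, if_true]
    by_cases hxS : x ∈ S
    · rw [show Y \ symmDiff S {x} = insert x ((Y \ S).erase x) from ?_, Finset.sum_insert (by simp),
        hxturn, if_pos hxS, add_comm]
      ext i
      simp only [Finset.mem_sdiff, Finset.mem_symmDiff, Finset.mem_singleton, Finset.mem_insert,
        Finset.mem_erase]
      by_cases hix : i = x
      · subst hix; simp [hx, hxS]
      · simp [hix]
    · rw [show Y \ symmDiff S {x} = (Y \ S).erase x from ?_, if_neg hxS, add_zero]
      ext i
      simp only [Finset.mem_sdiff, Finset.mem_symmDiff, Finset.mem_singleton, Finset.mem_erase]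
      by_cases hix : i = x
      · subst hix; simp [hxS]
      · simp [hix]
  have hself : ∀ K : Set P, ∀ c, ¬ (e x ∈ K ∧ n x ∈ K) → turning g e n (Y \ S) K c =
      ∑ i ∈ (Y \ S).erase x, if e i ∈ K ∧ n i ∈ K then turn g e n c i else 0 := by
    intro K c hK
    unfold turning
    exact (Finset.sum_erase (a := x) _ (if_neg hK)).symm
  have hxj : jump g e n b x = δ ∧ near g e n b x = u := by
    unfold jump near
    rcases huv with ⟨rfl, rfl⟩ | ⟨rfl, rfl⟩
    · simp [hu, hv, hδ, hen]
    · simp [hu, hv, hδ]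
  have herase : ∀ f : ι → ℤ, ∑ i ∈ (Y \ S).erase x, f i =
      ∑ i ∈ Y \ S, f i - if x ∈ S then 0 else f x := by
    intro f
    by_cases hxS : x ∈ S
    · rw [Finset.erase_eq_of_notMem (by simp [hxS])]; simp [hxS]
    · have hx' : x ∈ Y \ S := by simp [hx, hxS]
      rw [← Finset.add_sum_erase (Y \ S) f hx']; simp [hxS]
  rw [hT, Finset.sum_congr rfl hmain, Finset.sum_add_distrib, Finset.sum_add_distrib,
    Finset.sum_sub_distrib, ← Finset.mul_sum, ← hself, ← hself, herase, herase, ← hsub, hsum, hxj.1,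
    hxj.2]
  · simp only [lt_self_iff_false, if_false]
    split_ifs <;> linarith
  · rcases huv with ⟨rfl, rfl⟩ | ⟨rfl, rfl⟩ <;> simp [hL, hu]
  · rcases huv with ⟨rfl, rfl⟩ | ⟨rfl, rfl⟩ <;> simp [hO, hv]

end Split

end StateSum

/-! ### All states with one component have the same turning -/

namespace StateSum
open Walk
open scoped Classical

variable {P ι : Type*}

theorem mul_pairing_symmDiff {σ : Equiv.Perm P} {e n : ι → P} {Y S : Finset ι} {x : ι}
    (hY : Distinct e n Y) (hS : S ⊆ Y) (hx : x ∈ Y) :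
    σ * pairing e n (symmDiff S {x}) = σ * pairing e n S * Equiv.swap (e x) (n x) := by
  have key : ∀ T ⊆ Y, x ∉ T → pairing e n (T ∪ {x}) = pairing e n T * Equiv.swap (e x) (n x) := by
    intro T hT hxT
    rw [pairing_union hY hT (Finset.singleton_subset_iff.2 hx)
      (Finset.disjoint_singleton_right.2 hxT), pairing_singleton]
  rw [mul_assoc]
  congr 1
  by_cases hxS : x ∈ S
  · have h1 : symmDiff S {x} = S.erase x := by
      ext i
      by_cases h : i = x <;> simp [Finset.mem_symmDiff, h, hxS]
    have h2 := key (S.erase x) ((Finset.erase_subset _ _).trans hS) (by simp)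
    rw [Finset.union_comm, ← Finset.insert_eq, Finset.insert_erase hxS] at h2
    rw [h1, h2, mul_assoc, Equiv.swap_mul_self, mul_one]
  · rw [← key S hS hxS]
    congr 1
    ext i
    by_cases h : i = x <;> simp [Finset.mem_symmDiff, h, hxS]

theorem symmDiff_singleton_symmDiff {A B : Finset ι} {x : ι} (hx : x ∈ symmDiff A B) :
    symmDiff (symmDiff A {x}) B = (symmDiff A B).erase x := by
  rw [symmDiff_right_comm]
  ext i
  by_cases h : i = x
  · subst h; simp [Finset.mem_symmDiff (t := {i}), hx]
  · simp [Finset.mem_symmDiff (t := {x}), h]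

/-- Joining two components at either of two crossings yields the same turning. -/
theorem turning_exchange [Finite P] {g : Equiv.Perm P} {e n : ι → P} {Y T : Finset ι} {b : P}
    (hY : Distinct e n Y)
    (hpot : ∀ χ : P → ℤ, (∀ p, χ (g p) = χ p) → ∃ ρ, IsPotential g e n Y T χ ρ)
    {x y : ι} (hx : x ∈ Y) (hy : y ∈ Y) {u v u' v' : P}
    (huv : (u = e x ∧ v = n x) ∨ (u = n x ∧ v = e x))
    (huv' : (u' = e y ∧ v' = n y) ∨ (u' = n y ∧ v' = e y))
    (hu : Path g ∅ b u) (hv : ¬ Path g ∅ b v) (hu' : Path g ∅ b u') (hv' : ¬ Path g ∅ b v')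
    (h : ∀ p, Path g ∅ b p ∨ Path g ∅ v p) :
    turning (g * Equiv.swap u v) e n (Y \ symmDiff T {x}) Set.univ b =
      turning (g * Equiv.swap u' v') e n (Y \ symmDiff T {y}) Set.univ b := by
  obtain ⟨ρ, hρ⟩ := hpot (fun p => if Path g ∅ b p then 0 else 1) fun p => by
    simp only [path_apply_iff]
  obtain ⟨O, hO⟩ : ∃ O : Set P, ∀ p, p ∈ O ↔ Path g ∅ b p := ⟨{p | Path g ∅ b p}, fun _ => Iff.rfl⟩
  obtain ⟨L, hL⟩ : ∃ L : Set P, ∀ p, p ∈ L ↔ ¬ Path g ∅ b p :=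
    ⟨{p | ¬ Path g ∅ b p}, fun _ => Iff.rfl⟩
  have hvv' : Path g ∅ v v' := (h v').resolve_left hv'
  have h' : ∀ p, Path g ∅ b p ∨ Path g ∅ v' p := fun p =>
    (h p).imp_right fun hp => (path_symm hvv').trans hp
  have hLv : ∀ p, p ∈ L ↔ Path g ∅ v p := fun p =>
    ⟨fun hp => (h p).resolve_left ((hL p).1 hp),
      fun hp => (hL p).2 fun hb => hv (hb.trans (path_symm hp))⟩
  rw [turning_join hO hL hY hx huv hu hv h (fun _ => rfl) hρ,
    turning_join hO hL hY hy huv' hu' hv' h' (fun _ => rfl) hρ,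
    turning_path (c := v) (d := v') hY (fun p => ?_) hρ hLv hvv']
  by_cases hp : Path g ∅ b p <;> simp [hp, hL]

/-- All states with one component have the same turning. -/
theorem turning_eq [Finite P] {σ : Equiv.Perm P} {e n : ι → P} {Y : Finset ι} {b : P}
    (hY : Distinct e n Y) (hpot : HasPotentials σ e n Y) {S₁ S₂ : Finset ι} (h₁ : S₁ ⊆ Y)
    (h₂ : S₂ ⊆ Y) (hc₁ : Covers (σ * pairing e n S₁) b) (hc₂ : Covers (σ * pairing e n S₂) b) :
    turning (σ * pairing e n S₁) e n (Y \ S₁) Set.univ b =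
      turning (σ * pairing e n S₂) e n (Y \ S₂) Set.univ b := by
  induction hN : (symmDiff S₁ S₂).card using Nat.strong_induction_on generalizing S₁ with
  | _ N ih =>
    by_cases hS : S₁ = S₂
    · rw [hS]
    obtain ⟨x, hx⟩ : (symmDiff S₁ S₂).Nonempty :=
      Finset.nonempty_iff_ne_empty.2 fun h => hS (symmDiff_eq_bot.1 h)
    have hxY : x ∈ Y := by
      rcases Finset.mem_symmDiff.1 hx with h | h
      exacts [h₁ h.1, h₂ h.1]
    set T := symmDiff S₁ {x} with hT
    have hTY : T ⊆ Y := by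
      intro i hi
      rcases Finset.mem_symmDiff.1 hi with h | h
      · exact h₁ h.1
      · rw [Finset.mem_singleton.1 h.1]; exact hxY
    have hgT := mul_pairing_symmDiff (σ := σ) hY h₁ hxY
    rw [← hT] at hgT
    have hS₁ : S₁ = symmDiff T {x} := by rw [hT, symmDiff_symmDiff_cancel_right]
    have hen := hY.ne x hxY x hxY
    obtain ⟨u, v, huv, hlt⟩ : ∃ u v, ((u = e x ∧ v = n x) ∨ (u = n x ∧ v = e x)) ∧
        arrival (σ * pairing e n S₁) b u < arrival (σ * pairing e n S₁) b v := by
      rcases lt_trichotomy (arrival (σ * pairing e n S₁) b (e x))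
        (arrival (σ * pairing e n S₁) b (n x)) with h | h | h
      · exact ⟨_, _, .inl ⟨rfl, rfl⟩, h⟩
      · exact absurd (arrival_inj (hc₁ _) (hc₁ _) h) hen
      · exact ⟨_, _, .inr ⟨rfl, rfl⟩, h⟩
    have hsw : Equiv.swap (e x) (n x) = Equiv.swap u v := by
      rcases huv with ⟨rfl, rfl⟩ | ⟨rfl, rfl⟩
      exacts [rfl, Equiv.swap_comm _ _]
    rw [hsw] at hgT
    obtain ⟨hu, hv, hall⟩ := split_of_covers hc₁ hlt
    rw [← hgT] at hu hv hall
    set g := σ * pairing e n T with hg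
    obtain ⟨y, hy, u', v', huv', hu', hv'⟩ : ∃ y ∈ symmDiff T S₂, ∃ u' v',
        ((u' = e y ∧ v' = n y) ∨ (u' = n y ∧ v' = e y)) ∧ Path g ∅ b u' ∧ ¬ Path g ∅ b v' := by
      by_contra! hno
      have hiff : ∀ i ∈ symmDiff T S₂, (Path g ∅ b (e i) ↔ Path g ∅ b (n i)) := fun i hi =>
        ⟨hno i hi _ _ (.inl ⟨rfl, rfl⟩), hno i hi _ _ (.inr ⟨rfl, rfl⟩)⟩
      refine hv (mem_of_path (g := ⇑(σ * pairing e n S₂)) (C := {p | Path g ∅ b p}) .refl ?_ (hc₂ v))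
      intro p _ hp
      have h1 : (σ * pairing e n S₂) p = g (pairing e n T (pairing e n S₂ p)) := by
        rw [hg, Equiv.Perm.mul_apply, Equiv.Perm.mul_apply, pairing_pairing (hY.mono hTY)]
      rw [h1]
      refine path_apply_iff.2 ?_
      have hp : Path g ∅ b p := hp
      rcases pairing_cases (hY.mono h₂) p with ⟨i, hi, rfl, h⟩ | ⟨i, hi, rfl, h⟩ | ⟨hn, h⟩ <;> rw [h]
      · by_cases hiT : i ∈ T
        · rwa [pairing_hd (hY.mono hTY) hiT]
        · rw [pairing_hd_of_notMem hY hTY (h₂ hi) hiT]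
          exact (hiff i (Finset.mem_symmDiff.2 (.inr ⟨hi, hiT⟩))).1 hp
      · by_cases hiT : i ∈ T
        · rwa [pairing_tl (hY.mono hTY) hiT]
        · rw [pairing_tl_of_notMem hY hTY (h₂ hi) hiT]
          exact (hiff i (Finset.mem_symmDiff.2 (.inr ⟨hi, hiT⟩))).2 hp
      · rcases pairing_cases (hY.mono hTY) p with ⟨i, hi, rfl, h'⟩ | ⟨i, hi, rfl, h'⟩ | ⟨-, h'⟩ <;>
          rw [h']
        · exact (hiff i (Finset.mem_symmDiff.2 (.inl ⟨hi, fun h2 => (hn i h2).1 rfl⟩))).1 hp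
        · exact (hiff i (Finset.mem_symmDiff.2 (.inl ⟨hi, fun h2 => (hn i h2).2 rfl⟩))).2 hp
        · exact hp
    have hyY : y ∈ Y := by
      rcases Finset.mem_symmDiff.1 hy with h | h
      exacts [hTY h.1, h₂ h.1]
    have hgU := mul_pairing_symmDiff (σ := σ) hY hTY hyY
    have hsw' : Equiv.swap (e y) (n y) = Equiv.swap u' v' := by
      rcases huv' with ⟨rfl, rfl⟩ | ⟨rfl, rfl⟩
      exacts [rfl, Equiv.swap_comm _ _]
    rw [hsw'] at hgU
    have hvv' : Path g ∅ v v' := (hall v').resolve_left hv'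
    have hcU : Covers (σ * pairing e n (symmDiff T {y})) b := by
      rw [hgU]
      exact covers_join hu' hv' fun p => (hall p).imp_right fun hp => (path_symm hvv').trans hp
    have hUY : symmDiff T {y} ⊆ Y := by
      intro i hi
      rcases Finset.mem_symmDiff.1 hi with h | h
      · exact hTY h.1
      · rw [Finset.mem_singleton.1 h.1]; exact hyY
    have hg₁ : σ * pairing e n S₁ = g * Equiv.swap u v := by
      rw [hgT, mul_assoc, Equiv.swap_mul_self, mul_one]
    rw [← ih _ ?_ hUY hcU rfl, hgU, hg₁]
    · conv_lhs => rw [hS₁]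
      exact turning_exchange hY (hpot T hTY) hxY hyY huv huv' hu hv hu' hv' hall
    · rw [← hN]
      rw [symmDiff_singleton_symmDiff hy, hT, symmDiff_singleton_symmDiff hx]
      exact ((Finset.card_le_card (Finset.erase_subset _ _)).trans_lt
        (Finset.card_erase_lt_of_mem hx))

end StateSum

/-! ### The determinant of a diagram that is cut open -/

namespace StateSum
open Walk Matrix
open scoped Classical

variable {P ι F : Type*} [Field F]

/-- If the rows of `A` add up to zero and `l` is a kernel vector of `A`, then the minors of `A`, written
as determinants in which one row is a unit vector, are proportional to the entries of `l`. -/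
theorem mul_det_updateRow_single [Fintype P] {A : Matrix P P F} (hsum : ∀ q, ∑ p, A p q = 0) {l : P → F}
    (hl : A *ᵥ l = 0) (hl0 : l ≠ 0) (b b' p p' : P) :
    l p' * (A.updateRow b (Pi.single p 1)).det = l p * (A.updateRow b' (Pi.single p' 1)).det := by
  have h1 : ∀ w : P → F, (A.updateRow b w).det = (A.updateRow b' w).det := by
    intro w
    by_cases hbb : b = b'
    · rw [hbb]
    have h0 : ((A.updateRow b w).updateRow b' (A b + A b')).det = 0 := by
      refine Matrix.exists_vecMul_eq_zero_iff.1 ⟨Function.update 1 b 0, fun h => ?_, ?_⟩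
      · simpa [Function.update_of_ne (Ne.symm hbb)] using congrFun h b'
      · ext q
        have h2 := hsum q
        have hrest : ∀ p ∈ (Finset.univ.erase b).erase b', Function.update (1 : P → F) b 0 p *
            ((A.updateRow b w).updateRow b' (A b + A b')) p q = A p q := by
          intro p hp
          have hp1 : p ≠ b' := (Finset.mem_erase.1 hp).1
          have hp2 : p ≠ b := (Finset.mem_erase.1 (Finset.mem_erase.1 hp).2).1
          rw [updateRow_ne hp1, updateRow_ne hp2, Function.update_of_ne hp2]
          simp
        rw [← Finset.add_sum_erase _ _ (Finset.mem_univ b),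
          ← Finset.add_sum_erase _ _ (show b' ∈ Finset.univ.erase b by simp [Ne.symm hbb])] at h2
        rw [Pi.zero_apply, vecMul, dotProduct, ← Finset.add_sum_erase _ _ (Finset.mem_univ b),
          ← Finset.add_sum_erase _ _ (show b' ∈ Finset.univ.erase b by simp [Ne.symm hbb]),
          Finset.sum_congr rfl hrest, Function.update_self, zero_mul,
          Function.update_of_ne (Ne.symm hbb), updateRow_self]
        simpa [add_assoc] using h2
    rw [det_updateRow_add] at h0
    have h2 : (A.updateRow b w).updateRow b' (A b') = A.updateRow b w := by
      ext p q
      by_cases hp : p = b'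
      · subst hp; rw [updateRow_self, updateRow_ne (Ne.symm hbb)]
      · rw [updateRow_ne hp]
    have h3 : ((A.updateRow b w).updateRow b' (A b)).det = -(A.updateRow b' w).det := by
      have := det_permute (Equiv.swap b b') (A.updateRow b' w)
      rw [Equiv.Perm.sign_swap hbb] at this
      rw [show (A.updateRow b w).updateRow b' (A b) =
        (A.updateRow b' w).submatrix (Equiv.swap b b') id from ?_, this]
      · simp
      · ext p q
        by_cases hp : p = b'
        · subst hp; rw [updateRow_self]; simp [updateRow_ne hbb]
        · rw [updateRow_ne hp]
          by_cases hp' : p = b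
          · subst hp'; simp
          · simp [updateRow_ne hp', Equiv.swap_apply_of_ne_of_ne hp' hp, updateRow_ne hp]
    rw [h2, h3] at h0
    linear_combination h0
  have h2 : (A.updateRow b (l p' • Pi.single p 1 - l p • Pi.single p' 1)).det = 0 := by
    refine Matrix.exists_mulVec_eq_zero_iff.1 ⟨l, hl0, ?_⟩
    ext q
    by_cases hq : q = b
    · subst hq
      simp [mulVec, dotProduct, Pi.single_apply, sub_mul, Finset.sum_sub_distrib]
      ring
    · simpa [mulVec, updateRow_ne hq] using congrFun hl q
  rw [sub_eq_add_neg, ← neg_smul, det_updateRow_add, det_updateRow_smul, det_updateRow_smul] at h2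
  rw [← h1]
  linear_combination h2

/-- The row of the point `p`: a walk that arrives at `p` stays on its strand or leaves it for `hd i` if
`p = tl i`, with weights that add up to one. -/
noncomputable def passage (tl hd : ι → P) (c : ι → F) (U : Finset ι) (p : P) : P → F :=
  Pi.single p 1 + ∑ i ∈ U, if p = tl i then (c i - 1) • (Pi.single p 1 - Pi.single (hd i) 1) else 0

/-- The matrix `(p, q) ↦ [q = g p] - passage p q`, whose rows add up to zero. -/
noncomputable def closedMatrix (g : Equiv.Perm P) (tl hd : ι → P) (c : ι → F) (U : Finset ι) :
    Matrix P P F :=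
  fun p => Pi.single (g p) 1 - passage tl hd c U p

/-- The determinant of a diagram that is cut open in front of the point `b`. -/
noncomputable def basedDet [Fintype P] (g : Equiv.Perm P) (tl hd : ι → P) (c : ι → F)
    (U : Finset ι) (b : P) : F :=
  ((Equiv.Perm.sign g : ℤ) : F) *
    ((closedMatrix g tl hd c U).updateCol b (Pi.single (g.symm b) 1)).det

section
variable {g : Equiv.Perm P} {tl hd : ι → P} {c : ι → F} {U : Finset ι} {b p : P} {i : ι}

theorem passage_tl (hU : Distinct tl hd U) (hi : i ∈ U) :
    passage tl hd c U (tl i) = c i • Pi.single (tl i) 1 + (1 - c i) • Pi.single (hd i) 1 := by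
  unfold passage
  rw [Finset.sum_eq_single_of_mem i hi fun j hj hji =>
    if_neg fun h => hji (hU.tl_inj i hi j hj h).symm, if_pos rfl]
  ext q
  simp only [Pi.add_apply, Pi.smul_apply, Pi.sub_apply, smul_eq_mul]
  ring

theorem passage_of_ne (h : ∀ i ∈ U, p ≠ tl i) : passage tl hd c U p = Pi.single p 1 := by
  unfold passage
  rw [Finset.sum_eq_zero fun i hi => if_neg (h i hi), add_zero]

theorem passage_congr {tl' hd' : ι → P} {c' : ι → F}
    (h : ∀ i ∈ U, tl' i = tl i ∧ hd' i = hd i ∧ c' i = c i) :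
    passage tl' hd' c' U p = passage tl hd c U p := by
  unfold passage
  congr 1
  refine Finset.sum_congr rfl fun i hi => ?_
  rw [(h i hi).1, (h i hi).2.1, (h i hi).2.2]

theorem sum_passage [Fintype P] : ∑ q, passage tl hd c U p q = 1 := by
  simp only [passage, Pi.add_apply, Finset.sum_add_distrib, Finset.sum_apply]
  rw [Finset.sum_comm]
  have : ∀ i ∈ U, ∑ q, (if p = tl i then (c i - 1) • ((Pi.single p 1 - Pi.single (hd i) 1 : P → F))
      else 0 : P → F) q = 0 := by
    intro i _
    split_ifs
    · simp [← Finset.mul_sum, Finset.sum_sub_distrib]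
    · simp
  rw [Finset.sum_congr rfl this]
  simp

theorem closedMatrix_mulVec_one [Fintype P] : ∑ q, closedMatrix g tl hd c U p q = 0 := by
  simp [closedMatrix, Finset.sum_sub_distrib, sum_passage]

theorem basedDet_congr [Fintype P] {tl' hd' : ι → P} {c' : ι → F}
    (h : ∀ i ∈ U, tl' i = tl i ∧ hd' i = hd i ∧ c' i = c i) :
    basedDet g tl' hd' c' U b = basedDet g tl hd c U b := by
  unfold basedDet closedMatrix
  simp only [passage_congr h]

/-- The linear map that deletes the coordinate `b`. -/
noncomputable def dropCoord (b : P) : (P → F) →ₗ[F] (P → F) where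
  toFun x := Function.update x b 0
  map_add' x y := by
    ext q
    by_cases h : q = b
    · subst h; simp
    · simp [h]
  map_smul' a x := by
    ext q
    by_cases h : q = b
    · subst h; simp
    · simp [h]

theorem based_row : (closedMatrix g tl hd c U).updateCol b (Pi.single (g.symm b) 1) p =
    Pi.single (g p) 1 - dropCoord b (passage tl hd c U p) := by
  ext q
  by_cases h : q = b
  · subst h
    simp [dropCoord, Pi.single_apply, Equiv.eq_symm_apply, eq_comm]
  · simp [dropCoord, closedMatrix, h]

/-- The skein relation for the determinant. -/
theorem basedDet_skein [Fintype P] (hY : Distinct tl hd U) (hi : i ∈ U) {tl' hd' : ι → P}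
    {c' : ι → F} {t : F} (ht : t ≠ 0) (hne : ∀ j ∈ U, j ≠ i → tl' j = tl j ∧ hd' j = hd j ∧ c' j = c j)
    (htl : tl' i = hd i) (hhd : hd' i = tl i) (hc : c i = t) (hc' : c' i = t⁻¹) :
    basedDet g tl hd c U b - t * basedDet g tl' hd' c' U b =
      (1 - t) * basedDet (g * Equiv.swap (tl i) (hd i)) tl hd c (U.erase i) b := by
  set u := tl i with hu
  set v := hd i with hv
  have huv : u ≠ v := hY.ne i hi i hi
  have hY' : Distinct tl' hd' U := by
    refine ⟨fun j hj k hk h => ?_, fun j hj k hk h => ?_, fun j hj k hk h => ?_⟩ <;>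
      by_cases hji : j = i <;> by_cases hki : k = i
    · rw [hji, hki]
    · rw [hji, htl, (hne k hk hki).1] at h
      exact absurd h.symm (hY.ne k hk i hi)
    · rw [hki, htl, (hne j hj hji).1] at h
      exact absurd h (hY.ne j hj i hi)
    · rw [(hne j hj hji).1, (hne k hk hki).1] at h
      exact hY.tl_inj j hj k hk h
    · rw [hji, hki]
    · rw [hji, hhd, (hne k hk hki).2.1] at h
      exact absurd h (hY.ne i hi k hk)
    · rw [hki, hhd, (hne j hj hji).2.1] at h
      exact absurd h.symm (hY.ne i hi j hj)
    · rw [(hne j hj hji).2.1, (hne k hk hki).2.1] at h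
      exact hY.hd_inj j hj k hk h
    · rw [hji, hki, htl, hhd] at h
      exact huv h.symm
    · rw [hji, htl, (hne k hk hki).2.1] at h
      exact hki (hY.hd_inj i hi k hk h).symm
    · rw [hki, hhd, (hne j hj hji).1] at h
      exact hji (hY.tl_inj j hj i hi h)
    · rw [(hne j hj hji).1, (hne k hk hki).2.1] at h
      exact hY.ne j hj k hk h
  have hE : Distinct tl hd (U.erase i) := hY.mono (Finset.erase_subset _ _)
  set N := (closedMatrix (g * Equiv.swap u v) tl hd c (U.erase i)).updateCol b
    (Pi.single ((g * Equiv.swap u v).symm b) 1) with hN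
  -- the determinant as a function of the rows of the two passages of the crossing
  let D : (P → F) → (P → F) → F := fun x y => ((N.updateRow u x).updateRow v y).det
  have hadd1 : ∀ x x' y, D (x + x') y = D x y + D x' y := by
    intro x x' y
    simp only [D, updateRow_comm _ huv, det_updateRow_add]
  have hsmul1 : ∀ (a : F) x y, D (a • x) y = a * D x y := by
    intro a x y
    simp only [D, updateRow_comm _ huv, det_updateRow_smul]
  have hadd2 : ∀ x y y', D x (y + y') = D x y + D x y' := fun x y y' => det_updateRow_add _ _ _ _
  have hsmul2 : ∀ (a : F) x y, D x (a • y) = a * D x y := fun a x y => det_updateRow_smul _ _ _ _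
  have hself : ∀ x, D x x = 0 := fun x => det_zero_of_row_eq huv (by
    rw [updateRow_self, updateRow_ne huv, updateRow_self])
  have halt : ∀ x y, D x y = -D y x := by
    intro x y
    have := hself (x + y)
    rw [hadd1, hadd2, hadd2, hself, hself] at this
    linear_combination this
  have hsub1 : ∀ x x' y, D (x - x') y = D x y - D x' y := by
    intro x x' y
    have := hadd1 (x - x') x' y
    rw [sub_add_cancel] at this
    linear_combination -this
  have hsub2 : ∀ x y y', D x (y - y') = D x y - D x y' := by
    intro x y y'
    have := hadd2 x (y - y') y'
    rw [sub_add_cancel] at this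
    linear_combination -this
  have hrow : ∀ (M : Matrix P P F), (∀ p, p ≠ u → p ≠ v → M p = N p) → M.det = D (M u) (M v) := by
    intro M hM
    simp only [D]
    congr 1
    ext p q
    by_cases hpv : p = v
    · rw [hpv, updateRow_self]
    · rw [updateRow_ne hpv]
      by_cases hpu : p = u
      · rw [hpu, updateRow_self]
      · rw [updateRow_ne hpu, hM p hpu hpv]
  have hother : ∀ p, p ≠ u → p ≠ v → passage tl hd c U p = passage tl hd c (U.erase i) p ∧
      passage tl' hd' c' U p = passage tl hd c (U.erase i) p := by
    intro p hpu hpv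
    by_cases hp : ∃ j ∈ U, p = tl j
    · obtain ⟨j, hj, rfl⟩ := hp
      have hji : j ≠ i := fun h => hpu (h ▸ rfl)
      refine ⟨by rw [passage_tl hY hj, passage_tl hE (by simp [hj, hji])], ?_⟩
      obtain ⟨h1, h2, h3⟩ := hne j hj hji
      rw [← h1, passage_tl hY' hj, h1, passage_tl hE (by simp [hj, hji]), h2, h3]
    · push Not at hp
      refine ⟨by rw [passage_of_ne hp,
        passage_of_ne fun j hj => hp j (Finset.mem_of_mem_erase hj)], ?_⟩
      rw [passage_of_ne, passage_of_ne fun j hj => hp j (Finset.mem_of_mem_erase hj)]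
      intro j hj
      by_cases hji : j = i
      · rwa [hji, htl]
      · rw [(hne j hj hji).1]; exact hp j hj
  have h1 := hrow ((closedMatrix g tl hd c U).updateCol b (Pi.single (g.symm b) 1)) fun p hpu hpv => by
    rw [hN, based_row, based_row, (hother p hpu hpv).1, mul_swap_of_ne hpu hpv]
  have h2 := hrow ((closedMatrix g tl' hd' c' U).updateCol b (Pi.single (g.symm b) 1))
    fun p hpu hpv => by
      rw [hN, based_row, based_row, (hother p hpu hpv).2, mul_swap_of_ne hpu hpv]
  have h3 := hrow N fun _ _ _ => rfl
  have hsign : ((Equiv.Perm.sign (g * Equiv.swap u v) : ℤ) : F) = -((Equiv.Perm.sign g : ℤ) : F) := by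
    rw [Equiv.Perm.sign_mul, Equiv.Perm.sign_swap huv]
    simp
  unfold basedDet
  rw [h1, h2, ← hN, h3, hsign, hN]
  simp only [based_row]
  have p1 : passage tl hd c U u = t • Pi.single u 1 + (1 - t) • Pi.single v 1 := by
    rw [← hc]; exact passage_tl hY hi
  have p2 : passage tl hd c U v = Pi.single v 1 := passage_of_ne fun j hj h => hY.ne j hj i hi h.symm
  have p3 : passage tl' hd' c' U v = t⁻¹ • Pi.single v 1 + (1 - t⁻¹) • Pi.single u 1 := by
    rw [← hc', ← htl, ← hhd]; exact passage_tl hY' hi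
  have p4 : passage tl' hd' c' U u = Pi.single u 1 := by
    rw [← hhd]; exact passage_of_ne fun j hj h => hY'.ne j hj i hi h.symm
  have p5 : passage tl hd c (U.erase i) u = Pi.single u 1 := passage_of_ne fun j hj h =>
    (Finset.mem_erase.1 hj).1 (hY.tl_inj i hi j (Finset.mem_of_mem_erase hj) h).symm
  have p6 : passage tl hd c (U.erase i) v = Pi.single v 1 := passage_of_ne fun j hj h =>
    hY.ne j (Finset.mem_of_mem_erase hj) i hi h.symm
  rw [p1, p2, p3, p4, p5, p6, mul_swap_left, mul_swap_right]
  simp only [map_add, map_smul, hsub1, hsub2, hadd1, hadd2, hsmul1, hsmul2, hself]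
  have a2 := halt (Pi.single (g v) 1) (Pi.single (g u) 1)
  have a3 := halt (dropCoord b (Pi.single u 1)) (Pi.single (g u) 1)
  have a4 := halt (Pi.single (g v) 1) (dropCoord b (Pi.single v 1))
  rw [a2, a3, a4]
  field_simp
  ring

/-- For a knot on which every crossing is met first at `hd`, the columns can be ordered such that the
matrix becomes triangular. -/
theorem basedDet_eq_one [Fintype P] (hcov : Covers g b) (hU : Distinct tl hd U)
    (h : ∀ i ∈ U, Before g b (hd i) (tl i)) : basedDet g tl hd c U b = 1 := by
  set M := (closedMatrix g tl hd c U).updateCol b (Pi.single (g.symm b) 1) with hM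
  have hinj : Function.Injective (arrival g b) := fun p q hpq => arrival_inj (hcov p) (hcov q) hpq
  have hzero : ∀ p q : P, g q ≠ b → arrival g b p ≤ arrival g b q → passage tl hd c U p (g q) = 0 := by
    intro p q hq hpq
    have hs := arrival_step g.injective (hcov q) hq
    have hne : ∀ x, arrival g b x ≤ arrival g b q → g q ≠ x := by
      rintro x hx rfl; omega
    by_cases hp : ∃ i ∈ U, p = tl i
    · obtain ⟨i, hi, rfl⟩ := hp
      have := (before_iff_arrival_lt (hcov _) (hcov _)).1 (h i hi)
      rw [passage_tl hU hi]
      simp [hne _ hpq, hne _ (this.le.trans hpq)]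
    · push Not at hp
      rw [passage_of_ne hp]
      simp [hne _ hpq]
  have hent : ∀ p q : P, arrival g b p ≤ arrival g b q →
      (p = q → M p (g q) = 1) ∧ (p ≠ q → M p (g q) = 0) := by
    intro p q hpq
    rw [hM, based_row]
    by_cases hq : g q = b
    · have : dropCoord b (passage tl hd c U p) (g q) = 0 := by rw [hq]; simp [dropCoord]
      rw [Pi.sub_apply, this, sub_zero, Pi.single_apply, g.injective.eq_iff]
      exact ⟨fun h => if_pos h.symm, fun h => if_neg h.symm⟩
    · have : dropCoord b (passage tl hd c U p) (g q) = 0 := by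
        rw [← hzero p q hq hpq]; simp [dropCoord, hq]
      rw [Pi.sub_apply, this, sub_zero, Pi.single_apply, g.injective.eq_iff]
      exact ⟨fun h => if_pos h.symm, fun h => if_neg h.symm⟩
  let _ : LinearOrder P := LinearOrder.lift' (arrival g b) hinj
  have hlt : ∀ p q : P, p < q ↔ arrival g b p < arrival g b q := fun _ _ => Iff.rfl
  have htri : (M.submatrix id g).IsLowerTriangular := by
    intro p q hpq
    have hpq : p < q := hpq
    rw [submatrix_apply, id, (hent p q ((hlt p q).1 hpq).le).2 hpq.ne]
  have hdet : (M.submatrix id g).det = 1 := by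
    rw [det_of_isLowerTriangular _ htri]
    exact Finset.prod_eq_one fun p _ => by rw [submatrix_apply, id, (hent p p le_rfl).1 rfl]
  rw [det_permute'] at hdet
  unfold basedDet
  convert hdet

/-- If the walks never leave a set `C` that does not contain the base point, then the block of `C` has
rows that add up to zero. -/
theorem basedDet_eq_zero [Fintype P] {C : Set P} (hU : Distinct tl hd U) (hb : b ∉ C) (hne : C.Nonempty)
    (hg : ∀ p, g p ∈ C ↔ p ∈ C) (hC : ∀ i ∈ U, tl i ∈ C → hd i ∈ C) :
    basedDet g tl hd c U b = 0 := by
  set M := (closedMatrix g tl hd c U).updateCol b (Pi.single (g.symm b) 1) with hM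
  have hoff : ∀ p ∈ C, ∀ q ∉ C, M p q = 0 := by
    intro p hp q hq
    have hpq : q ≠ p := by rintro rfl; exact hq hp
    have hgq : q ≠ g p := by rintro rfl; exact hq ((hg p).2 hp)
    have : passage tl hd c U p q = 0 := by
      by_cases h : ∃ i ∈ U, p = tl i
      · obtain ⟨i, hi, rfl⟩ := h
        have : q ≠ hd i := by rintro rfl; exact hq (hC i hi hp)
        rw [passage_tl hU hi]
        simp [hpq, this]
      · push Not at h
        rw [passage_of_ne h]
        simp [hpq]
    rw [hM, based_row]
    by_cases hqb : q = b
    · subst hqb; simp [dropCoord, hgq]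
    · simp [dropCoord, hgq, hqb, this]
  have hdet : M.det = 0 := by
    rw [twoBlockTriangular_det' M (fun p => p ∈ C) hoff]
    refine mul_eq_zero_of_left (Matrix.exists_mulVec_eq_zero_iff.1 ⟨1, ?_, ?_⟩) _
    · obtain ⟨p, hp⟩ := hne
      exact fun h => by simpa using congrFun h ⟨p, hp⟩
    · ext ⟨p, hp⟩
      have h1 : ∑ q, M p q = ∑ q, closedMatrix g tl hd c U p q := by
        refine Finset.sum_congr rfl fun q _ => ?_
        by_cases hqb : q = b
        · subst hqb
          have h2 := hoff p hp q hb
          rw [h2]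
          have hgq : q ≠ g p := by rintro rfl; exact hb ((hg p).2 hp)
          have hpq : q ≠ p := by rintro rfl; exact hb hp
          unfold closedMatrix
          by_cases h : ∃ i ∈ U, p = tl i
          · obtain ⟨i, hi, rfl⟩ := h
            have : q ≠ hd i := by rintro rfl; exact hb (hC i hi hp)
            rw [passage_tl hU hi]
            simp [hpq, this, hgq]
          · push Not at h
            rw [passage_of_ne h]
            simp [hpq, hgq]
        · rw [hM, updateCol_ne hqb]
      rw [closedMatrix_mulVec_one] at h1
      rw [← Finset.sum_subset (Finset.subset_univ {q | q ∈ C})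
        (fun q _ hq => hoff p hp q (by simpa using hq)),
        Finset.sum_subtype (p := fun q => q ∈ C) _ (by simp)] at h1
      simpa [mulVec, dotProduct, toSquareBlockProp] using h1
  unfold basedDet
  rw [← hM, hdet, mul_zero]

/-- The dependence of the determinant on the base point. -/
theorem mul_basedDet [Fintype P] {l : P → F} (hl0 : l ≠ 0)
    (hl : ∀ q, ∑ p, l p * closedMatrix g tl hd c U p q = 0) (b b' : P) :
    l (g.symm b') * basedDet g tl hd c U b = l (g.symm b) * basedDet g tl hd c U b' := by
  have h := mul_det_updateRow_single (A := (closedMatrix g tl hd c U)ᵀ) (l := l)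
    (fun q => by simpa using closedMatrix_mulVec_one (p := q)) ?_ hl0 b b' (g.symm b) (g.symm b')
  · rw [updateRow_transpose, updateRow_transpose, det_transpose, det_transpose] at h
    unfold basedDet
    linear_combination ((Equiv.Perm.sign g : ℤ) : F) * h
  · ext q
    rw [Pi.zero_apply, ← hl q]
    simp [mulVec, dotProduct, mul_comm]

end

end StateSum

/-! ### The state sum as a normalised determinant -/

namespace StateSum
open Walk
open scoped Classical

variable {P ι F R : Type*}

/-- The upper passage of a crossing with eastward passage `e i`, northward passage `n i` and sign
`ε i`. -/
def upper (e n : ι → P) (ε : ι → ℤˣ) (i : ι) : P := if ε i = 1 then e i else n i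

/-- The lower passage of a crossing with eastward passage `e i`, northward passage `n i` and sign
`ε i`. -/
def lower (e n : ι → P) (ε : ι → ℤˣ) (i : ι) : P := if ε i = 1 then n i else e i

section
variable {σ : Equiv.Perm P} {e n : ι → P} {Y S : Finset ι} {ε : ι → ℤˣ} {b : P} {i : ι}

theorem upper_lower_cases (e n : ι → P) (ε : ι → ℤˣ) (i : ι) :
    (ε i = 1 ∧ upper e n ε i = e i ∧ lower e n ε i = n i) ∨
      (ε i = -1 ∧ upper e n ε i = n i ∧ lower e n ε i = e i) := by
  rcases Int.units_eq_one_or (ε i) with h | h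
  · simp [upper, lower, h]
  · simp [upper, lower, h]

theorem Distinct.upper_lower (hY : Distinct e n Y) (ε : ι → ℤˣ) :
    Distinct (upper e n ε) (lower e n ε) Y := by
  refine ⟨fun i hi j hj h => ?_, fun i hi j hj h => ?_, fun i hi j hj h => ?_⟩ <;>
    rcases upper_lower_cases e n ε i with ⟨h1, h2, h3⟩ | ⟨h1, h2, h3⟩ <;>
    rcases upper_lower_cases e n ε j with ⟨h4, h5, h6⟩ | ⟨h4, h5, h6⟩ <;>
    simp only [h2, h3, h5, h6] at h
  · exact hY.tl_inj i hi j hj h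
  · exact absurd h (hY.ne i hi j hj)
  · exact absurd h.symm (hY.ne j hj i hi)
  · exact hY.hd_inj i hi j hj h
  · exact hY.hd_inj i hi j hj h
  · exact absurd h.symm (hY.ne j hj i hi)
  · exact absurd h (hY.ne i hi j hj)
  · exact hY.tl_inj i hi j hj h
  · exact hY.ne i hi j hj h
  · have := hY.tl_inj i hi j hj h
    subst this
    rw [h1] at h4
    exact absurd h4 (by decide)
  · have := hY.hd_inj i hi j hj h
    subst this
    rw [h1] at h4
    exact absurd h4 (by decide)
  · exact hY.ne j hj i hi h.symm

theorem upper_lower_congr {ε' : ι → ℤˣ} (h : ε i = ε' i) :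
    upper e n ε i = upper e n ε' i ∧ lower e n ε i = lower e n ε' i := by
  simp only [upper, lower, h, and_self]

theorem mul_pairing_insert (hY : Distinct e n Y) (hS : S ⊆ Y) (hi : i ∈ Y \ S) :
    σ * pairing e n (insert i S) = σ * pairing e n S * Equiv.swap (e i) (n i) := by
  obtain ⟨hi, hiS⟩ := Finset.mem_sdiff.1 hi
  rw [← mul_pairing_symmDiff hY hS hi]
  congr 2
  ext j
  by_cases h : j = i <;> simp [Finset.mem_symmDiff, h, hiS]

theorem IsPotential.smooth {r : P → ℤ} (hY : Distinct e n Y)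
    (hr : IsPotential σ e n Y ∅ (fun _ => 1) r) (hS : S ⊆ Y) :
    IsPotential (σ * pairing e n S) e n Y S (fun _ => 1) r where
  corner := hr.corner
  smooth_east i hi := by
    rw [Equiv.Perm.mul_apply, pairing_tl (hY.mono hS) hi, hr.north i (hS hi) (by simp),
      hr.corner i (hS hi)]
  smooth_north i hi := by
    rw [Equiv.Perm.mul_apply, pairing_hd (hY.mono hS) hi, hr.east i (hS hi) (by simp),
      hr.corner i (hS hi), add_sub_cancel_right]
  east i hi hiS := by
    rw [Equiv.Perm.mul_apply, pairing_tl_of_notMem hY hS hi hiS, hr.east i hi (by simp)]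
  north i hi hiS := by
    rw [Equiv.Perm.mul_apply, pairing_hd_of_notMem hY hS hi hiS, hr.north i hi (by simp)]
  plain p hp := by
    rw [Equiv.Perm.mul_apply, pairing_of_ne fun i hi => hp i (hS hi), hr.plain p hp]

theorem sum_mul_passage [Fintype P] [Field F] {tl hd : ι → P} {c : ι → F} (l : P → F) (q : P) :
    ∑ p, l p * passage tl hd c Y p q = l q + ∑ i ∈ Y, l (tl i) * (c i - 1) *
      ((if q = tl i then 1 else 0) - (if q = hd i then 1 else 0)) := by
  simp only [passage, Pi.add_apply, Finset.sum_apply, mul_add, Finset.sum_add_distrib,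
    Finset.mul_sum]
  rw [Finset.sum_comm]
  congr 1
  · simp [Pi.single_apply]
  · refine Finset.sum_congr rfl fun i _ => ?_
    rw [Finset.sum_eq_single (tl i) (fun p _ hp => by simp [hp]) (by simp)]
    simp only [if_true, Pi.smul_apply, Pi.sub_apply, Pi.single_apply, smul_eq_mul]
    ring

/-- The powers of `t` given by the potential of the diagram itself form a left kernel vector: the rules
of `IsPotential` say that the potential is an Alexander numbering of the regions. -/
theorem sum_zpow_mul_closedMatrix [Fintype P] [Field F] {g : Equiv.Perm P} (hY : Distinct e n Y)
    {r : P → ℤ} (hr : IsPotential g e n Y S (fun _ => 1) r) {t : F} (ht : t ≠ 0)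
    (ε : ι → ℤˣ) (q : P) :
    ∑ p, t ^ r (g p) * closedMatrix g (upper e n ε) (lower e n ε) (fun i => t ^ ((ε i : ℤˣ) : ℤ))
      (Y \ S) p q = 0 := by
  simp only [closedMatrix, Pi.sub_apply, mul_sub, Finset.sum_sub_distrib]
  rw [sum_mul_passage (fun p => t ^ r (g p)),
    Finset.sum_eq_single (g.symm q) (fun p _ hp => by
      rw [Pi.single_apply, if_neg, mul_zero]
      rintro rfl
      simp at hp) (by simp)]
  simp only [Equiv.apply_symm_apply, Pi.single_eq_same, mul_one]
  rw [sub_eq_zero]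
  have hU : Distinct (upper e n ε) (lower e n ε) (Y \ S) :=
    (hY.upper_lower ε).mono Finset.sdiff_subset
  by_cases h1 : ∃ i ∈ Y \ S, q = upper e n ε i
  · obtain ⟨i, hi, rfl⟩ := h1
    obtain ⟨hiY, hiS⟩ := Finset.mem_sdiff.1 hi
    rw [Finset.sum_eq_single_of_mem i hi fun j hj hji => ?_]
    · rw [if_pos rfl, if_neg (hU.ne i hi i hi)]
      rcases upper_lower_cases e n ε i with ⟨h2, h3, -⟩ | ⟨h2, h3, -⟩ <;> rw [h3]
      · rw [hr.east i hiY hiS, h2, zpow_sub₀ ht]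
        simp only [Units.val_one, zpow_one]
        field_simp
        ring
      · rw [hr.north i hiY hiS, h2, zpow_add₀ ht]
        simp only [Units.val_neg, Units.val_one, zpow_one, zpow_neg]
        field_simp
        ring
    · rw [if_neg fun h => hji (hU.tl_inj i hi j hj h).symm, if_neg (hU.ne i hi j hj), sub_zero,
        mul_zero]
  by_cases h2 : ∃ i ∈ Y \ S, q = lower e n ε i
  · obtain ⟨i, hi, rfl⟩ := h2
    obtain ⟨hiY, hiS⟩ := Finset.mem_sdiff.1 hi
    have hc := hr.corner i hiY
    rw [Finset.sum_eq_single_of_mem i hi fun j hj hji => ?_]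
    · rw [if_pos rfl, if_neg (hU.ne i hi i hi).symm]
      rcases upper_lower_cases e n ε i with ⟨h2, h3, h4⟩ | ⟨h2, h3, h4⟩ <;> rw [h3, h4]
      · rw [hr.east i hiY hiS, hr.north i hiY hiS, h2, hc, add_sub_cancel_right, zpow_add₀ ht]
        simp only [Units.val_one, zpow_one]
        ring
      · rw [hr.east i hiY hiS, hr.north i hiY hiS, h2, hc, add_sub_cancel_right, zpow_add₀ ht]
        simp only [Units.val_neg, Units.val_one, zpow_one, zpow_neg]
        field_simp
        ring
    · rw [if_neg fun h => hji (hU.hd_inj i hi j hj h).symm, if_neg (hU.ne j hj i hi).symm, sub_zero,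
        mul_zero]
  push Not at h1 h2
  rw [Finset.sum_eq_zero fun i hi => by rw [if_neg (h1 i hi), if_neg (h2 i hi), sub_zero, mul_zero],
    add_zero]
  congr 1
  by_cases h3 : ∃ i ∈ Y, q = e i ∨ q = n i
  · obtain ⟨i, hi, hq⟩ := h3
    have hiS : i ∈ S := by
      by_contra hiS
      have hi' := Finset.mem_sdiff.2 ⟨hi, hiS⟩
      have h4 := h1 i hi'
      have h5 := h2 i hi'
      rcases upper_lower_cases e n ε i with ⟨_, h6, h7⟩ | ⟨_, h6, h7⟩ <;> rw [h6] at h4 <;>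
        rw [h7] at h5 <;> tauto
    rcases hq with rfl | rfl
    exacts [(hr.smooth_east i hiS).symm, (hr.smooth_north i hiS).symm]
  · push Not at h3
    exact (hr.plain q h3).symm

theorem basedDet_base [Fintype P] [Field F] {g : Equiv.Perm P} (hY : Distinct e n Y)
    {r : P → ℤ} (hr : IsPotential g e n Y S (fun _ => 1) r) {t : F} (ht : t ≠ 0)
    (ε : ι → ℤˣ) (b b' : P) :
    t ^ r b' * basedDet g (upper e n ε) (lower e n ε) (fun i => t ^ ((ε i : ℤˣ) : ℤ)) (Y \ S) b =
      t ^ r b * basedDet g (upper e n ε) (lower e n ε) (fun i => t ^ ((ε i : ℤˣ) : ℤ)) (Y \ S) b' := by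
  have := mul_basedDet (l := fun p => t ^ r (g p))
    (fun h => zpow_ne_zero (r (g b)) ht (congrFun h b)) (sum_zpow_mul_closedMatrix hY hr ht ε) b b'
  simpa using this

/-- Some choice of the signs makes `O` lie below the rest of the diagram: every crossing with its upper
passage on `O` has its lower passage on `O`, too. -/
theorem exists_layered (e n : ι → P) (O : Set P) :
    ∃ ε : ι → ℤˣ, ∀ i, upper e n ε i ∈ O → lower e n ε i ∈ O := by
  refine ⟨fun i => if e i ∈ O then -1 else 1, fun i => ?_⟩
  by_cases h : e i ∈ O <;> simp [upper, lower, h]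

/-- Some choice of crossings makes the walk from the base point meet the lower passages first. -/
theorem exists_ascending (g : P → P) (e n : ι → P) (b : P) :
    ∃ ε : ι → ℤˣ, ∀ i, (ε i : ℤ) = turn g e n b i := by
  refine ⟨fun i => if arrival g b (n i) < arrival g b (e i) then 1 else -1, fun i => ?_⟩
  unfold turn
  simp only; split_ifs <;> rfl

theorem before_of_ascending {g : P → P} (hY : Distinct e n Y) (hcov : Covers g b)
    (hε : ∀ i, (ε i : ℤ) = turn g e n b i) (hi : i ∈ Y) :
    Before g b (lower e n ε i) (upper e n ε i) := by
  rw [before_iff_arrival_lt (hcov _) (hcov _)]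
  have h := hε i
  have hne : arrival g b (e i) ≠ arrival g b (n i) := fun h =>
    hY.ne i hi i hi (arrival_inj (hcov _) (hcov _) h)
  unfold turn at h
  rcases upper_lower_cases e n ε i with ⟨h1, h2, h3⟩ | ⟨h1, h2, h3⟩ <;> rw [h1] at h <;> rw [h2, h3]
  · by_contra! hlt
    rw [if_neg hlt.not_gt] at h
    simp at h
  · by_contra! hlt
    rw [if_pos (lt_of_le_of_ne hlt hne.symm)] at h
    simp at h

theorem stateSum_skein_update [CommRing R] {z : R} (hY : Distinct e n Y) (hS : S ⊆ Y)
    (hi : i ∈ Y \ S) :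
    stateSum z (σ * pairing e n S) (upper e n (Function.update ε i 1))
        (lower e n (Function.update ε i 1)) (Function.update ε i 1) (Y \ S) b -
      stateSum z (σ * pairing e n S) (upper e n (Function.update ε i (-1)))
        (lower e n (Function.update ε i (-1))) (Function.update ε i (-1)) (Y \ S) b =
      z * stateSum z (σ * pairing e n (insert i S)) (upper e n ε) (lower e n ε) ε
        (Y \ insert i S) b := by
  have hU := (hY.upper_lower (Function.update ε i 1)).mono (Finset.sdiff_subset (s := Y) (t := S))
  have hj : ∀ j, j ≠ i → Function.update ε i (-1) j = Function.update ε i 1 j := fun j hji => by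
    simp [hji]
  have h := stateSum_skein (z := z) (σ := σ * pairing e n S) (b := b) (w := Function.update ε i 1)
    (w' := Function.update ε i (-1)) hU hi (tl' := upper e n (Function.update ε i (-1)))
    (hd' := lower e n (Function.update ε i (-1))) (fun j _ hji => ⟨(upper_lower_congr (hj j hji)).1,
      (upper_lower_congr (hj j hji)).2, hj j hji⟩) (by simp [upper, lower]) (by simp [upper, lower])
    (by simp) (by simp)
  have h3 : upper e n (Function.update ε i 1) i = e i ∧
      lower e n (Function.update ε i 1) i = n i := by simp [upper, lower]
  rw [h, h3.1, h3.2, mul_pairing_insert hY hS hi, Finset.sdiff_insert]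
  congr 1
  refine stateSum_congr fun j hj => ?_
  have h : Function.update ε i 1 j = ε j := by simp [(Finset.mem_erase.1 hj).1]
  exact ⟨(upper_lower_congr h).1, (upper_lower_congr h).2, h⟩

/-- The state sum is the normalised determinant: both satisfy the same skein relation, and they agree
for layered diagrams and for ascending knots. -/
theorem stateSum_eq_basedDet [Fintype P] [Field F] (hY : Distinct e n Y) {r : P → ℤ}
    (hr : IsPotential σ e n Y ∅ (fun _ => 1) r) {s : F} (hs : s ≠ 0) {A : ℤ}
    (hA : ∀ S ⊆ Y, Covers (σ * pairing e n S) b →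
      turning (σ * pairing e n S) e n (Y \ S) Set.univ b = A) (hS : S ⊆ Y) (ε : ι → ℤˣ) :
    stateSum (s⁻¹ - s) (σ * pairing e n S) (upper e n ε) (lower e n ε) ε (Y \ S) b =
      s ^ (A - ∑ i ∈ Y \ S, (ε i : ℤ)) * basedDet (σ * pairing e n S) (upper e n ε) (lower e n ε)
        (fun i => (s ^ 2) ^ (ε i : ℤ)) (Y \ S) b := by
  have ht : s ^ 2 ≠ 0 := pow_ne_zero 2 hs
  rw [← sub_eq_zero]
  refine skein_induction (Y := Y) (Ψ := fun S ε => stateSum (s⁻¹ - s) (σ * pairing e n S) (upper e n ε)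
    (lower e n ε) ε (Y \ S) b - s ^ (A - ∑ i ∈ Y \ S, (ε i : ℤ)) * basedDet (σ * pairing e n S)
      (upper e n ε) (lower e n ε) (fun i => (s ^ 2) ^ (ε i : ℤ)) (Y \ S) b) ?_ ?_ ?_ hS ε
  · intro S hS ε ε' h
    have hc : ∀ i ∈ Y \ S, upper e n ε i = upper e n ε' i ∧ lower e n ε i = lower e n ε' i ∧ ε i = ε' i :=
      fun i hi => ⟨(upper_lower_congr (h i hi)).1, (upper_lower_congr (h i hi)).2, h i hi⟩
    rw [stateSum_congr hc, basedDet_congr (fun i hi => ⟨(hc i hi).1, (hc i hi).2.1, ?_⟩),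
      Finset.sum_congr rfl fun i hi => by rw [h i hi]]
    rw [h i hi]
  · intro S hS i hi ε h0
    have h1 := stateSum_skein_update (σ := σ) (b := b) (ε := ε) (z := s⁻¹ - s) hY hS hi
    have hU := (hY.upper_lower (Function.update ε i 1)).mono (Finset.sdiff_subset (s := Y) (t := S))
    have hj : ∀ j, j ≠ i → Function.update ε i (-1) j = Function.update ε i 1 j := fun j hji => by
      simp [hji]
    have h2 := basedDet_skein (g := σ * pairing e n S) (b := b) hU hi
      (tl' := upper e n (Function.update ε i (-1))) (hd' := lower e n (Function.update ε i (-1)))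
      (c := fun j => (s ^ 2) ^ (Function.update ε i 1 j : ℤ))
      (c' := fun j => (s ^ 2) ^ (Function.update ε i (-1) j : ℤ)) ht
      (fun j _ hji => ⟨(upper_lower_congr (hj j hji)).1, (upper_lower_congr (hj j hji)).2, by
        rw [hj j hji]⟩) (by simp [upper, lower]) (by simp [upper, lower]) (by simp) (by simp)
    have h3 : upper e n (Function.update ε i 1) i = e i ∧
        lower e n (Function.update ε i 1) i = n i := by simp [upper, lower]
    rw [h3.1, h3.2, ← mul_pairing_insert hY hS hi, ← Finset.sdiff_insert] at h2
    have h4 := h0 (Function.update ε i 1)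
    have h5 : stateSum (s⁻¹ - s) (σ * pairing e n (insert i S)) (upper e n (Function.update ε i 1))
        (lower e n (Function.update ε i 1)) (Function.update ε i 1) (Y \ insert i S) b =
        stateSum (s⁻¹ - s) (σ * pairing e n (insert i S)) (upper e n ε) (lower e n ε) ε
          (Y \ insert i S) b := by
      refine stateSum_congr fun j hj => ?_
      have hji : j ≠ i := by rintro rfl; simp at hj
      have h : Function.update ε i 1 j = ε j := by simp [hji]
      exact ⟨(upper_lower_congr h).1, (upper_lower_congr h).2, h⟩
    rw [← h5, sub_eq_zero.1 h4] at h1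
    have hsum : ∀ x : ℤˣ, ∑ j ∈ Y \ S, (Function.update ε i x j : ℤ) =
        x + ∑ j ∈ Y \ insert i S, (ε j : ℤ) := by
      intro x
      rw [← Finset.add_sum_erase _ _ hi, Finset.sdiff_insert]
      congr 1
      · simp
      · refine Finset.sum_congr rfl fun j hj => ?_
        simp [(Finset.mem_erase.1 hj).1]
    have hsum' : ∑ j ∈ Y \ insert i S, (Function.update ε i 1 j : ℤ) =
        ∑ j ∈ Y \ insert i S, (ε j : ℤ) := by
      refine Finset.sum_congr rfl fun j hj => ?_
      have hji : j ≠ i := by rintro rfl; simp at hj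
      simp [hji]
    rw [hsum'] at h1
    rw [hsum, hsum]
    set w := ∑ j ∈ Y \ insert i S, (ε j : ℤ)
    have e1 : s ^ (A - (((1 : ℤˣ) : ℤ) + w)) = s ^ (A - w) * s⁻¹ := by
      rw [show A - (((1 : ℤˣ) : ℤ) + w) = A - w - 1 by push_cast; ring, zpow_sub_one₀ hs]
    have e2 : s ^ (A - (((-1 : ℤˣ) : ℤ) + w)) = s ^ (A - w) * s := by
      rw [show A - (((-1 : ℤˣ) : ℤ) + w) = A - w + 1 by push_cast; ring, zpow_add_one₀ hs]
    rw [e1, e2]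
    have e3 : s⁻¹ * s ^ 2 = s := by field_simp
    linear_combination h1 - s ^ (A - w) * s⁻¹ * h2 +
      s ^ (A - w) * (basedDet (σ * pairing e n (insert i S)) (upper e n (Function.update ε i 1))
        (lower e n (Function.update ε i 1)) (fun j => (s ^ 2) ^ (Function.update ε i 1 j : ℤ))
        (Y \ insert i S) b - basedDet (σ * pairing e n S) (upper e n (Function.update ε i (-1)))
        (lower e n (Function.update ε i (-1))) (fun j => (s ^ 2) ^ (Function.update ε i (-1) j : ℤ))
        (Y \ S) b) * e3
  · intro S hS
    by_cases hcov : Covers (σ * pairing e n S) b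
    -- for an ascending knot, both sides are `1`
    · obtain ⟨ε, hε⟩ := exists_ascending (σ * pairing e n S) e n b
      have hbef : ∀ i ∈ Y \ S, Before (σ * pairing e n S) b (lower e n ε i) (upper e n ε i) :=
        fun i hi => before_of_ascending hY hcov hε (Finset.mem_sdiff.1 hi).1
      refine ⟨ε, ?_⟩
      rw [stateSum_eq_one hcov hbef,
        basedDet_eq_one hcov ((hY.upper_lower ε).mono Finset.sdiff_subset) hbef, ← hA S hS hcov]
      simp [turning, hε]
    -- a link whose component `O` of the base point lies below the rest: both sides vanish, where the
    -- determinant is computed with a base point `q` outside of `O`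
    · obtain ⟨O, hO⟩ : ∃ O : Set P, ∀ p, p ∈ O ↔ Path (σ * pairing e n S) ∅ b p :=
        ⟨{p | Path (σ * pairing e n S) ∅ b p}, fun _ => Iff.rfl⟩
      obtain ⟨ε, hε⟩ := exists_layered e n O
      have hU := (hY.upper_lower ε).mono (Finset.sdiff_subset (s := Y) (t := S))
      have hclosed : ∀ p, (σ * pairing e n S) p ∈ O ↔ p ∈ O := fun p => by
        rw [hO, hO, path_apply_iff]
      obtain ⟨q, hq⟩ : ∃ q, q ∉ O := by
        by_contra! h
        exact hcov fun p => (hO p).1 (h p)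
      have hb : b ∈ O := (hO b).2 .refl
      refine ⟨ε, ?_⟩
      have h1 := basedDet_base (F := F) hY (hr.smooth hY hS) ht ε b q
      rw [basedDet_eq_zero (b := q) hU hq ⟨b, hb⟩ hclosed fun i _ => hε i, mul_zero] at h1
      rw [stateSum_eq_zero hU hb (fun p hp => (hclosed p).2 hp) (fun i _ => hε i) ⟨q, hq⟩,
        (mul_eq_zero.1 h1).resolve_left (zpow_ne_zero _ ht), mul_zero, sub_zero]

theorem map_stateSum {R' : Type*} [CommRing R] [CommRing R'] (f : R →+* R') {z : R} {tl hd : ι → P}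
    {w : ι → ℤˣ} : f (stateSum z σ tl hd w Y b) = stateSum (f z) σ tl hd w Y b := by
  unfold stateSum
  rw [map_sum]
  refine Finset.sum_congr rfl fun S _ => ?_
  split_ifs <;> simp

/-- The state sum of a planar diagram does not depend on the base point. -/
theorem stateSum_base [Finite P] [CommRing R] (hY : Distinct e n Y) (hpot : HasPotentials σ e n Y)
    (hS : S ⊆ Y) (ε : ι → ℤˣ) (z : R) (b b' : P) :
    stateSum z (σ * pairing e n S) (upper e n ε) (lower e n ε) ε (Y \ S) b =
      stateSum z (σ * pairing e n S) (upper e n ε) (lower e n ε) ε (Y \ S) b' := by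
  cases nonempty_fintype P
  obtain ⟨r, hr⟩ := hpot ∅ (by simp) (fun _ => 1) (by simp)
  rw [pairing_empty, mul_one] at hr
  have key : ∀ s : ℝ, s ≠ 0 →
      stateSum (s⁻¹ - s) (σ * pairing e n S) (upper e n ε) (lower e n ε) ε (Y \ S) b =
      stateSum (s⁻¹ - s) (σ * pairing e n S) (upper e n ε) (lower e n ε) ε (Y \ S) b' := by
    intro s hs
    by_cases h : ∃ S₀ ⊆ Y, Covers (σ * pairing e n S₀) b
    -- the turning and the determinant change in opposite ways with the base point
    · obtain ⟨S₀, h₀, hc₀⟩ := h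
      have hA : ∀ c, ∀ T ⊆ Y, Covers (σ * pairing e n T) c →
          turning (σ * pairing e n T) e n (Y \ T) Set.univ c =
            turning (σ * pairing e n S₀) e n (Y \ S₀) Set.univ c := fun c T hT hc =>
        turning_eq hY hpot hT h₀ hc (hc₀.symm c)
      have hbb := turning_path (K := Set.univ) (χ := fun _ => 1) hY (by simp) (hr.smooth hY h₀)
        (c := b) (d := b')
        (fun p => ⟨fun _ => hc₀ p, fun _ => trivial⟩) (hc₀ b')
      rw [stateSum_eq_basedDet hY hr hs (hA b) hS, stateSum_eq_basedDet hY hr hs (hA b') hS]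
      have h1 := basedDet_base hY (hr.smooth hY hS) (pow_ne_zero 2 hs) ε b b'
      set A := turning (σ * pairing e n S₀) e n (Y \ S₀) Set.univ b
      rw [show turning (σ * pairing e n S₀) e n (Y \ S₀) Set.univ b' = A + 2 * r b - 2 * r b' by
        linarith]
      set w := ∑ i ∈ Y \ S, (ε i : ℤ)
      have h2 : ∀ k : ℤ, (s ^ (2 : ℤ)) ^ k = (s ^ 2) ^ k := fun k => by norm_cast
      have h4 : s ^ (A + 2 * r b - 2 * r b' - w) =
          s ^ (A - w) * (s ^ 2) ^ r b / (s ^ 2) ^ r b' := by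
        rw [show A + 2 * r b - 2 * r b' - w = (A - w) + 2 * r b - 2 * r b' by ring, zpow_sub₀ hs,
          zpow_add₀ hs, zpow_mul, zpow_mul, h2, h2]
      rw [h4]
      have h3 : (s ^ 2) ^ r b' ≠ 0 := zpow_ne_zero _ (pow_ne_zero 2 hs)
      rw [div_mul_eq_mul_div, eq_div_iff h3]
      linear_combination s ^ (A - w) * h1
    · have hzero : ∀ c, stateSum (s⁻¹ - s) (σ * pairing e n S) (upper e n ε) (lower e n ε) ε
          (Y \ S) c = 0 := by
        intro c
        refine Finset.sum_eq_zero fun T hT => if_neg fun hg => h ⟨S ∪ T, ?_, ?_⟩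
        · exact Finset.union_subset hS ((Finset.mem_powerset.1 hT).trans Finset.sdiff_subset)
        · have hT := Finset.mem_powerset.1 hT
          have h1 := hg.1.symm b
          have h2 : pairing (upper e n ε) (lower e n ε) T = pairing e n T := pairing_congr fun i _ => by
            rcases upper_lower_cases e n ε i with ⟨-, h⟩ | ⟨-, h⟩
            exacts [.inl h, .inr h]
          rwa [h2, mul_assoc, ← pairing_union hY hS (hT.trans Finset.sdiff_subset)
            (Finset.disjoint_of_subset_right hT Finset.disjoint_sdiff)] at h1
      rw [hzero, hzero]
  have hpoly : stateSum (X : ℤ[X]) (σ * pairing e n S) (upper e n ε) (lower e n ε) ε (Y \ S) b =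
      stateSum (X : ℤ[X]) (σ * pairing e n S) (upper e n ε) (lower e n ε) ε (Y \ S) b' := by
    refine Polynomial.map_injective (Int.castRingHom ℝ) Int.cast_injective ?_
    refine Polynomial.eq_of_infinite_eval_eq _ _ (Set.Infinite.mono (s := Set.univ) ?_
      Set.infinite_univ)
    intro x _
    -- every real number is `s⁻¹ - s` for some `s > 0`
    obtain ⟨s, hs, rfl⟩ : ∃ s : ℝ, s ≠ 0 ∧ s⁻¹ - s = x := by
      have h0 : 0 ≤ x ^ 2 + 4 := by positivity
      have h1 := Real.sq_sqrt h0
      have h2 : (√(x ^ 2 + 4) - x) * (√(x ^ 2 + 4) + x) = 4 := by linear_combination h1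
      have h3 : √(x ^ 2 + 4) - x ≠ 0 := fun h => by rw [h] at h2; norm_num at h2
      refine ⟨(√(x ^ 2 + 4) - x) / 2, by simpa using h3, ?_⟩
      field_simp
      linear_combination h2 - 2 * h1
    have := key s hs
    simp only [Set.mem_ofPred_eq]
    rw [Polynomial.eval_map, Polynomial.eval_map, ← Polynomial.coe_eval₂RingHom, map_stateSum,
      map_stateSum]
    simpa using this
  have := congrArg (Polynomial.eval₂RingHom (Int.castRingHom R) z) hpoly
  rw [map_stateSum, map_stateSum] at this
  simpa using this

theorem stateSum_neg [CommRing R] {z : R} {tl hd : ι → P} {w : ι → ℤˣ} :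
    stateSum (-z) σ tl hd (-w) Y b = stateSum z σ tl hd w Y b := by
  unfold stateSum
  refine Finset.sum_congr rfl fun S _ => ?_
  simp

theorem upper_neg : upper e n (-ε) = lower e n ε ∧ lower e n (-ε) = upper e n ε := by
  constructor <;> funext i <;> rcases Int.units_eq_one_or (ε i) with h | h <;> simp [upper, lower, h]

/-- The state sum does not change if every smoothed crossing is to be met first on its lower passage
instead of its upper one. -/
theorem stateSum_flip [Finite P] [CommRing R] (hY : Distinct e n Y) (hpot : HasPotentials σ e n Y)
    (ε : ι → ℤˣ) (z : R) (b : P) :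
    stateSum z σ (lower e n ε) (upper e n ε) ε Y b = stateSum z σ (upper e n ε) (lower e n ε) ε Y b := by
  rw [← sub_eq_zero]
  have main := skein_induction (Y := Y) (Ψ := fun S ε =>
    stateSum z (σ * pairing e n S) (lower e n ε) (upper e n ε) ε (Y \ S) b -
    stateSum z (σ * pairing e n S) (upper e n ε) (lower e n ε) ε (Y \ S) b) ?_ ?_ ?_
    (Finset.empty_subset Y) ε
  · simpa [pairing_empty] using main
  · intro S hS ε ε' h
    rw [stateSum_congr (tl := upper e n ε') (hd := lower e n ε') (w := ε') fun i hi =>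
      ⟨(upper_lower_congr (h i hi)).1, (upper_lower_congr (h i hi)).2, h i hi⟩,
      stateSum_congr (tl := lower e n ε') (hd := upper e n ε') (w := ε') fun i hi =>
      ⟨(upper_lower_congr (h i hi)).2, (upper_lower_congr (h i hi)).1, h i hi⟩]
  · intro S hS i hi ε h0
    have h1 := stateSum_skein_update (σ := σ) (b := b) (ε := ε) (z := z) hY hS hi
    -- exchanging the passages amounts to negating the signs and `z`
    have hneg : ∀ x : ℤˣ, -Function.update ε i x = Function.update (-ε) i (-x) := by
      intro x
      funext j
      by_cases hj : j = i
      · subst hj; simp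
      · simp [hj]
    have hasc : ∀ T (x : ℤˣ), stateSum z (σ * pairing e n T) (lower e n (Function.update ε i x))
        (upper e n (Function.update ε i x)) (Function.update ε i x) (Y \ T) b =
        stateSum (-z) (σ * pairing e n T) (upper e n (Function.update (-ε) i (-x)))
          (lower e n (Function.update (-ε) i (-x))) (Function.update (-ε) i (-x)) (Y \ T) b := by
      intro T x
      rw [← hneg, upper_neg.1, upper_neg.2, stateSum_neg]
    have h2 := stateSum_skein_update (σ := σ) (b := b) (ε := -ε) (z := -z) hY hS hi
    have h3 : stateSum (-z) (σ * pairing e n (insert i S)) (upper e n (-ε)) (lower e n (-ε)) (-ε)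
        (Y \ insert i S) b = stateSum z (σ * pairing e n (insert i S)) (upper e n ε) (lower e n ε) ε
          (Y \ insert i S) b := by
      rw [upper_neg.1, upper_neg.2, stateSum_neg, sub_eq_zero.1 (h0 ε)]
    simp only [hasc, neg_neg]
    rw [h3] at h2
    linear_combination -h1 - h2
  · intro S hS
    by_cases hcov : Covers (σ * pairing e n S) b
    · obtain ⟨ε, hε⟩ := exists_ascending (σ * pairing e n S) e n b
      have hbef : ∀ i ∈ Y \ S, Before (σ * pairing e n S) b (lower e n ε i) (upper e n ε i) :=
        fun i hi => before_of_ascending hY hcov hε (Finset.mem_sdiff.1 hi).1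
      refine ⟨ε, ?_⟩
      rw [stateSum_eq_one hcov hbef, sub_eq_zero]
      unfold stateSum
      rw [Finset.sum_eq_single ∅]
      · have : Good (σ * pairing e n S) (lower e n ε) (upper e n ε) b ∅ :=
          ⟨by simpa [pairing_empty] using hcov, by simp⟩
        simp [this]
      · intro T hT hne
        have hT := Finset.mem_powerset.1 hT
        exact if_neg (not_good_of_tl_first
          (((hY.upper_lower ε).swap).mono (hT.trans Finset.sdiff_subset))
          (Finset.nonempty_iff_ne_empty.2 hne) hcov fun i hi => hbef i (hT hi))
      · simp
    · obtain ⟨O, hO⟩ : ∃ O : Set P, ∀ p, p ∈ O ↔ Path (σ * pairing e n S) ∅ b p :=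
        ⟨{p | Path (σ * pairing e n S) ∅ b p}, fun _ => Iff.rfl⟩
      obtain ⟨ε, hε⟩ := exists_layered e n O
      have hU := (hY.upper_lower ε).mono (Finset.sdiff_subset (s := Y) (t := S))
      have hclosed : ∀ p, (σ * pairing e n S) p ∈ O ↔ p ∈ O := fun p => by
        rw [hO, hO, path_apply_iff]
      obtain ⟨q, hq⟩ : ∃ q, q ∉ O := by
        by_contra! h
        exact hcov fun p => (hO p).1 (h p)
      have hb : b ∈ O := (hO b).2 .refl
      refine ⟨ε, ?_⟩
      have h1 := stateSum_base hY hpot hS (-ε) (-z) b q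
      rw [upper_neg.1, upper_neg.2, stateSum_neg, stateSum_neg] at h1
      rw [h1, stateSum_eq_zero (C := Oᶜ) hU.swap hq (fun p hp h => hp ((hclosed p).1 h))
        (fun i _ h h' => h (hε i h')) ⟨b, fun h => h hb⟩,
        stateSum_eq_zero hU hb (fun p hp => (hclosed p).2 hp) (fun i _ => hε i) ⟨q, hq⟩, sub_zero]

end

end StateSum

/-! ### Flows on planar diagrams -/

namespace GaussDiagram
open StateSum Walk
open scoped Classical

variable {P : Type}

theorem finite_arrows (D : GaussDiagram P) : D.arrows.Finite := by
  have := D.finite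
  exact Set.Finite.of_injOn (f := SignedArrow.tail) (t := Set.univ) (fun _ _ => trivial)
    (fun a ha b hb h => D.tail_inj a ha b hb h) Set.finite_univ

/-- The crossings of a diagram, as a finite set. -/
noncomputable def crossings (D : GaussDiagram P) : Finset (SignedArrow P) := D.finite_arrows.toFinset

theorem mem_crossings {D : GaussDiagram P} {a : SignedArrow P} : a ∈ D.crossings ↔ a ∈ D.arrows := by
  simp [crossings]

theorem card_crossings (D : GaussDiagram P) : D.crossings.card = D.numCrossings := by
  rw [numCrossings, Set.ncard_eq_toFinset_card _ D.finite_arrows]; rfl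

theorem distinct_tail_head (D : GaussDiagram P) :
    Distinct SignedArrow.tail SignedArrow.head D.crossings where
  tl_inj a ha b hb := D.tail_inj a (mem_crossings.1 ha) b (mem_crossings.1 hb)
  hd_inj a ha b hb := D.head_inj a (mem_crossings.1 ha) b (mem_crossings.1 hb)
  ne a ha b hb := D.tail_ne_head a (mem_crossings.1 ha) b (mem_crossings.1 hb)

theorem upper_tail_head :
    upper SignedArrow.tail SignedArrow.head SignedArrow.sign = SignedArrow.east (P := P) ∧
      lower SignedArrow.tail SignedArrow.head SignedArrow.sign = SignedArrow.north (P := P) :=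
  ⟨rfl, rfl⟩

theorem upper_east_north :
    upper SignedArrow.east SignedArrow.north SignedArrow.sign = SignedArrow.tail (P := P) ∧
      lower SignedArrow.east SignedArrow.north SignedArrow.sign = SignedArrow.head (P := P) := by
  constructor <;> funext a <;> rcases Int.units_eq_one_or a.sign with h | h <;>
    simp [upper, lower, SignedArrow.east, SignedArrow.north, h]

theorem distinct_east_north (D : GaussDiagram P) :
    Distinct SignedArrow.east SignedArrow.north D.crossings := by
  have := D.distinct_tail_head.upper_lower SignedArrow.sign
  rwa [upper_tail_head.1, upper_tail_head.2] at this

theorem east_north_cases (a : SignedArrow P) :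
    (a.east = a.tail ∧ a.north = a.head) ∨ (a.east = a.head ∧ a.north = a.tail) := by
  unfold SignedArrow.east SignedArrow.north
  split_ifs <;> simp

/-- The region on the left (`s = true`) or on the right (`s = false`) of an edge. -/
def side (D : GaussDiagram P) (p : P) (s : Bool) : D.Region := Quot.mk _ (p, s)

theorem side_corner (D : GaussDiagram P) {a : SignedArrow P} (ha : a ∈ D.crossings) :
    D.side a.east true = D.side a.north false ∧
      D.side (D.next.symm a.east) true = D.side a.north true ∧
      D.side (D.next.symm a.east) false = D.side (D.next.symm a.north) true ∧
      D.side a.east false = D.side (D.next.symm a.north) false := by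
  have ha := mem_crossings.1 ha
  exact ⟨Quot.sound (.corner ha .northEast), Quot.sound (.corner ha .northWest),
    Quot.sound (.corner ha .southWest), Quot.sound (.corner ha .southEast)⟩

theorem side_plain (D : GaussDiagram P) {p : P}
    (hp : ∀ a ∈ D.crossings, p ≠ a.east ∧ p ≠ a.north) (s : Bool) :
    D.side (D.next.symm p) s = D.side p s := by
  refine Quot.sound (.plain (fun a ha => ?_) s)
  obtain ⟨h1, h2⟩ := hp a (mem_crossings.2 ha)
  rcases east_north_cases a with ⟨h3, h4⟩ | ⟨h3, h4⟩ <;> rw [h3] at h1 <;> rw [h4] at h2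
  exacts [⟨h1.symm, h2.symm⟩, ⟨h2.symm, h1.symm⟩]

/-- The two passages of a crossing are exchanged; the orbits are the vertices of the diagram. -/
noncomputable def opposite (D : GaussDiagram P) : Equiv.Perm P :=
  pairing SignedArrow.east SignedArrow.north D.crossings

theorem opposite_east (D : GaussDiagram P) {a : SignedArrow P} (ha : a ∈ D.crossings) :
    D.opposite a.east = a.north := pairing_tl D.distinct_east_north ha

theorem opposite_opposite (D : GaussDiagram P) (p : P) : D.opposite (D.opposite p) = p :=
  pairing_pairing D.distinct_east_north p

theorem opposite_cases (D : GaussDiagram P) (p : P) :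
    (∃ a ∈ D.crossings, p = a.east ∧ D.opposite p = a.north) ∨
      (∃ a ∈ D.crossings, p = a.north ∧ D.opposite p = a.east) ∨
        ((∀ a ∈ D.crossings, p ≠ a.east ∧ p ≠ a.north) ∧ D.opposite p = p) :=
  pairing_cases D.distinct_east_north p

theorem eq_of_piece_eq {D : GaussDiagram P} {α : Type*} {f : P → α}
    (h1 : ∀ p, f (D.next p) = f p) (h2 : ∀ p, f (D.opposite p) = f p) (p : P) :
    f (Quot.out (Quot.mk D.PointAdj p)) = f p := by
  have h : ∀ p q, D.PointAdj p q → f p = f q := by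
    rintro p q (p | @⟨a, ha⟩)
    · exact (h1 p).symm
    · have ha := mem_crossings.2 ha
      rcases east_north_cases a with ⟨h3, h4⟩ | ⟨h3, h4⟩ <;> rw [← h3, ← h4]
      · rw [← D.opposite_east ha, h2]
      · rw [← D.opposite_east ha, h2]
  exact congrArg (Quot.lift f h) (Quot.out_eq (Quot.mk D.PointAdj p))

section Homology
variable (D : GaussDiagram P)

/-- The difference of a function on the regions across every edge. -/
def regionBoundary : (D.Region → ℚ) →ₗ[ℚ] (P → ℚ) where
  toFun f p := f (D.side p true) - f (D.side p false)
  map_add' f g := by ext p; simp only [Pi.add_apply]; ring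
  map_smul' c f := by ext p; simp only [Pi.smul_apply, smul_eq_mul, RingHom.id_apply]; ring

/-- The matrix of the map that assigns to a function on the edges the inflow minus the outflow at the
vertex of every point. -/
noncomputable def flowMatrix : Matrix P P ℚ := fun p q =>
  (if q = D.next.symm p then 1 else 0) + (if q = D.next.symm (D.opposite p) then 1 else 0) -
    (if q = p then 1 else 0) - (if q = D.opposite p then 1 else 0)

theorem flowMatrix_mulVec [Fintype P] (w : P → ℚ) (p : P) : D.flowMatrix.mulVec w p =
    w (D.next.symm p) + w (D.next.symm (D.opposite p)) - w p - w (D.opposite p) := by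
  simp [flowMatrix, Matrix.mulVec, dotProduct, sub_mul, add_mul, Finset.sum_add_distrib,
    Finset.sum_sub_distrib]

theorem flowMatrix_transpose_mulVec [Fintype P] (h : P → ℚ) (q : P) :
    D.flowMatrix.transpose.mulVec h q =
      h (D.next q) + h (D.opposite (D.next q)) - h q - h (D.opposite q) := by
  have e1 : ∀ p, q = D.next.symm p ↔ p = D.next q := fun p => by
    rw [Equiv.eq_symm_apply, eq_comm]
  have e2 : ∀ p, q = D.opposite p ↔ p = D.opposite q := fun p =>
    ⟨fun h => by rw [h, opposite_opposite], fun h => by rw [h, opposite_opposite]⟩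
  have e3 : ∀ p, D.opposite p = D.next q ↔ p = D.opposite (D.next q) := fun p =>
    ⟨fun h => by rw [← h, opposite_opposite], fun h => by rw [h, opposite_opposite]⟩
  simp only [Matrix.mulVec, dotProduct, Matrix.transpose_apply, flowMatrix, e1, e2, e3]
  simp [sub_mul, add_mul, Finset.sum_add_distrib, Finset.sum_sub_distrib]

theorem regionBoundary_flow [Fintype P] (f : D.Region → ℚ) :
    D.flowMatrix.mulVec (D.regionBoundary f) = 0 := by
  ext p
  rw [flowMatrix_mulVec]
  simp only [regionBoundary, LinearMap.coe_mk, AddHom.coe_mk, Pi.zero_apply]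
  rcases D.opposite_cases p with ⟨a, ha, rfl, h⟩ | ⟨a, ha, rfl, h⟩ | ⟨hp, h⟩ <;> rw [h]
  · obtain ⟨h1, h2, h3, h4⟩ := D.side_corner ha
    rw [h1, h2, h3, h4]; ring
  · obtain ⟨h1, h2, h3, h4⟩ := D.side_corner ha
    rw [h1, h2, h3, h4]; ring
  · rw [D.side_plain hp, D.side_plain hp]; ring

theorem finrank_ker_regionBoundary_le [Finite P] :
    Module.finrank ℚ (LinearMap.ker D.regionBoundary) ≤ Nat.card D.Piece := by
  have : Finite D.Piece := Quot.finite _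
  have : Finite D.Region := Quot.finite _
  have := Fintype.ofFinite D.Piece
  rw [Nat.card_eq_fintype_card, ← Module.finrank_fintype_fun_eq_card ℚ (η := D.Piece)]
  refine LinearMap.finrank_le_finrank_of_injective (f := (LinearMap.pi fun x : D.Piece =>
    LinearMap.proj (D.side (Quot.out x) true)) ∘ₗ (LinearMap.ker D.regionBoundary).subtype) ?_
  refine (injective_iff_map_eq_zero _).2 ?_
  rintro ⟨f, hf⟩ h0
  have hf : ∀ p, f (D.side p false) = f (D.side p true) := fun p =>
    (sub_eq_zero.1 (congrFun (LinearMap.mem_ker.1 hf) p)).symm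
  have hs : ∀ p, f (D.side (D.next.symm p) true) = f (D.side p true) := by
    intro p
    rcases D.opposite_cases p with ⟨a, ha, rfl, h⟩ | ⟨a, ha, rfl, h⟩ | ⟨hp, h⟩
    · obtain ⟨h1, h2, h3, h4⟩ := D.side_corner ha
      rw [h2, h1, hf]
    · obtain ⟨h1, h2, h3, h4⟩ := D.side_corner ha
      rw [← hf, ← h4, hf, h1, hf]
    · rw [D.side_plain hp]
  have ho : ∀ p, f (D.side (D.opposite p) true) = f (D.side p true) := by
    intro p
    rcases D.opposite_cases p with ⟨a, ha, rfl, h⟩ | ⟨a, ha, rfl, h⟩ | ⟨hp, h⟩ <;> rw [h]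
    · rw [(D.side_corner ha).1, hf]
    · rw [(D.side_corner ha).1, hf]
  have hall : ∀ p, f (D.side p true) = 0 := fun p => by
    rw [← eq_of_piece_eq (D := D) (f := fun p => f (D.side p true))
      (fun p => by rw [← hs (D.next p), Equiv.symm_apply_apply]) ho p]
    exact congrFun h0 _
  refine Subtype.ext (funext fun x => ?_)
  induction x using Quot.ind with
  | mk d =>
    obtain ⟨p, s⟩ := d
    cases s
    · exact (hf p).trans (hall p)
    · exact hall p

theorem finrank_ker_flowMatrix_le [Fintype P] :
    Module.finrank ℚ (LinearMap.ker D.flowMatrix.mulVecLin) ≤ D.numCrossings + Nat.card D.Piece := by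
  have h1 := LinearMap.finrank_range_add_finrank_ker D.flowMatrix.mulVecLin
  have h2 := LinearMap.finrank_range_add_finrank_ker D.flowMatrix.transpose.mulVecLin
  have h3 := Matrix.rank_transpose D.flowMatrix
  unfold Matrix.rank at h3
  have h4 : Module.finrank ℚ (LinearMap.ker D.flowMatrix.transpose.mulVecLin) ≤
      D.numCrossings + Nat.card D.Piece := by
    have : Finite D.Piece := Quot.finite _
    have := Fintype.ofFinite D.Piece
    rw [Nat.card_eq_fintype_card, ← Module.finrank_fintype_fun_eq_card ℚ (η := D.Piece),
      ← card_crossings, ← Fintype.card_coe, ← Module.finrank_fintype_fun_eq_card ℚ (η := D.crossings),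
      ← Module.finrank_prod]
    refine LinearMap.finrank_le_finrank_of_injective
      (f := ((LinearMap.pi fun a : D.crossings => (LinearMap.proj a.1.east : (P → ℚ) →ₗ[ℚ] ℚ)).prod
        (LinearMap.pi fun x : D.Piece => LinearMap.proj (R := ℚ) (φ := fun _ : P => ℚ) (Quot.out x) +
          LinearMap.proj (R := ℚ) (φ := fun _ : P => ℚ) (D.opposite (Quot.out x)))) ∘ₗ
        (LinearMap.ker D.flowMatrix.transpose.mulVecLin).subtype) ?_
    refine (injective_iff_map_eq_zero _).2 ?_
    rintro ⟨h, hh⟩ h0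
    have hh : ∀ q, h (D.next q) + h (D.opposite (D.next q)) = h q + h (D.opposite q) := by
      intro q
      have := congrFun (LinearMap.mem_ker.1 hh) q
      rw [Matrix.mulVecLin_apply, flowMatrix_transpose_mulVec, Pi.zero_apply] at this
      linear_combination this
    obtain ⟨ha, hb⟩ := Prod.ext_iff.1 h0
    have hsum : ∀ p, h p + h (D.opposite p) = 0 := fun p => by
      rw [← eq_of_piece_eq (D := D) (f := fun p => h p + h (D.opposite p)) hh
        (fun p => by rw [opposite_opposite, add_comm]) p]
      exact congrFun hb _
    refine Subtype.ext (funext fun p => ?_)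
    have hp := hsum p
    change h p = 0
    rcases D.opposite_cases p with ⟨a, haD, rfl, h'⟩ | ⟨a, haD, rfl, h'⟩ | ⟨-, h'⟩
    · exact congrFun ha ⟨a, haD⟩
    · rw [h', show h a.east = 0 from congrFun ha ⟨a, haD⟩, add_zero] at hp
      exact hp
    · rw [h'] at hp
      linarith
  omega

/-- On a planar diagram, every flow is the boundary of a function on the regions. -/
theorem exists_regionBoundary_eq [Fintype P] (hD : D.IsPlanar) {w : P → ℚ}
    (hw : D.flowMatrix.mulVec w = 0) : ∃ f, D.regionBoundary f = w := by
  have : Finite D.Region := Quot.finite _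
  have := Fintype.ofFinite D.Region
  have hle : LinearMap.range D.regionBoundary ≤ LinearMap.ker D.flowMatrix.mulVecLin := by
    rintro _ ⟨f, rfl⟩
    exact D.regionBoundary_flow f
  have h1 := LinearMap.finrank_range_add_finrank_ker D.regionBoundary
  rw [Module.finrank_fintype_fun_eq_card, ← Nat.card_eq_fintype_card, hD] at h1
  have h2 := D.finrank_ker_regionBoundary_le
  have h3 := D.finrank_ker_flowMatrix_le
  have := Submodule.eq_of_le_of_finrank_le hle (by omega)
  have hw : w ∈ LinearMap.ker D.flowMatrix.mulVecLin := hw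
  rwa [← this] at hw

end Homology

theorem IsPlanar.hasPotentials {D : GaussDiagram P} (hD : D.IsPlanar) :
    HasPotentials D.next SignedArrow.east SignedArrow.north D.crossings := by
  intro S hS χ hχ
  have := D.finite
  cases nonempty_fintype P
  have hY := D.distinct_east_north
  -- the values of the flow behind a crossing
  have hsm : ∀ a ∈ S, χ (D.next a.north) = χ a.east ∧ χ (D.next a.east) = χ a.north := by
    intro a ha
    have h1 := hχ a.east
    have h2 := hχ a.north
    rw [Equiv.Perm.mul_apply, pairing_tl (hY.mono hS) ha] at h1
    rw [Equiv.Perm.mul_apply, pairing_hd (hY.mono hS) ha] at h2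
    exact ⟨h1, h2⟩
  have hns : ∀ a ∈ D.crossings, a ∉ S →
      χ (D.next a.north) = χ a.north ∧ χ (D.next a.east) = χ a.east := by
    intro a ha haS
    have h1 := hχ a.east
    have h2 := hχ a.north
    rw [Equiv.Perm.mul_apply, pairing_tl_of_notMem hY hS ha haS] at h1
    rw [Equiv.Perm.mul_apply, pairing_hd_of_notMem hY hS ha haS] at h2
    exact ⟨h2, h1⟩
  have hsum : ∀ a ∈ D.crossings,
      χ (D.next a.north) + χ (D.next a.east) = χ a.north + χ a.east := by
    intro a ha
    by_cases haS : a ∈ S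
    · rw [(hsm a haS).1, (hsm a haS).2, add_comm]
    · rw [(hns a ha haS).1, (hns a ha haS).2]
  obtain ⟨f, hf⟩ := D.exists_regionBoundary_eq hD (w := fun p => (χ (D.next p) : ℚ)) (by
    ext p
    rw [flowMatrix_mulVec]
    simp only [Equiv.apply_symm_apply, Pi.zero_apply]
    rcases D.opposite_cases p with ⟨a, ha, rfl, h⟩ | ⟨a, ha, rfl, h⟩ | ⟨hp, h⟩ <;> rw [h]
    · have : ((χ (D.next a.north) + χ (D.next a.east) : ℤ) : ℚ) = (χ a.north + χ a.east : ℤ) := by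
        rw [hsum a ha]
      push_cast at this
      linear_combination -this
    · have : ((χ (D.next a.north) + χ (D.next a.east) : ℤ) : ℚ) = (χ a.north + χ a.east : ℤ) := by
        rw [hsum a ha]
      push_cast at this
      linear_combination -this
    · have h1 := hχ p
      rw [Equiv.Perm.mul_apply, pairing_of_ne fun a ha => hp a (hS ha)] at h1
      rw [h1]; ring)
  have hf : ∀ p, f (D.side p true) = f (D.side p false) + (χ (D.next p) : ℤ) := by
    intro p
    have h : f (D.side p true) - f (D.side p false) = χ (D.next p) := congrFun hf p
    linear_combination h
  have hr : ∀ a ∈ D.crossings,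
      ⌊f (D.side (D.next.symm a.east) false)⌋ =
        ⌊f (D.side (D.next.symm a.north) false)⌋ + χ a.north ∧
      ⌊f (D.side a.east false)⌋ = ⌊f (D.side (D.next.symm a.north) false)⌋ ∧
      ⌊f (D.side a.north false)⌋ =
        ⌊f (D.side (D.next.symm a.north) false)⌋ + χ (D.next a.east) := by
    intro a ha
    obtain ⟨h1, h2, h3, h4⟩ := D.side_corner ha
    refine ⟨?_, by rw [h4], ?_⟩
    · rw [h3, hf, Int.floor_add_intCast, Equiv.apply_symm_apply]
    · rw [← h1, hf, Int.floor_add_intCast, h4]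
  refine ⟨fun p => ⌊f (D.side (D.next.symm p) false)⌋, ?_, ?_, ?_, ?_, ?_, ?_⟩
  · exact fun a ha => (hr a ha).1
  · intro a ha
    obtain ⟨h1, h2, h3⟩ := hr a (hS ha)
    rw [Equiv.Perm.mul_apply, pairing_tl (hY.mono hS) ha, Equiv.symm_apply_apply, h3, h1,
      (hsm a ha).2]
  · intro a ha
    obtain ⟨h1, h2, h3⟩ := hr a (hS ha)
    rw [Equiv.Perm.mul_apply, pairing_hd (hY.mono hS) ha, Equiv.symm_apply_apply, h2]
  · intro a ha haS
    obtain ⟨h1, h2, h3⟩ := hr a ha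
    rw [Equiv.Perm.mul_apply, pairing_tl_of_notMem hY hS ha haS, Equiv.symm_apply_apply, h1, h2,
      add_sub_cancel_right]
  · intro a ha haS
    obtain ⟨h1, h2, h3⟩ := hr a ha
    rw [Equiv.Perm.mul_apply, pairing_hd_of_notMem hY hS ha haS, Equiv.symm_apply_apply, h3,
      (hns a ha haS).2]
  · intro p hp
    rw [Equiv.Perm.mul_apply, pairing_of_ne fun a ha => hp a (hS ha), Equiv.symm_apply_apply,
      D.side_plain hp]

end GaussDiagram

/-! ### Walks through a tangle -/

namespace Tangle
open Walk StateSum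
open scoped Classical

variable {P ι R : Type*} {k m : ℕ}

/-- `k` strands with one edge each: strand `i` runs from `(i, false)` to `(i, true)`.  If the smoothed
crossings of a tangle connect the place `x` with `f x`, then a walk that arrives at `x` leaves
the tangle if `f x` is an exit, and continues at `step f x` otherwise. -/
def step (f : Fin k × Bool → Fin k × Bool) (x : Fin k × Bool) : Fin k × Bool := ((f x).1, true)

/-- The number of steps inside the tangle, starting at `x`, with an upper bound as first argument. -/
def exitTime (f : Fin k × Bool → Fin k × Bool) : ℕ → Fin k × Bool → ℕ
  | 0, _ => 0
  | r + 1, x => if (f x).2 then 0 else exitTime f r (step f x) + 1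

/-- The number of steps inside the tangle after the entrance of strand `i`. -/
def leave (f : Fin k × Bool → Fin k × Bool) (i : Fin k) : ℕ := exitTime f k (i, false)

/-- The strand at whose end a walk leaves the tangle that entered it on strand `i`. -/
def exit (f : Fin k × Bool → Fin k × Bool) (i : Fin k) : Fin k :=
  (f ((step f)^[leave f i] (i, false))).1

/-- Every walk through the tangle leaves it within the time bound used in `leave`. -/
def Exits (f : Fin k × Bool → Fin k × Bool) : Prop :=
  ∀ i, (f ((step f)^[leave f i] (i, false))).2 = true

/-- The places that are met by a walk through the tangle, with the strand where it entered and the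
number of steps since. -/
def visits (f : Fin k × Bool → Fin k × Bool) : List ((Fin k × Bool) × Fin k × ℕ) :=
  (List.finRange k).flatMap fun i =>
    (List.range (leave f i + 1)).map fun j => ((step f)^[j] (i, false), i, j)

/-- The entrance and the number of steps that lead to the place `x`, if there are any. -/
def visit (f : Fin k × Bool → Fin k × Bool) (x : Fin k × Bool) : Option (Fin k × ℕ) :=
  ((visits f).find? fun v => decide (v.1 = x)).map Prod.snd

/-- The tangle contains no closed component. -/
def Complete (f : Fin k × Bool → Fin k × Bool) : Prop := ∀ x, (visit f x).isSome = true

/-- Whether the place `x` is met before the place `y`, if the strand `i` is entered before the strand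
`j` exactly if `o i j` holds. -/
def earlier (f : Fin k × Bool → Fin k × Bool) (o : Fin k → Fin k → Bool) (x y : Fin k × Bool) :
    Bool :=
  match visit f x, visit f y with
  | some (i, r), some (j, s) => if i = j then decide (r < s) else o i j
  | _, _ => false

theorem earlier_congr {f : Fin k × Bool → Fin k × Bool} {o o' : Fin k → Fin k → Bool}
    (h : ∀ i j, i ≠ j → o i j = o' i j) (x y : Fin k × Bool) : earlier f o x y = earlier f o' x y := by
  unfold earlier
  split
  · split_ifs with hij
    · rfl
    · exact h _ _ hij
  · rfl

theorem snd_of_lt_exitTime {f : Fin k × Bool → Fin k × Bool} {r j : ℕ} {x : Fin k × Bool}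
    (h : j < exitTime f r x) : (f ((step f)^[j] x)).2 = false := by
  induction r generalizing x j with
  | zero => simp [exitTime] at h
  | succ r ih =>
    unfold exitTime at h
    split_ifs at h with hx
    · omega
    · cases j with
      | zero => simpa using hx
      | succ j =>
        rw [Function.iterate_succ_apply]
        exact ih (by omega)

theorem visit_eq_some {f : Fin k × Bool → Fin k × Bool} {x : Fin k × Bool} {i : Fin k} {j : ℕ}
    (h : visit f x = some (i, j)) : j ≤ leave f i ∧ (step f)^[j] (i, false) = x := by
  unfold visit at h
  obtain ⟨v, hv, hv'⟩ := Option.map_eq_some_iff.1 h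
  have h1 := List.mem_of_find?_eq_some hv
  have h2 := List.find?_some hv
  simp only [visits, List.mem_flatMap, List.mem_map, List.mem_range, List.mem_finRange, true_and] at h1
  obtain ⟨i', j', hj, rfl⟩ := h1
  obtain ⟨rfl, rfl⟩ := Prod.mk.inj hv'
  exact ⟨by omega, by simpa using h2⟩

theorem visit_isSome {f : Fin k × Bool → Fin k × Bool} {i : Fin k} {j : ℕ} (hj : j ≤ leave f i) :
    (visit f ((step f)^[j] (i, false))).isSome = true := by
  unfold visit
  rw [Option.isSome_map, List.find?_isSome]
  refine ⟨((step f)^[j] (i, false), i, j), ?_, by simp⟩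
  simp only [visits, List.mem_flatMap, List.mem_map, List.mem_range, List.mem_finRange, true_and]
  exact ⟨i, j, by omega, rfl⟩

/-- The points `pt x` are the places of a tangle whose strands consist of one edge each, and `b` is not
the end of one of these edges. -/
structure IsTangle (g : P → P) (pt : Fin k × Bool → P) (b : P) : Prop where
  inj : pt.Injective
  edge : ∀ i, g (pt (i, false)) = pt (i, true)
  base : ∀ i, b ≠ pt (i, true)

/-- The successor map outside a tangle that is entered on strand `i` and left on strand `π i`. -/
noncomputable def outer (g : P → P) (pt : Fin k × Bool → P) (π : Fin k → Fin k) (p : P) : P :=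
  if h : ∃ i, pt (i, false) = p then g (pt (π h.choose, true)) else g p

theorem outer_entrance {g : P → P} {pt : Fin k × Bool → P} (hpt : pt.Injective) (π : Fin k → Fin k)
    (i : Fin k) : outer g pt π (pt (i, false)) = g (pt (π i, true)) := by
  have h : ∃ j, pt (j, false) = pt (i, false) := ⟨i, rfl⟩
  unfold outer
  rw [dif_pos h]
  have := congrArg Prod.fst (hpt h.choose_spec)
  rw [show h.choose = i from this]

section Walks
variable {g₀ g : Equiv.Perm P} {pt : Fin k × Bool → P} {b : P} {f : Fin k × Bool → Fin k × Bool}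

theorem iterate_place (h₀ : IsTangle g₀ pt b) (hg : ∀ x, g (pt x) = g₀ (pt (f x))) {i : Fin k} {j : ℕ}
    (hj : j ≤ leave f i) : g^[j] (pt (i, false)) = pt ((step f)^[j] (i, false)) := by
  induction j with
  | zero => rfl
  | succ j ih =>
    rw [Function.iterate_succ_apply', Function.iterate_succ_apply', ih (by omega), hg]
    have h := snd_of_lt_exitTime (f := f) (r := k) (x := (i, false)) (j := j)
      (by unfold leave at hj; omega)
    rw [show f ((step f)^[j] (i, false)) = ((f ((step f)^[j] (i, false))).1, false) from
      Prod.ext rfl h, h₀.edge]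
    rfl

theorem snd_iterate_step {i : Fin k} {j : ℕ} : ((step f)^[j + 1] (i, false)).2 = true := by
  rw [Function.iterate_succ_apply']; rfl

theorem return_outer (h₀ : IsTangle g₀ pt b) (hg : ∀ x, g (pt x) = g₀ (pt (f x)))
    (hg' : ∀ p ∉ Set.range pt, g p = g₀ p) (hf : Exits f) (p : P)
    (hp : p ∉ Set.range fun i => pt (i, true)) :
    outer g₀ pt (exit f) p ∉ (Set.range fun i => pt (i, true)) ∧
      ∃ r, g^[r + 1] p = outer g₀ pt (exit f) p ∧
        ∀ j < r, g^[j + 1] p ∈ Set.range fun i => pt (i, true) := by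
  have hnot : ∀ q, (∀ i, q ≠ pt (i, false)) → g₀ q ∉ Set.range fun i => pt (i, true) := by
    rintro q hq ⟨i, hi⟩
    exact hq i (g₀.injective (by rw [h₀.edge]; exact hi.symm))
  by_cases h : ∃ i, pt (i, false) = p
  · obtain ⟨i, rfl⟩ := h
    rw [outer_entrance h₀.inj]
    refine ⟨hnot _ fun j h => by simpa using congrArg Prod.snd (h₀.inj h), leave f i, ?_, ?_⟩
    · rw [Function.iterate_succ_apply', iterate_place h₀ hg le_rfl, hg]
      congr 2
      exact Prod.ext rfl (hf i)
    · intro j hj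
      rw [iterate_place h₀ hg hj]
      exact ⟨((step f)^[j + 1] (i, false)).1, congrArg pt (Prod.ext rfl snd_iterate_step.symm)⟩
  · have hp' : p ∉ Set.range pt := by
      rintro ⟨⟨i, s⟩, rfl⟩
      cases s
      · exact h ⟨i, rfl⟩
      · exact hp ⟨i, rfl⟩
    unfold outer
    rw [dif_neg h]
    exact ⟨hnot _ fun i hi => h ⟨i, hi.symm⟩, 0, hg' p hp', by simp⟩

theorem covers_iff (h₀ : IsTangle g₀ pt b) (hg : ∀ x, g (pt x) = g₀ (pt (f x)))
    (hg' : ∀ p ∉ Set.range pt, g p = g₀ p) (hf : Exits f) :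
    Covers g b ↔ Complete f ∧
      ∀ p ∉ Set.range fun i => pt (i, true), Path (outer g₀ pt (exit f)) ∅ b p := by
  have hb : b ∉ Set.range fun i => pt (i, true) := by
    rintro ⟨i, hi⟩
    exact h₀.base i hi.symm
  have hsim := return_outer h₀ hg hg' hf
  constructor
  · intro hc
    refine ⟨?_, fun p hp => (path_return hsim (by simp) hb hp).1 (hc p)⟩
    intro x
    obtain ⟨y, hy, -, j, r, hr, hI, hjr, hx⟩ := exists_path_return hsim hb (hc (pt x))
    by_cases h : ∃ i, pt (i, false) = y
    · obtain ⟨i, rfl⟩ := h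
      -- the walk leaves the tangle after `leave f i` steps
      rcases le_or_gt j (leave f i) with hj | hj
      · rw [iterate_place h₀ hg hj] at hx
        rw [h₀.inj hx]
        exact visit_isSome hj
      · exact absurd (hI (leave f i) (by omega)) (by
          rw [Function.iterate_succ_apply', iterate_place h₀ hg le_rfl, hg]
          rintro ⟨l, hl⟩
          have h1 := h₀.inj (g₀.injective ((h₀.edge l).trans hl))
          have h2 := hf i
          rw [← h1] at h2
          exact absurd h2 (by simp))
    · have hr0 : r = 0 := by
        by_contra hr0
        obtain ⟨i, hi⟩ := hI 0 (by omega)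
        have hy' : y ∉ Set.range pt := by
          rintro ⟨⟨i, s⟩, rfl⟩
          cases s
          · exact h ⟨i, rfl⟩
          · exact hy ⟨i, rfl⟩
        have h1 : g₀ y = pt (i, true) := by rw [← hg' y hy']; exact hi.symm
        rw [← h₀.edge] at h1
        exact h ⟨i, (g₀.injective h1).symm⟩
      have hj0 : j = 0 := by omega
      subst hj0
      rw [Function.iterate_zero, id] at hx
      obtain ⟨i, s⟩ := x
      cases s
      · exact absurd ⟨i, hx⟩ h
      · exact absurd ⟨i, hx⟩ hy
  · rintro ⟨hc, ho⟩ p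
    by_cases hp : p ∈ Set.range fun i => pt (i, true)
    · obtain ⟨i, rfl⟩ := hp
      obtain ⟨⟨j, r⟩, hv⟩ := Option.isSome_iff_exists.1 (hc (i, true))
      obtain ⟨h1, h2⟩ := visit_eq_some hv
      have h3 : pt (j, false) ∉ Set.range fun i => pt (i, true) := by
        rintro ⟨l, hl⟩
        simpa using congrArg Prod.snd (h₀.inj hl)
      have h4 := (path_return hsim (by simp) hb h3).2 (ho _ h3)
      simp only
      rw [← h2, ← iterate_place h₀ hg h1]
      exact h4.trans (path_empty_iff.2 ⟨r, rfl⟩)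
    · exact (path_return hsim (by simp) hb hp).2 (ho p hp)

theorem before_outer (h₀ : IsTangle g₀ pt b) (hg : ∀ x, g (pt x) = g₀ (pt (f x)))
    (hg' : ∀ p ∉ Set.range pt, g p = g₀ p) (hf : Exits f) {p q : P}
    (hp : p ∉ Set.range fun i => pt (i, true)) (hq : q ∉ Set.range fun i => pt (i, true)) :
    Before g b p q ↔ Before (outer g₀ pt (exit f)) b p q := by
  have hb : b ∉ Set.range fun i => pt (i, true) := by
    rintro ⟨i, hi⟩
    exact h₀.base i hi.symm
  refine and_congr_right fun _ => path_return (return_outer h₀ hg hg' hf) ?_ hb hp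
  rintro x hx rfl
  exact hq hx

theorem before_place (h₀ : IsTangle g₀ pt b) (hg : ∀ x, g (pt x) = g₀ (pt (f x)))
    (hg' : ∀ p ∉ Set.range pt, g p = g₀ p) (hf : Exits f) (hcov : Covers g b) (x y : Fin k × Bool) :
    Before g b (pt x) (pt y) ↔ earlier f (fun i j =>
      decide (Before (outer g₀ pt (exit f)) b (pt (i, false)) (pt (j, false)))) x y = true := by
  have hcomp := ((covers_iff h₀ hg hg' hf).1 hcov).1
  obtain ⟨⟨i, r⟩, hx⟩ := Option.isSome_iff_exists.1 (hcomp x)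
  obtain ⟨⟨j, s⟩, hy⟩ := Option.isSome_iff_exists.1 (hcomp y)
  unfold earlier
  rw [hx, hy]
  obtain ⟨hr, rfl⟩ := visit_eq_some hx
  obtain ⟨hs, rfl⟩ := visit_eq_some hy
  have hent : ∀ i : Fin k, pt (i, false) ∉ Set.range fun i => pt (i, true) := by
    rintro i ⟨l, hl⟩
    simpa using congrArg Prod.snd (h₀.inj hl)
  have harr : ∀ i, ∀ r ≤ leave f i, arrival g b (pt ((step f)^[r] (i, false))) =
      arrival g b (pt (i, false)) + r := by
    intro i r
    induction r with
    | zero => simp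
    | succ r ih =>
      intro hr
      have h1 : pt ((step f)^[r + 1] (i, false)) = g (pt ((step f)^[r] (i, false))) := by
        rw [← iterate_place h₀ hg hr, ← iterate_place h₀ hg (show r ≤ leave f i by omega),
          Function.iterate_succ_apply']
      have h2 : pt ((step f)^[r + 1] (i, false)) ≠ b := by
        intro h
        refine h₀.base ((step f)^[r + 1] (i, false)).1 ?_
        rw [← h]
        exact congrArg pt (Prod.ext rfl snd_iterate_step)
      rw [h1] at h2 ⊢
      rw [arrival_step g.injective (hcov _) h2, ih (by omega), add_assoc]
  have hlt : ∀ i j r, r ≤ leave f i → i ≠ j →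
      arrival g b (pt (i, false)) < arrival g b (pt (j, false)) →
      arrival g b (pt (i, false)) + r < arrival g b (pt (j, false)) := by
    intro i j r hr hij h
    by_contra! hle
    obtain ⟨t, ht⟩ := Nat.exists_eq_add_of_lt h
    have h1 := harr i (t + 1) (by omega)
    have h2 := h₀.inj (arrival_inj (hcov _) (hcov _) (h1.trans (by omega)) :
      pt ((step f)^[t + 1] (i, false)) = pt (j, false))
    have h3 := snd_iterate_step (f := f) (i := i) (j := t)
    rw [h2] at h3
    simp at h3
  rw [before_iff_arrival_lt (hcov _) (hcov _), harr i r hr, harr j s hs]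
  by_cases hij : i = j
  · subst hij
    simp
  · simp only [hij, if_false, decide_eq_true_eq]
    rw [← before_outer h₀ hg hg' hf (hent i) (hent j), before_iff_arrival_lt (hcov _) (hcov _)]
    have hne : arrival g b (pt (i, false)) ≠ arrival g b (pt (j, false)) := fun h =>
      hij (congrArg Prod.fst (h₀.inj (arrival_inj (hcov _) (hcov _) h)))
    constructor
    · intro h
      by_contra! hle
      have := hlt j i s hs (Ne.symm hij) (lt_of_le_of_ne hle hne.symm)
      omega
    · intro h
      have := hlt i j r hr hij h
      omega

end Walks

end Tangle

/-! ### The state sum of a diagram with a tangle -/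

namespace Tangle
open Walk StateSum

section Table
variable {κ : Type*} {k m : ℕ}

/-- The places are exchanged along the crossings in the list `T`, where the crossing `i` joins `tl i`
and `hd i`. -/
def flip (tl hd : Fin m → Fin k × Bool) (T : List (Fin m)) (x : Fin k × Bool) : Fin k × Bool :=
  T.foldr (fun i y => if y = tl i then hd i else if y = hd i then tl i else y) x

/-- `f` exchanges `tl i` and `hd i` for the crossings `i` in `T` and fixes the other places. -/
def IsFlip (tl hd : Fin m → Fin k × Bool) (T : List (Fin m)) (f : Fin k × Bool → Fin k × Bool) :
    Prop :=
  (∀ i ∈ T, f (tl i) = hd i ∧ f (hd i) = tl i) ∧ ∀ x, (∀ i ∈ T, x ≠ tl i ∧ x ≠ hd i) → f x = x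

/-- The conditions under which the smoothings of the tangle are computed correctly. -/
def Proper (tl hd : Fin m → Fin k × Bool) : Prop :=
  ∀ T ∈ (List.finRange m).sublists', IsFlip tl hd T (flip tl hd T) ∧ Exits (flip tl hd T)

instance (f : Fin k × Bool → Fin k × Bool) : Decidable (Complete f) := by
  unfold Complete; infer_instance

instance (tl hd : Fin m → Fin k × Bool) : Decidable (Proper tl hd) := by
  unfold Proper IsFlip Exits; infer_instance

/-- The contribution of the state that smooths the crossings `T` of the tangle, without the power of
`z`, if the strands are entered in the order `o`. -/
def coeff (tl hd : Fin m → Fin k × Bool) (w : Fin m → ℤˣ) (o : Fin k → Fin k → Bool)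
    (T : List (Fin m)) : ℤ :=
  if Complete (flip tl hd T) ∧ ∀ i ∈ T, earlier (flip tl hd T) o (tl i) (hd i) = true then
    (T.map fun i => (w i : ℤ)).prod else 0

/-- What a state of the tangle passes on to the outside: how it connects the strands, and the power of
`z`. -/
def key (tl hd : Fin m → Fin k × Bool) (T : List (Fin m)) : (Fin k → Fin k) × ℕ :=
  (exit (flip tl hd T), T.length)

/-- The contributions of all states of the tangle. -/
def contributions (tl hd : Fin m → Fin k × Bool) (w : Fin m → ℤˣ) (o : Fin k → Fin k → Bool) :
    List (((Fin k → Fin k) × ℕ) × ℤ) :=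
  (List.finRange m).sublists'.map fun T => (key tl hd T, coeff tl hd w o T)

/-- A formal linear combination in which the coefficients of every term add up to zero. -/
def Balanced [DecidableEq κ] (L : List (κ × ℤ)) : Prop :=
  ∀ x ∈ L, (L.map fun y => if y.1 = x.1 then y.2 else 0).sum = 0

instance [DecidableEq κ] (L : List (κ × ℤ)) : Decidable (Balanced L) := by
  unfold Balanced; infer_instance

/-- `o` is a linear order in which the strands can be entered. -/
def IsOrder (o : Fin k → Fin k → Bool) : Prop :=
  (∀ i j, i ≠ j → o i j = !o j i) ∧ ∀ i j l, o i j = true → o j l = true → o i l = true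

theorem coeff_congr {tl hd : Fin m → Fin k × Bool} {w : Fin m → ℤˣ} {o o' : Fin k → Fin k → Bool}
    (h : ∀ i j, i ≠ j → o i j = o' i j) (T : List (Fin m)) :
    coeff tl hd w o T = coeff tl hd w o' T := by
  unfold coeff
  simp only [earlier_congr h]

theorem Balanced.sum_eq_zero [DecidableEq κ] {L : List (κ × ℤ)} (h : Balanced L) (x : κ) :
    (L.map fun y => if y.1 = x then y.2 else 0).sum = 0 := by
  by_cases hx : ∃ y ∈ L, y.1 = x
  · obtain ⟨y, hy, rfl⟩ := hx
    exact h y hy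
  · push Not at hx
    refine List.sum_eq_zero fun c hc => ?_
    obtain ⟨y, hy, rfl⟩ := List.mem_map.1 hc
    exact if_neg (hx y hy)

theorem sum_map_eq_sum_fiber {R τ : Type*} [CommRing R] [DecidableEq κ] (L : List τ) (q : τ → κ)
    (c : κ → τ → ℤ) (H : κ → R) (K : Finset κ) (hK : ∀ T ∈ L, q T ∈ K) :
    (L.map fun T => (c (q T) T : R) * H (q T)).sum =
      ∑ x ∈ K, (((L.map fun T => if q T = x then c x T else 0).sum : ℤ) : R) * H x := by
  induction L with
  | nil => simp
  | cons T L ih =>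
    simp only [List.map_cons, List.sum_cons, Int.cast_add, add_mul, Finset.sum_add_distrib]
    rw [ih fun T hT => hK T (List.mem_cons_of_mem _ hT)]
    congr 1
    rw [Finset.sum_eq_single_of_mem (q T) (hK T (by simp))]
    · simp
    · intro x _ hx
      simp [Ne.symm hx]

theorem sum_map_eq_of_balanced {R τ τ' : Type*} [CommRing R] [DecidableEq κ] (L : List τ)
    (L' : List τ') (q : τ → κ) (q' : τ' → κ) (c : κ → τ → ℤ) (c' : κ → τ' → ℤ) (H : κ → R)
    (h : ∀ x, H x ≠ 0 →
      Balanced (L.map (fun T => (q T, c x T)) ++ L'.map (fun T => (q' T, -c' x T)))) :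
    (L.map fun T => (c (q T) T : R) * H (q T)).sum =
      (L'.map fun T => (c' (q' T) T : R) * H (q' T)).sum := by
  rw [sum_map_eq_sum_fiber L q c H ((L.map q).toFinset ∪ (L'.map q').toFinset),
    sum_map_eq_sum_fiber L' q' c' H ((L.map q).toFinset ∪ (L'.map q').toFinset)]
  · refine Finset.sum_congr rfl fun x hxK => ?_
    by_cases hx : H x = 0
    · rw [hx, mul_zero, mul_zero]
    · have := (h x hx).sum_eq_zero x
      rw [List.map_append, List.sum_append, List.map_map, List.map_map] at this
      have h2 : (L'.map ((fun y : κ × ℤ => if y.1 = x then y.2 else 0) ∘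
          fun T => (q' T, -c' x T))).sum = -(L'.map fun T => if q' T = x then c' x T else 0).sum := by
        clear this h hxK
        induction L' with
        | nil => simp
        | cons T L' ih =>
          rw [List.map_cons, List.sum_cons, ih, List.map_cons, List.sum_cons, neg_add]
          congr 1
          simp only [Function.comp]
          split_ifs <;> simp
      rw [h2] at this
      rw [show (L.map fun T => if q T = x then c x T else 0).sum =
        (L'.map fun T => if q' T = x then c' x T else 0).sum from by
          simpa [Function.comp_def] using add_neg_eq_zero.1 this]
  · intro T hT
    exact Finset.mem_union_right _ (by simpa using ⟨T, hT, rfl⟩)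
  · intro T hT
    exact Finset.mem_union_left _ (by simpa using ⟨T, hT, rfl⟩)

end Table

open scoped Classical

variable {P ι R : Type*} [CommRing R] {k m : ℕ}

theorem sum_powerset_union_toFinset {M : Type*} [AddCommMonoid M] {l : List ι} {Y : Finset ι}
    (hl : l.Nodup) (hY : ∀ i ∈ l, i ∉ Y) (F : Finset ι → M) :
    ∑ S ∈ (Y ∪ l.toFinset).powerset, F S =
      ∑ S ∈ Y.powerset, (l.sublists'.map fun T => F (S ∪ T.toFinset)).sum := by
  induction l generalizing F with
  | nil => simp
  | cons a l ih =>
    obtain ⟨ha, hl⟩ := List.nodup_cons.1 hl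
    have hY' : ∀ i ∈ l, i ∉ Y := fun i hi => hY i (List.mem_cons_of_mem _ hi)
    rw [List.toFinset_cons, Finset.union_insert, Finset.sum_powerset_insert, ih hl hY',
      ih hl hY' fun S => F (insert a S), ← Finset.sum_add_distrib]
    · refine Finset.sum_congr rfl fun S _ => ?_
      rw [List.sublists'_cons, List.map_append, List.sum_append, List.map_map]
      congr 3
      funext T
      simp [Finset.union_insert]
    · simp [ha, hY a (by simp)]

/-- The part of the condition for a state to count that concerns the outside of a tangle which connects
its strands by `π`. -/
def OuterGood (g : P → P) (pt : Fin k × Bool → P) (tl hd : ι → P) (b : P) (S : Finset ι)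
    (π : Fin k → Fin k) : Prop :=
  (∀ p ∉ Set.range fun i => pt (i, true), Path (outer g pt π) ∅ b p) ∧
    ∀ i ∈ S, Before (outer g pt π) b (tl i) (hd i)

/-- The order in which the strands of a tangle are entered. -/
noncomputable def entryOrder (g : P → P) (pt : Fin k × Bool → P) (b : P) (π : Fin k → Fin k)
    (i j : Fin k) : Bool :=
  decide (Before (outer g pt π) b (pt (i, false)) (pt (j, false)))

theorem OuterGood.isOrder {g : P → P} {pt : Fin k × Bool → P} (hpt : pt.Injective) {tl hd : ι → P}
    {b : P} {S : Finset ι} {π : Fin k → Fin k} (h : OuterGood g pt tl hd b S π) :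
    IsOrder (entryOrder g pt b π) := by
  have hp : ∀ i, Path (outer g pt π) ∅ b (pt (i, false)) := fun i => h.1 _ (by
    rintro ⟨l, hl⟩
    simpa using congrArg Prod.snd (hpt hl))
  refine ⟨fun i j hij => ?_, fun i j l h1 h2 => ?_⟩
  · unfold entryOrder
    rw [Bool.eq_iff_iff, Bool.not_eq_true', decide_eq_true_eq, decide_eq_false_iff_not,
      before_iff_arrival_lt (hp i) (hp j), before_iff_arrival_lt (hp j) (hp i)]
    have : arrival (outer g pt π) b (pt (i, false)) ≠ arrival (outer g pt π) b (pt (j, false)) :=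
      fun h => hij (congrArg Prod.fst (hpt (arrival_inj (hp i) (hp j) h)))
    omega
  · unfold entryOrder at *
    rw [decide_eq_true_eq, before_iff_arrival_lt (hp _) (hp _)] at *
    omega

section
variable {σ : Equiv.Perm P} {pt : Fin k × Bool → P} {b : P} {tl hd : ι → P} {w : ι → ℤˣ}
  {Y : Finset ι} {z : R}

/-- The crossings `α i` lie in the tangle, where their passages are the places `ltl i` and `lhd i`, and
the crossings `Y` lie outside. -/
structure Local (pt : Fin k × Bool → P) (tl hd : ι → P) (w : ι → ℤˣ) (Y : Finset ι) (α : Fin m → ι)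
    (ltl lhd : Fin m → Fin k × Bool) (lw : Fin m → ℤˣ) : Prop where
  distinct : Distinct tl hd (Y ∪ ((List.finRange m).map α).toFinset)
  inj : α.Injective
  notMem : ∀ i, α i ∉ Y
  tl_eq : ∀ i, tl (α i) = pt (ltl i)
  hd_eq : ∀ i, hd (α i) = pt (lhd i)
  sign_eq : ∀ i, w (α i) = lw i

theorem good_union (hpt : pt.Injective) (hedge : ∀ i, σ (pt (i, false)) = pt (i, true))
    (hb : ∀ i, b ≠ pt (i, true)) (hY : ∀ i ∈ Y, tl i ∉ Set.range pt ∧ hd i ∉ Set.range pt)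
    {α : Fin m → ι} {ltl lhd : Fin m → Fin k × Bool} {lw : Fin m → ℤˣ}
    (hα : Local pt tl hd w Y α ltl lhd lw) (hproper : Proper ltl lhd) {S : Finset ι} (hS : S ⊆ Y)
    {T : List (Fin m)} (hT : T ∈ (List.finRange m).sublists') :
    Good σ tl hd b (S ∪ (T.map α).toFinset) ↔
      OuterGood (σ * pairing tl hd S) pt tl hd b S (exit (flip ltl lhd T)) ∧
      (Complete (flip ltl lhd T) ∧ ∀ i ∈ T, earlier (flip ltl lhd T)
        (entryOrder (σ * pairing tl hd S) pt b (exit (flip ltl lhd T))) (ltl i) (lhd i) = true) := by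
  obtain ⟨hflip, hexits⟩ := hproper T hT
  set f := flip ltl lhd T
  set T' := (T.map α).toFinset with hT'
  have hTs := List.mem_sublists'.1 hT
  have hTY : T' ⊆ Y ∪ ((List.finRange m).map α).toFinset := by
    intro i hi
    refine Finset.mem_union_right _ ?_
    rw [hT', List.mem_toFinset] at hi
    rw [List.mem_toFinset]
    exact (hTs.map α).subset hi
  have hSY : S ⊆ Y ∪ ((List.finRange m).map α).toFinset := hS.trans Finset.subset_union_left
  have hmem : ∀ i, i ∈ T' ↔ ∃ j ∈ T, α j = i := by simp [hT']
  have hdisj : Disjoint S T' := by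
    rw [Finset.disjoint_left]
    intro i hi hi'
    obtain ⟨j, -, rfl⟩ := (hmem i).1 hi'
    exact hα.notMem j (hS hi)
  set g₀ := σ * pairing tl hd S with hg₀
  have hg : σ * pairing tl hd (S ∪ T') = g₀ * pairing tl hd T' := by
    rw [pairing_union hα.distinct hSY hTY hdisj, mul_assoc]
  have h₀ : IsTangle g₀ pt b := by
    refine ⟨hpt, fun i => ?_, hb⟩
    rw [hg₀, Equiv.Perm.mul_apply, pairing_of_ne, hedge]
    exact fun j hj => ⟨fun h => (hY j (hS hj)).1 ⟨_, h⟩, fun h => (hY j (hS hj)).2 ⟨_, h⟩⟩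
  have h1 : ∀ x, (g₀ * pairing tl hd T') (pt x) = g₀ (pt (f x)) := by
    intro x
    rw [Equiv.Perm.mul_apply]
    congr 1
    by_cases hx : ∃ i ∈ T, x = ltl i
    · obtain ⟨i, hi, rfl⟩ := hx
      rw [(hflip.1 i hi).1, ← hα.tl_eq, ← hα.hd_eq]
      exact pairing_tl (hα.distinct.mono hTY) ((hmem _).2 ⟨i, hi, rfl⟩)
    by_cases hx' : ∃ i ∈ T, x = lhd i
    · obtain ⟨i, hi, rfl⟩ := hx'
      rw [(hflip.1 i hi).2, ← hα.tl_eq, ← hα.hd_eq]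
      exact pairing_hd (hα.distinct.mono hTY) ((hmem _).2 ⟨i, hi, rfl⟩)
    push Not at hx hx'
    rw [hflip.2 x fun i hi => ⟨hx i hi, hx' i hi⟩, pairing_of_ne]
    intro j hj
    obtain ⟨i, hi, rfl⟩ := (hmem j).1 hj
    rw [hα.tl_eq, hα.hd_eq]
    exact ⟨fun h => hx i hi (hpt h), fun h => hx' i hi (hpt h)⟩
  have h2 : ∀ p ∉ Set.range pt, (g₀ * pairing tl hd T') p = g₀ p := by
    intro p hp
    rw [Equiv.Perm.mul_apply, pairing_of_ne]
    intro j hj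
    obtain ⟨i, hi, rfl⟩ := (hmem j).1 hj
    rw [hα.tl_eq, hα.hd_eq]
    exact ⟨fun h => hp ⟨_, h.symm⟩, fun h => hp ⟨_, h.symm⟩⟩
  have hout : ∀ p, p ∉ Set.range pt → p ∉ Set.range fun i => pt (i, true) := by
    rintro p hp ⟨i, hi⟩
    exact hp ⟨_, hi⟩
  unfold Good OuterGood
  rw [hg, covers_iff h₀ h1 h2 hexits]
  constructor
  · rintro ⟨⟨hc, ho⟩, hbef⟩
    have hcov := (covers_iff h₀ h1 h2 hexits).2 ⟨hc, ho⟩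
    refine ⟨⟨ho, fun i hi => ?_⟩, hc, fun i hi => ?_⟩
    · rw [← before_outer h₀ h1 h2 hexits (hout _ (hY i (hS hi)).1) (hout _ (hY i (hS hi)).2)]
      exact hbef i (Finset.mem_union_left _ hi)
    · have := hbef (α i) (Finset.mem_union_right _ ((hmem _).2 ⟨i, hi, rfl⟩))
      rw [hα.tl_eq, hα.hd_eq] at this
      exact (before_place h₀ h1 h2 hexits hcov _ _).1 this
  · rintro ⟨⟨ho, hbef⟩, hc, hloc⟩
    have hcov := (covers_iff h₀ h1 h2 hexits).2 ⟨hc, ho⟩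
    refine ⟨⟨hc, ho⟩, fun i hi => ?_⟩
    rcases Finset.mem_union.1 hi with hi | hi
    · rw [before_outer h₀ h1 h2 hexits (hout _ (hY i (hS hi)).1) (hout _ (hY i (hS hi)).2)]
      exact hbef i hi
    · obtain ⟨j, hj, rfl⟩ := (hmem _).1 hi
      rw [hα.tl_eq, hα.hd_eq]
      exact (before_place h₀ h1 h2 hexits hcov _ _).2 (hloc j hj)

theorem stateSum_tangle (hpt : pt.Injective) (hedge : ∀ i, σ (pt (i, false)) = pt (i, true))
    (hb : ∀ i, b ≠ pt (i, true)) (hY : ∀ i ∈ Y, tl i ∉ Set.range pt ∧ hd i ∉ Set.range pt)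
    {α : Fin m → ι} {ltl lhd : Fin m → Fin k × Bool} {lw : Fin m → ℤˣ}
    (hα : Local pt tl hd w Y α ltl lhd lw) (hproper : Proper ltl lhd) :
    stateSum z σ tl hd w (Y ∪ ((List.finRange m).map α).toFinset) b =
      ∑ S ∈ Y.powerset, (∏ i ∈ S, (((w i : ℤ) : R) * z)) *
        ((List.finRange m).sublists'.map fun T =>
          ((coeff ltl lhd lw (entryOrder (σ * pairing tl hd S) pt b (key ltl lhd T).1) T : ℤ) : R) *
          (z ^ (key ltl lhd T).2 * if OuterGood (σ * pairing tl hd S) pt tl hd b S (key ltl lhd T).1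
            then 1 else 0)).sum := by
  unfold stateSum
  rw [sum_powerset_union_toFinset]
  · refine Finset.sum_congr rfl fun S hS => ?_
    have hS := Finset.mem_powerset.1 hS
    rw [List.sublists'_map, List.map_map, ← List.sum_map_mul_left]
    congr 1
    refine List.map_congr_left fun T hT => ?_
    have hTs := List.mem_sublists'.1 hT
    have hTn : (T.map α).Nodup := (hTs.nodup (List.nodup_finRange m)).map hα.inj
    have hdisj : Disjoint S (T.map α).toFinset := by
      rw [Finset.disjoint_left]
      intro i hi hi'
      obtain ⟨j, -, rfl⟩ := List.mem_map.1 (List.mem_toFinset.1 hi')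
      exact hα.notMem j (hS hi)
    have hprod : ∏ i ∈ (T.map α).toFinset, (((w i : ℤ) : R) * z) =
        (((T.map fun i => (lw i : ℤ)).prod : ℤ) : R) * z ^ T.length := by
      rw [List.prod_toFinset _ hTn, List.map_map]
      clear hdisj hTn hTs hT
      induction T with
      | nil => simp
      | cons i T ih =>
        simp only [List.map_cons, List.prod_cons, Function.comp, List.length_cons, hα.sign_eq] at ih ⊢
        rw [ih, Int.cast_mul, pow_succ]
        ring
    rw [Function.comp, Finset.prod_union hdisj, hprod]
    simp only [good_union hpt hedge hb hY hα hproper hS hT]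
    unfold coeff key
    by_cases h1 : OuterGood (σ * pairing tl hd S) pt tl hd b S (exit (flip ltl lhd T))
    · by_cases h2 : Complete (flip ltl lhd T) ∧ ∀ i ∈ T, earlier (flip ltl lhd T)
          (entryOrder (σ * pairing tl hd S) pt b (exit (flip ltl lhd T))) (ltl i) (lhd i) = true
      · rw [if_pos ⟨h1, h2⟩, if_pos h2, if_pos h1]; ring
      · rw [if_neg fun h => h2 h.2, if_neg h2]; simp
    · rw [if_neg fun h => h1 h.1, if_neg h1]; simp
  · exact (List.nodup_finRange m).map hα.inj
  · intro i hi
    obtain ⟨j, -, rfl⟩ := List.mem_map.1 hi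
    exact hα.notMem j

/-- Two tangles with the same contributions for every order of the strands are interchangeable in the
state sum. -/
theorem stateSum_tangle_congr {m' : ℕ} (hpt : pt.Injective)
    (hedge : ∀ i, σ (pt (i, false)) = pt (i, true))
    (hb : ∀ i, b ≠ pt (i, true)) (hY : ∀ i ∈ Y, tl i ∉ Set.range pt ∧ hd i ∉ Set.range pt)
    {α : Fin m → ι} {ltl lhd : Fin m → Fin k × Bool} {lw : Fin m → ℤˣ}
    (hα : Local pt tl hd w Y α ltl lhd lw) (hproper : Proper ltl lhd)
    {α' : Fin m' → ι} {ltl' lhd' : Fin m' → Fin k × Bool} {lw' : Fin m' → ℤˣ}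
    (hα' : Local pt tl hd w Y α' ltl' lhd' lw') (hproper' : Proper ltl' lhd')
    (htable : ∀ o, IsOrder o → Balanced (contributions ltl lhd lw o ++
      (contributions ltl' lhd' lw' o).map fun x => (x.1, -x.2))) :
    stateSum z σ tl hd w (Y ∪ ((List.finRange m).map α).toFinset) b =
      stateSum z σ tl hd w (Y ∪ ((List.finRange m').map α').toFinset) b := by
  rw [stateSum_tangle hpt hedge hb hY hα hproper, stateSum_tangle hpt hedge hb hY hα' hproper']
  refine Finset.sum_congr rfl fun S _ => congrArg _ ?_
  refine sum_map_eq_of_balanced _ _ (key ltl lhd) (key ltl' lhd')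
    (fun x T => coeff ltl lhd lw (entryOrder (σ * pairing tl hd S) pt b x.1) T)
    (fun x T => coeff ltl' lhd' lw' (entryOrder (σ * pairing tl hd S) pt b x.1) T)
    (fun x => z ^ x.2 * if OuterGood (σ * pairing tl hd S) pt tl hd b S x.1 then 1 else 0) ?_
  intro x hx
  have hgood : OuterGood (σ * pairing tl hd S) pt tl hd b S x.1 := by
    by_contra h
    exact hx (by rw [if_neg h, mul_zero])
  have := htable _ (hgood.isOrder hpt)
  unfold contributions at this
  rwa [List.map_map] at this

end

end Tangle

/-! ### Bigons and triangles -/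

namespace Tangle

/-- The order of two strands in which strand `0` is entered first if `x` holds. -/
def order₂ (x : Bool) (i j : Fin 2) : Bool := if i < j then x else if j < i then !x else false

/-- The relation between three strands that is given by its values for the pairs `0, 1`, `1, 2` and
`0, 2`. -/
def order₃ (x y z : Bool) : Fin 3 → Fin 3 → Bool
  | 0, 1 => x
  | 1, 0 => !x
  | 1, 2 => y
  | 2, 1 => !y
  | 0, 2 => z
  | 2, 0 => !z
  | _, _ => false

/-- The lower passages of the two crossings of a bigon, whose upper passages are the places `(0, false)`
and `(0, true)`; the strands run in the same direction if `d` holds. -/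
def bigonHead (d : Bool) : Fin 2 → Fin 2 × Bool := ![(1, !d), (1, d)]

/-- The upper passages of the two crossings of a bigon. -/
def bigonTail : Fin 2 → Fin 2 × Bool := ![(0, false), (0, true)]

/-- The upper passages of the crossings `top/middle`, `top/bottom`, `middle/bottom` of a triangle.  The
three strands are `0` (top), `1` (middle) and `2` (bottom); the Booleans tell whether the strands meet
these crossings in the order top/middle, top/bottom; top/middle, middle/bottom; top/bottom,
middle/bottom.  The third Reidemeister move negates all of them. -/
def triangleTail (d₀ d₁ : Bool) : Fin 3 → Fin 3 × Bool := ![(0, !d₀), (0, d₀), (1, d₁)]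

/-- The lower passages of the crossings of a triangle, see `triangleTail`. -/
def triangleHead (d₁ d₂ : Bool) : Fin 3 → Fin 3 × Bool := ![(1, !d₁), (2, !d₂), (2, d₂)]

/-- The sign of a truth value. -/
def signOf (d : Bool) : ℤˣ := if d then 1 else -1

/-- The signs of the crossings of a triangle.  Whether the three strands bound a triangular region is
reflected by the fact that one sign `s` determines all of them. -/
def triangleSign (s : ℤˣ) (d₀ d₁ d₂ : Bool) : Fin 3 → ℤˣ :=
  ![s * signOf d₀ * signOf d₁, s * signOf d₀ * signOf d₂, s * signOf d₁ * signOf d₂]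

theorem bigon_proper : ∀ d, Proper bigonTail (bigonHead d) := by decide +kernel

theorem trivial_proper : Proper (k := 2) (m := 0) ![] ![] := by decide +kernel

theorem triangle_proper : ∀ d₀ d₁ d₂, Proper (triangleTail d₀ d₁) (triangleHead d₁ d₂) := by
  decide +kernel

theorem bigon_table : ∀ (d : Bool) (s : ℤˣ) (x : Bool), Balanced
    (contributions bigonTail (bigonHead d) ![s, -s] (order₂ x) ++
      (contributions (k := 2) (m := 0) ![] ![] ![] (order₂ x)).map fun x => (x.1, -x.2)) := by
  decide +kernel

theorem triangle_table : ∀ (d₀ d₁ d₂ : Bool) (s : ℤˣ) (x y z : Bool), (x = y → z = x) → Balanced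
    (contributions (triangleTail d₀ d₁) (triangleHead d₁ d₂) (triangleSign s d₀ d₁ d₂)
      (order₃ x y z) ++
    (contributions (triangleTail (!d₀) (!d₁)) (triangleHead (!d₁) (!d₂)) (triangleSign s d₀ d₁ d₂)
      (order₃ x y z)).map fun x => (x.1, -x.2)) := by
  decide +kernel

end Tangle

/-! ### Reidemeister moves -/

namespace Tangle
open scoped Classical

theorem signOf_mul_self (d : Bool) : signOf d * signOf d = 1 := by cases d <;> rfl

theorem signOf_not (d : Bool) : signOf (!d) = -signOf d := by cases d <;> rfl

theorem mem_toFinset_map_finRange {ι : Type*} {m : ℕ} {α : Fin m → ι} {x : ι} :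
    x ∈ ((List.finRange m).map α).toFinset ↔ ∃ i, α i = x := by simp

theorem mem_toFinset_map_finRange_three {ι : Type*} {a b c x : ι} :
    x ∈ ((List.finRange 3).map ![a, b, c]).toFinset ↔ x = a ∨ x = b ∨ x = c := by
  rw [mem_toFinset_map_finRange]
  constructor
  · rintro ⟨i, rfl⟩
    fin_cases i <;> simp
  · rintro (rfl | rfl | rfl)
    exacts [⟨0, rfl⟩, ⟨1, rfl⟩, ⟨2, rfl⟩]

theorem bigon_balanced (d : Bool) (s : ℤˣ) {o : Fin 2 → Fin 2 → Bool} (ho : IsOrder o) : Balanced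
    (contributions bigonTail (bigonHead d) ![s, -s] o ++
      (contributions (k := 2) (m := 0) ![] ![] ![] o).map fun x => (x.1, -x.2)) := by
  have h : ∀ i j, i ≠ j → o i j = order₂ (o 0 1) i j := by
    intro i j hij
    have := ho.1 1 0 (by decide)
    fin_cases i <;> fin_cases j <;> simp_all [order₂]
  have := bigon_table d s (o 0 1)
  unfold contributions at this ⊢
  simpa only [coeff_congr h] using this

theorem triangle_balanced (d₀ d₁ d₂ : Bool) (s : ℤˣ) {o : Fin 3 → Fin 3 → Bool} (ho : IsOrder o) :
    Balanced (contributions (triangleTail d₀ d₁) (triangleHead d₁ d₂) (triangleSign s d₀ d₁ d₂) o ++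
      (contributions (triangleTail (!d₀) (!d₁)) (triangleHead (!d₁) (!d₂))
        (triangleSign s d₀ d₁ d₂) o).map fun x => (x.1, -x.2)) := by
  have h10 := ho.1 1 0 (by decide)
  have h21 := ho.1 2 1 (by decide)
  have h20 := ho.1 2 0 (by decide)
  have h : ∀ i j, i ≠ j → o i j = order₃ (o 0 1) (o 1 2) (o 0 2) i j := by
    intro i j hij
    fin_cases i <;> fin_cases j <;> first | exact absurd rfl hij | rfl | assumption
  have htrans : o 0 1 = o 1 2 → o 0 2 = o 0 1 := by
    intro heq
    have h1 := ho.2 0 1 2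
    have h2 := ho.2 2 1 0
    rw [h10, h21, h20] at h2
    clear h h10 h21 h20
    revert heq h1 h2
    generalize o 0 1 = x, o 1 2 = y, o 0 2 = z
    revert x y z
    decide
  have := triangle_table d₀ d₁ d₂ s _ _ _ htrans
  unfold contributions at this ⊢
  simpa only [coeff_congr h] using this

end Tangle

namespace GaussDiagram
open StateSum Walk
open scoped Classical

variable {P : Type}

/-- The state sum of a diagram with respect to a base point on the edge that ends in `b`. -/
noncomputable def conway (D : GaussDiagram P) (b : P) : ℤ[X] :=
  stateSum X D.next SignedArrow.tail SignedArrow.head SignedArrow.sign D.crossings b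

theorem IsPlanar.conway_base {D : GaussDiagram P} (hD : D.IsPlanar) (b b' : P) :
    D.conway b = D.conway b' := by
  have := D.finite
  have h := stateSum_base D.distinct_east_north hD.hasPotentials (Finset.empty_subset _)
    SignedArrow.sign (X : ℤ[X]) b b'
  rw [upper_east_north.1, upper_east_north.2, pairing_empty, mul_one, Finset.sdiff_empty] at h
  exact h

theorem corner_cases {D : GaussDiagram P} {a : SignedArrow P} {x y : P} {i j : Bool}
    (h : D.Corner a (x, i) (y, j)) :
    (x = a.east ∧ i = true ∧ y = a.north ∧ j = false) ∨
      (D.next x = a.east ∧ i = true ∧ y = a.north ∧ j = true) ∨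
      (D.next x = a.east ∧ i = false ∧ D.next y = a.north ∧ j = true) ∨
      (x = a.east ∧ i = false ∧ D.next y = a.north ∧ j = false) := by
  cases h <;> simp

end GaussDiagram

namespace LinkDiagram
open StateSum Walk Tangle GaussDiagram
open scoped Classical

variable {P : Type} {D E : LinkDiagram P}

/-- The sides of two edges that meet in a corner of a crossing, expressed by the sign of the crossing
and the directions of the edges (`true` for outgoing). -/
theorem meet_sides {a : SignedArrow P} (hne : a.tail ≠ a.head) {x y : P} {u v i j : Bool}
    (hx : if u then x = a.tail ∧ D.next x ≠ a.tail ∧ D.next x ≠ a.head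
      else D.next x = a.tail ∧ x ≠ a.tail ∧ x ≠ a.head)
    (hy : if v then y = a.head ∧ D.next y ≠ a.tail ∧ D.next y ≠ a.head
      else D.next y = a.head ∧ y ≠ a.tail ∧ y ≠ a.head)
    (h : D.Meet a (x, i) (y, j)) :
    signOf i = a.sign * signOf v ∧ signOf j = -(a.sign * signOf u) := by
  have key : (a.sign = 1 ∧ a.east = a.tail ∧ a.north = a.head) ∨
      (a.sign = -1 ∧ a.east = a.head ∧ a.north = a.tail) := by
    rcases Int.units_eq_one_or a.sign with h | h <;> simp [SignedArrow.east, SignedArrow.north, h]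
  have h' := h.imp corner_cases corner_cases
  clear h
  rcases key with ⟨h1, h2, h3⟩ | ⟨h1, h2, h3⟩ <;> rw [h2, h3] at h' <;> rw [h1] <;>
    cases u <;> cases v <;> simp only [if_true, Bool.false_eq_true, if_false] at hx hy <;>
    rcases h' with (h | h | h | h) | (h | h | h | h) <;>
    obtain ⟨h4, rfl, h5, rfl⟩ := h <;> first | exact ⟨rfl, rfl⟩ | (exfalso; grind)

theorem conway_reidemeister1 (h : Reidemeister1 D E) (b : P) : D.conway b = E.conway b := by
  have := D.finite
  obtain ⟨a, ha, hkink, hnext, harr⟩ := h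
  have haY := mem_crossings.2 ha
  have hE : E.crossings = D.crossings.erase a := by
    ext x
    simp [mem_crossings, harr, and_comm]
  unfold conway
  rw [hnext, hE]
  unfold stateSum
  conv_lhs => rw [← Finset.insert_erase haY]
  rw [Finset.sum_powerset_insert (by simp), add_eq_left]
  refine Finset.sum_eq_zero fun S hS => if_neg ?_
  have hS : insert a S ⊆ D.crossings := Finset.insert_subset haY
    ((Finset.mem_powerset.1 hS).trans (Finset.erase_subset _ _))
  have hd := D.distinct_tail_head.mono hS
  have hth : a.tail ≠ a.head := D.tail_ne_head a ha a ha
  rintro ⟨hcov, -⟩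
  set g := D.next * pairing SignedArrow.tail SignedArrow.head (insert a S) with hg
  -- smoothing the kink splits off a component with one point
  have key : ∀ p q, p ≠ q → g p = p → False := by
    intro p q hpq hp
    have := mem_of_path (C := {p}) rfl (fun x _ hx => by
      rw [Set.mem_singleton_iff] at hx ⊢
      rw [hx, hp]) (hcov.symm p q)
    exact hpq this.symm
  rcases hkink with h | h
  · refine key a.head a.tail hth.symm ?_
    rw [hg, Equiv.Perm.mul_apply, pairing_hd hd (by simp), h]
  · refine key a.tail a.head hth ?_
    rw [hg, Equiv.Perm.mul_apply, pairing_tl hd (by simp), h]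

/-- The places of a bigon with the crossings `a` and `b`, see `bigonHead`. -/
def bigonPlace (a b : SignedArrow P) (d : Bool) : Fin 2 × Bool → P
  | (0, s) => if s then b.tail else a.tail
  | (1, s) => if s = d then b.head else a.head

theorem conway_reidemeister2 (h : Reidemeister2 D E) : ∃ b, D.conway b = E.conway b := by
  have := D.finite
  obtain ⟨a, ha, b, hb, hsign, htail, hhead, hnext, harr⟩ := h
  have hab : a ≠ b := by
    rintro rfl
    rcases Int.units_eq_one_or a.sign with h | h <;> rw [h] at hsign <;> exact absurd hsign (by decide)
  obtain ⟨d, hd⟩ : ∃ d : Bool, if d then D.next a.head = b.head else D.next b.head = a.head := by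
    rcases hhead with h | h
    exacts [⟨true, h⟩, ⟨false, h⟩]
  have t1 : a.tail ≠ b.tail := fun h => hab (D.tail_inj a ha b hb h)
  have t2 : a.head ≠ b.head := fun h => hab (D.head_inj a ha b hb h)
  have t3 := D.tail_ne_head a ha a ha
  have t4 := D.tail_ne_head a ha b hb
  have t5 := D.tail_ne_head b hb a ha
  have t6 := D.tail_ne_head b hb b hb
  set pt := bigonPlace a b d with hpt
  have hinj : pt.Injective := by
    rintro ⟨i, s⟩ ⟨j, t⟩
    fin_cases i <;> fin_cases j <;> cases s <;> cases t <;> cases d <;>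
      simp [hpt, bigonPlace, t1, t2, t3, t4, t5, t6, t1.symm, t2.symm, t3.symm, t4.symm, t5.symm,
        t6.symm]
  have hplace : ∀ x, pt x = a.tail ∨ pt x = b.tail ∨ pt x = a.head ∨ pt x = b.head := by
    rintro ⟨i, s⟩
    fin_cases i <;> cases s <;> cases d <;> simp [hpt, bigonPlace]
  have hY : ∀ i ∈ E.crossings, i.tail ∉ Set.range pt ∧ i.head ∉ Set.range pt := by
    intro i hi
    rw [mem_crossings, harr] at hi
    obtain ⟨hi, hi'⟩ := hi
    simp only [Set.mem_insert_iff, Set.mem_singleton_iff, not_or] at hi'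
    constructor <;> rintro ⟨x, hx⟩ <;> rcases hplace x with h | h | h | h <;> rw [h] at hx
    · exact hi'.1 (D.tail_inj a ha i hi hx).symm
    · exact hi'.2 (D.tail_inj b hb i hi hx).symm
    · exact D.tail_ne_head i hi a ha hx.symm
    · exact D.tail_ne_head i hi b hb hx.symm
    · exact D.tail_ne_head a ha i hi hx
    · exact D.tail_ne_head b hb i hi hx
    · exact hi'.1 (D.head_inj a ha i hi hx).symm
    · exact hi'.2 (D.head_inj b hb i hi hx).symm
  have hD : E.crossings ∪ ((List.finRange 2).map ![a, b]).toFinset = D.crossings := by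
    ext x
    rw [Finset.mem_union, mem_toFinset_map_finRange, mem_crossings, mem_crossings, harr]
    simp only [Fin.exists_fin_two, Matrix.cons_val_zero, Matrix.cons_val_one, Set.mem_sdiff,
      Set.mem_insert_iff, Set.mem_singleton_iff]
    by_cases h1 : x = a
    · subst h1; simp [ha]
    · by_cases h2 : x = b
      · subst h2; simp [hb]
      · simp [h1, h2, Ne.symm h1, Ne.symm h2]
  have hE : E.crossings ∪ ((List.finRange 0).map ![]).toFinset = E.crossings := by simp
  refine ⟨a.tail, ?_⟩
  have main := stateSum_tangle_congr (z := (X : ℤ[X])) (σ := D.next) (pt := pt) (b := a.tail)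
    (tl := SignedArrow.tail) (hd := SignedArrow.head) (w := SignedArrow.sign) (Y := E.crossings)
    hinj ?_ ?_ hY (α := ![a, b]) (ltl := bigonTail) (lhd := bigonHead d) (lw := ![a.sign, -a.sign])
    ⟨?_, ?_, ?_, ?_, ?_, ?_⟩ (bigon_proper d) (α' := ![]) (ltl' := ![]) (lhd' := ![]) (lw' := ![])
    ⟨?_, ?_, ?_, ?_, ?_, ?_⟩ trivial_proper fun o ho => bigon_balanced d a.sign ho
  · rw [hD, hE] at main
    unfold conway
    rw [hnext]
    exact main
  · intro i
    fin_cases i <;> cases d <;> simp_all [bigonPlace]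
  · intro i
    fin_cases i <;> cases d <;> simp_all [bigonPlace]
  · rw [hD]; exact D.distinct_tail_head
  · intro i j h
    fin_cases i <;> fin_cases j <;> simp_all
  · intro i
    rw [mem_crossings, harr]
    fin_cases i <;> simp
  · intro i
    fin_cases i <;> simp [hpt, bigonPlace, bigonTail]
  · intro i
    fin_cases i <;> simp [hpt, bigonPlace, bigonHead]
  · intro i
    fin_cases i <;> simp [hsign]
  · rw [hE]; exact E.distinct_tail_head
  all_goals intro i; exact i.elim0

/-- The places of a triangle with the crossings `a`, `b` and `c`, see `triangleTail`. -/
def trianglePlace (a b c : SignedArrow P) (d₀ d₁ d₂ : Bool) : Fin 3 × Bool → P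
  | (0, s) => if s = d₀ then b.tail else a.tail
  | (1, s) => if s = d₁ then c.tail else a.head
  | (2, s) => if s = d₂ then c.head else b.head

theorem conway_reidemeister3 (h : Reidemeister3 D E) : ∃ b, D.conway b = E.conway b := by
  have := D.finite
  obtain ⟨a, ha, b, hb, c, hc, hab, hbc, hac, ⟨t, m, u, i, j, k, ht, hm, hu, ma, mc, mb⟩, hnext, harr⟩ :=
    h
  have join : ∀ {x p q}, D.Joins x p q → ∃ d : Bool, if d then x = p ∧ D.next p = q
      else x = q ∧ D.next q = p := by
    intro x p q h
    rcases h with h | h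
    exacts [⟨true, h⟩, ⟨false, h⟩]
  obtain ⟨d₀, h₀⟩ := join ht
  obtain ⟨d₁, h₁⟩ := join hm
  obtain ⟨d₂, h₂⟩ := join hu
  clear ht hm hu join
  have t1 : a.tail ≠ b.tail := fun h => hab (D.tail_inj a ha b hb h)
  have t2 : a.tail ≠ c.tail := fun h => hac (D.tail_inj a ha c hc h)
  have t3 : b.tail ≠ c.tail := fun h => hbc (D.tail_inj b hb c hc h)
  have t4 : a.head ≠ b.head := fun h => hab (D.head_inj a ha b hb h)
  have t5 : a.head ≠ c.head := fun h => hac (D.head_inj a ha c hc h)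
  have t6 : b.head ≠ c.head := fun h => hbc (D.head_inj b hb c hc h)
  have t7 := D.tail_ne_head a ha a ha
  have t8 := D.tail_ne_head a ha b hb
  have t9 := D.tail_ne_head a ha c hc
  have t10 := D.tail_ne_head b hb a ha
  have t11 := D.tail_ne_head b hb b hb
  have t12 := D.tail_ne_head b hb c hc
  have t13 := D.tail_ne_head c hc a ha
  have t14 := D.tail_ne_head c hc b hb
  have t15 := D.tail_ne_head c hc c hc
  -- the three corners determine the signs up to a common factor
  have sa := meet_sides (u := d₀) (v := d₁) t7 (by cases d₀ <;> simp_all [Ne.symm])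
    (by cases d₁ <;> simp_all [Ne.symm]) ma
  have sb := meet_sides (i := i) (j := k) (x := t) (y := u) (u := !d₀) (v := d₂) t11
    (by cases d₀ <;> simp_all [Ne.symm]) (by cases d₂ <;> simp_all [Ne.symm]) mb.symm
  have sc := meet_sides (u := !d₁) (v := !d₂) t15 (by cases d₁ <;> simp_all [Ne.symm])
    (by cases d₂ <;> simp_all [Ne.symm]) mc
  have hsigns : triangleSign (a.sign * signOf d₀ * signOf d₁) d₀ d₁ d₂ = ![a.sign, b.sign, c.sign] := by
    have hb' : b.sign = a.sign * signOf d₁ * signOf d₂ := by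
      rw [← sa.1, sb.1, mul_assoc, signOf_mul_self, mul_one]
    have hc' : c.sign = a.sign * signOf d₀ * signOf d₂ := by
      have h1 := sa.2.symm.trans sc.1
      rw [signOf_not, mul_neg, neg_inj] at h1
      rw [h1, mul_assoc, signOf_mul_self, mul_one]
    have e := signOf_mul_self
    unfold triangleSign
    rw [hb', hc']
    have e1 : ∀ x y : ℤˣ, x * signOf d₀ * y * signOf d₀ = x * y := fun x y => by
      rw [mul_right_comm, mul_assoc x, e, mul_one]
    rw [e1, mul_assoc _ (signOf d₁) (signOf d₁), e, mul_one, mul_assoc _ (signOf d₁) (signOf d₁), e,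
      mul_one]
  set pt := trianglePlace a b c d₀ d₁ d₂ with hpt
  have hinj : pt.Injective := by
    rintro ⟨i, s⟩ ⟨j, t⟩
    fin_cases i <;> fin_cases j <;> simp [hpt, trianglePlace] <;> (repeat' split_ifs) <;> grind
  have hplace : ∀ x, pt x = a.tail ∨ pt x = b.tail ∨ pt x = a.head ∨ pt x = c.tail ∨ pt x = b.head ∨
      pt x = c.head := by
    rintro ⟨i, s⟩
    fin_cases i <;> simp only [hpt, trianglePlace] <;> split_ifs <;> simp
  set Y := D.crossings \ {a, b, c} with hYdef
  have hmemY : ∀ {x}, x ∈ Y ↔ x ∈ D.arrows ∧ x ≠ a ∧ x ≠ b ∧ x ≠ c := by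
    intro x
    simp [hYdef, mem_crossings]
  have hY : ∀ i ∈ Y, i.tail ∉ Set.range pt ∧ i.head ∉ Set.range pt := by
    intro i hi
    obtain ⟨hi, h1, h2, h3⟩ := hmemY.1 hi
    constructor <;> rintro ⟨x, hx⟩ <;> rcases hplace x with h | h | h | h | h | h <;> rw [h] at hx
    · exact h1 (D.tail_inj a ha i hi hx).symm
    · exact h2 (D.tail_inj b hb i hi hx).symm
    · exact D.tail_ne_head i hi a ha hx.symm
    · exact h3 (D.tail_inj c hc i hi hx).symm
    · exact D.tail_ne_head i hi b hb hx.symm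
    · exact D.tail_ne_head i hi c hc hx.symm
    · exact D.tail_ne_head a ha i hi hx
    · exact D.tail_ne_head b hb i hi hx
    · exact h1 (D.head_inj a ha i hi hx).symm
    · exact D.tail_ne_head c hc i hi hx
    · exact h2 (D.head_inj b hb i hi hx).symm
    · exact h3 (D.head_inj c hc i hi hx).symm
  have hD : Y ∪ ((List.finRange 3).map ![a, b, c]).toFinset = D.crossings := by
    ext x
    rw [Finset.mem_union, mem_toFinset_map_finRange_three, mem_crossings, hmemY]
    constructor
    · rintro (h | rfl | rfl | rfl)
      exacts [h.1, ha, hb, hc]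
    · tauto
  set a' : SignedArrow P := ⟨b.tail, c.tail, a.sign⟩ with ha'
  set b' : SignedArrow P := ⟨a.tail, c.head, b.sign⟩ with hb'
  set c' : SignedArrow P := ⟨a.head, b.head, c.sign⟩ with hc'
  have hE : Y ∪ ((List.finRange 3).map ![a', b', c']).toFinset = E.crossings := by
    ext x
    rw [Finset.mem_union, mem_toFinset_map_finRange_three, mem_crossings, hmemY, harr]
    simp only [Set.mem_union, Set.mem_sdiff, Set.mem_insert_iff, Set.mem_singleton_iff, not_or]
  have hnew : ∀ x, x = a' ∨ x = b' ∨ x = c' → x ∉ Y := by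
    intro x hx hxY
    obtain ⟨hxD, h1, h2, h3⟩ := hmemY.1 hxY
    rcases hx with rfl | rfl | rfl
    · exact h2 (D.tail_inj _ hxD b hb rfl)
    · exact h1 (D.tail_inj _ hxD a ha rfl)
    · exact D.tail_ne_head _ hxD a ha rfl
  have hpt' : ∀ i s, pt (i, s) =
      if i = 0 then (if s = d₀ then b.tail else a.tail) else
      if i = 1 then (if s = d₁ then c.tail else a.head) else (if s = d₂ then c.head else b.head) := by
    intro i s
    fin_cases i <;> rfl
  obtain ⟨x, hx⟩ : ∃ x, x = pt (0, false) := ⟨_, rfl⟩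
  refine ⟨x, ?_⟩
  have main := stateSum_tangle_congr (z := (X : ℤ[X])) (σ := D.next) (pt := pt) (b := x)
    (tl := SignedArrow.tail) (hd := SignedArrow.head) (w := SignedArrow.sign) (Y := Y)
    hinj ?_ ?_ hY (α := ![a, b, c]) (ltl := triangleTail d₀ d₁) (lhd := triangleHead d₁ d₂)
    (lw := triangleSign (a.sign * signOf d₀ * signOf d₁) d₀ d₁ d₂)
    ⟨?_, ?_, ?_, ?_, ?_, ?_⟩ (triangle_proper d₀ d₁ d₂) (α' := ![a', b', c'])
    (ltl' := triangleTail (!d₀) (!d₁)) (lhd' := triangleHead (!d₁) (!d₂))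
    (lw' := triangleSign (a.sign * signOf d₀ * signOf d₁) d₀ d₁ d₂)
    ⟨?_, ?_, ?_, ?_, ?_, ?_⟩ (triangle_proper (!d₀) (!d₁) (!d₂))
    fun o ho => triangle_balanced d₀ d₁ d₂ _ ho
  · rw [hD, hE] at main
    unfold conway
    rw [hnext]
    exact main
  · intro i
    fin_cases i
    · cases d₀ <;> simpa [hpt'] using h₀.2
    · cases d₁ <;> simpa [hpt'] using h₁.2
    · cases d₂ <;> simpa [hpt'] using h₂.2
  · intro i h
    rw [hx] at h
    exact absurd (hinj h) (by simp)
  · rw [hD]; exact D.distinct_tail_head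
  · intro i j h
    fin_cases i <;> fin_cases j <;>
      simp [hab, hbc, hac, hab.symm, hbc.symm, hac.symm] at h ⊢
  · intro i
    rw [hmemY]
    fin_cases i <;> simp
  · intro i
    fin_cases i <;> simp [hpt', triangleTail]
  · intro i
    fin_cases i <;> simp [hpt', triangleHead]
  · intro i
    rw [hsigns]
    fin_cases i <;> rfl
  · rw [hE]; exact E.distinct_tail_head
  · intro i j h
    fin_cases i <;> fin_cases j <;>
      simp [ha', hb', hc', t1, t7, t10, t1.symm, t7.symm, t10.symm] at h ⊢
  · intro i
    refine hnew _ ?_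
    fin_cases i <;> simp
  · intro i
    fin_cases i <;> simp [hpt', triangleTail, ha', hb', hc']
  · intro i
    fin_cases i <;> simp [hpt', triangleHead, ha', hb', hc']
  · intro i
    rw [hsigns]
    fin_cases i <;> rfl

end LinkDiagram

/-! ### Renaming and inserting points -/

namespace Walk

variable {P Q : Type*} {f : P → Q} {g : P → P} {h : Q → Q}

/-- `f` embeds the points of the map `g` in the points of the map `h`, which arises by inserting at most
one point between a point and its successor. -/
structure Refines (f : P → Q) (g : P → P) (h : Q → Q) : Prop where
  inj : f.Injective
  next : ∀ p, h (f p) = f (g p) ∨ (h (f p) ∉ Set.range f ∧ h (h (f p)) = f (g p))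
  inserted : ∀ q ∉ Set.range f, ∃ p, h (f p) = q

theorem Refines.path_iff (H : Refines f g h) {Z : Set Q} (hZ : Z ⊆ Set.range f) {b p : P} :
    Path h Z (f b) (f p) ↔ Path g (f ⁻¹' Z) b p := by
  have hg : ∀ p, Function.extend f (f ∘ g) id (f p) = f (g p) := fun p => H.inj.extend_apply ..
  rw [path_return (g' := Function.extend f (f ∘ g) id) (I := (Set.range f)ᶜ) ?_ ?_ (by simp) (by simp)]
  · exact path_semiconj H.inj hg
  · intro q hq
    obtain ⟨p, rfl⟩ := not_not.1 hq
    rw [hg]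
    refine ⟨by simp, ?_⟩
    rcases H.next p with h1 | ⟨h1, h2⟩
    · exact ⟨0, h1, by simp⟩
    · refine ⟨1, h2, fun j hj => ?_⟩
      rw [Nat.lt_one_iff.1 hj]
      exact h1
  · exact fun q hq hq' => hq (hZ hq')

theorem Refines.covers_iff (H : Refines f g h) {b : P} : Covers h (f b) ↔ Covers g b := by
  constructor
  · intro hc p
    simpa using (H.path_iff (Set.empty_subset _)).1 (hc (f p))
  · intro hc q
    have key : ∀ p, Path h ∅ (f b) (f p) := fun p =>
      (H.path_iff (Set.empty_subset _)).2 (by simpa using hc p)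
    by_cases hq : q ∈ Set.range f
    · obtain ⟨p, rfl⟩ := hq
      exact key p
    · obtain ⟨p, rfl⟩ := H.inserted q hq
      exact (key p).step

theorem Refines.before_iff (H : Refines f g h) {b p q : P} :
    Before h (f b) (f p) (f q) ↔ Before g b p q := by
  unfold Before
  rw [H.inj.ne_iff, H.path_iff (by simp)]
  rw [show f ⁻¹' {f q} = {q} by ext x; simp [H.inj.eq_iff]]

end Walk

namespace StateSum
open Walk
open scoped Classical

variable {P Q ι κ R : Type*} [CommRing R] {z : R} {Y : Finset ι}

theorem distinct_of_image {tl hd : κ → P} {φ : ι → κ} (hφ : φ.Injective)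
    (h : Distinct tl hd (Y.image φ)) : Distinct (tl ∘ φ) (hd ∘ φ) Y :=
  ⟨fun _ hi _ hj e => hφ (h.tl_inj _ (Finset.mem_image_of_mem _ hi) _ (Finset.mem_image_of_mem _ hj) e),
    fun _ hi _ hj e => hφ (h.hd_inj _ (Finset.mem_image_of_mem _ hi) _ (Finset.mem_image_of_mem _ hj) e),
    fun _ hi _ hj => h.ne _ (Finset.mem_image_of_mem _ hi) _ (Finset.mem_image_of_mem _ hj)⟩

theorem pairing_image {tl hd : κ → P} {φ : ι → κ} (hφ : φ.Injective)
    (h : Distinct tl hd (Y.image φ)) : pairing tl hd (Y.image φ) = pairing (tl ∘ φ) (hd ∘ φ) Y := by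
  ext p
  rcases pairing_cases (distinct_of_image hφ h) p with ⟨i, hi, rfl, e⟩ | ⟨i, hi, rfl, e⟩ | ⟨hp, e⟩ <;>
    rw [e]
  · exact pairing_tl h (Finset.mem_image_of_mem _ hi)
  · exact pairing_hd h (Finset.mem_image_of_mem _ hi)
  · refine pairing_of_ne fun j hj => ?_
    obtain ⟨i, hi, rfl⟩ := Finset.mem_image.1 hj
    exact hp i hi

/-- Renaming the crossings. -/
theorem stateSum_image {σ : Equiv.Perm P} {b : P} {tl hd : κ → P} {w : κ → ℤˣ} {φ : ι → κ}
    (hφ : φ.Injective) (h : Distinct tl hd (Y.image φ)) :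
    stateSum z σ tl hd w (Y.image φ) b = stateSum z σ (tl ∘ φ) (hd ∘ φ) (w ∘ φ) Y b := by
  unfold stateSum
  rw [Finset.powerset_image, Finset.sum_image (Finset.image_injective hφ).injOn]
  refine Finset.sum_congr rfl fun S hS => ?_
  have hS := Finset.mem_powerset.1 hS
  have e : Good σ tl hd b (S.image φ) ↔ Good σ (tl ∘ φ) (hd ∘ φ) b S := by
    unfold Good
    rw [pairing_image hφ (h.mono (Finset.image_subset_image hS))]
    simp
  simp only [e, Finset.prod_image hφ.injOn]
  rfl

theorem pairing_comp {tl hd : ι → P} {f : P → Q} (hf : f.Injective) (h : Distinct tl hd Y) (p : P) :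
    pairing (f ∘ tl) (f ∘ hd) Y (f p) = f (pairing tl hd Y p) := by
  have h' : Distinct (f ∘ tl) (f ∘ hd) Y :=
    ⟨fun i hi j hj e => h.tl_inj i hi j hj (hf e), fun i hi j hj e => h.hd_inj i hi j hj (hf e),
      fun i hi j hj e => h.ne i hi j hj (hf e)⟩
  rcases pairing_cases h p with ⟨i, hi, rfl, e⟩ | ⟨i, hi, rfl, e⟩ | ⟨hp, e⟩ <;> rw [e]
  · exact pairing_tl h' hi
  · exact pairing_hd h' hi
  · exact pairing_of_ne fun i hi => ⟨hf.ne (hp i hi).1, hf.ne (hp i hi).2⟩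

/-- Inserting points that are no endpoints of crossings does not change the state sum. -/
theorem stateSum_refines {σ : Equiv.Perm P} {τ : Equiv.Perm Q} {f : P → Q} (H : Refines f σ τ)
    {tl hd : ι → P} {w : ι → ℤˣ} (h : Distinct tl hd Y) {b : P} :
    stateSum z τ (f ∘ tl) (f ∘ hd) w Y (f b) = stateSum z σ tl hd w Y b := by
  unfold stateSum
  refine Finset.sum_congr rfl fun S hS => ?_
  have h := h.mono (Finset.mem_powerset.1 hS)
  have H' : Refines f (σ * pairing tl hd S) (τ * pairing (f ∘ tl) (f ∘ hd) S) := by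
    have hfix : ∀ q ∉ Set.range f, pairing (f ∘ tl) (f ∘ hd) S q = q := fun q hq =>
      pairing_of_ne fun i _ => ⟨fun e => hq ⟨tl i, e.symm⟩, fun e => hq ⟨hd i, e.symm⟩⟩
    refine ⟨H.inj, fun p => ?_, fun q hq => ?_⟩
    · simp only [Equiv.Perm.mul_apply, pairing_comp H.inj h]
      refine (H.next (pairing tl hd S p)).imp_right fun h1 => ⟨h1.1, ?_⟩
      rw [hfix _ h1.1, h1.2]
    · obtain ⟨p, hp⟩ := H.inserted q hq
      refine ⟨pairing tl hd S p, ?_⟩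
      rw [Equiv.Perm.mul_apply, pairing_comp H.inj h, pairing_pairing h, hp]
  have e : Good τ (f ∘ tl) (f ∘ hd) (f b) S ↔ Good σ tl hd b S := by
    unfold Good
    rw [H'.covers_iff]
    simp only [Function.comp_apply, H'.before_iff]
  simp only [e]

end StateSum

/-! ### The Conway polynomial is the state sum -/

namespace LinkDiagram
open StateSum Walk GaussDiagram
open scoped Classical

variable {P Q : Type} {D : LinkDiagram P} {E : LinkDiagram Q}

theorem conway_refines {f : P → Q} (H : Refines f D.next E.next)
    (harr : E.arrows = SignedArrow.map f '' D.arrows) (b : P) : D.conway b = E.conway (f b) := by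
  have hφ : (SignedArrow.map f).Injective := by
    rintro ⟨x, y, s⟩ ⟨x', y', s'⟩ h
    simp only [SignedArrow.map, SignedArrow.mk.injEq] at h
    rw [H.inj h.1, H.inj h.2.1, h.2.2]
  have hE : E.crossings = D.crossings.image (SignedArrow.map f) := by
    ext x
    simp [mem_crossings, harr]
  have hdist := E.distinct_tail_head
  rw [hE] at hdist
  unfold conway
  rw [hE, stateSum_image hφ hdist]
  exact (stateSum_refines H D.distinct_tail_head).symm

theorem Relabel.refines (h : Relabel D E) : ∃ f : P → Q, Refines f D.next E.next ∧
    E.arrows = SignedArrow.map f '' D.arrows := by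
  obtain ⟨f, hf, harr⟩ := h
  exact ⟨f, ⟨f.injective, fun p => .inl (hf p), fun q hq => absurd (f.surjective q) hq⟩, harr⟩

theorem Subdivide.refines (h : Subdivide D E) : ∃ f : P → Q, Refines f D.next E.next ∧
    E.arrows = SignedArrow.map f '' D.arrows := by
  obtain ⟨f, m, hf, hm, hne, hnext, harr⟩ := h
  refine ⟨f, ⟨hf, fun p => (hnext p).imp_right fun h => ?_, fun q hq => ?_⟩, harr⟩
  · rw [h.1]
    exact ⟨(hm m).1 rfl, h.2⟩
  · obtain rfl := (hm q).2 hq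
    have h1 : E.next.symm q ∈ Set.range f := by
      by_contra h
      have := (hm _).2 h
      exact hne (by rw [Equiv.symm_apply_eq] at this; exact this.symm)
    obtain ⟨p, hp⟩ := h1
    exact ⟨p, by rw [hp, Equiv.apply_symm_apply]⟩

theorem SameLink.conway_eq {P Q : Type} {D : LinkDiagram P} {E : LinkDiagram Q} (h : SameLink D E) :
    (Nonempty P ↔ Nonempty Q) ∧ ∀ b b', D.conway b = E.conway b' := by
  have of_refines : ∀ {P Q : Type} {D : LinkDiagram P} {E : LinkDiagram Q},
      (∃ f : P → Q, Refines f D.next E.next ∧ E.arrows = SignedArrow.map f '' D.arrows) →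
      (Nonempty P ↔ Nonempty Q) ∧ ∀ b b', D.conway b = E.conway b' := by
    rintro P Q D E ⟨f, H, harr⟩
    refine ⟨⟨fun ⟨p⟩ => ⟨f p⟩, fun ⟨q⟩ => ?_⟩, fun b b' => ?_⟩
    · by_cases hq : q ∈ Set.range f
      · exact ⟨hq.choose⟩
      · exact ⟨(H.inserted q hq).choose⟩
    · rw [conway_refines H harr, E.planar.conway_base (f b) b']
  have of_exists : ∀ {P : Type} {D E : LinkDiagram P}, (∃ b, D.conway b = E.conway b) →
      (Nonempty P ↔ Nonempty P) ∧ ∀ b b', D.conway b = E.conway b' := by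
    rintro P D E ⟨x, hx⟩
    exact ⟨Iff.rfl, fun b b' => by
      rw [D.planar.conway_base b x, hx, E.planar.conway_base x b']⟩
  induction h with
  | relabel h => exact of_refines h.refines
  | subdivide h => exact of_refines h.refines
  | @reidemeister1 P D E h =>
    exact ⟨Iff.rfl, fun b b' => by rw [conway_reidemeister1 h, E.planar.conway_base b b']⟩
  | reidemeister2 h => exact of_exists (conway_reidemeister2 h)
  | reidemeister3 h => exact of_exists (conway_reidemeister3 h)
  | symm _ ih => exact ⟨ih.1.symm, fun b b' => (ih.2 b' b).symm⟩
  | trans _ _ ih1 ih2 =>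
    refine ⟨ih1.1.trans ih2.1, fun b b' => ?_⟩
    obtain ⟨x⟩ := ih1.1.1 ⟨b⟩
    rw [ih1.2 b x, ih2.2 x b']

theorem SkeinTriple.conway_sub {A B C : LinkDiagram P} (h : SkeinTriple A B C) (b : P) :
    A.conway b - B.conway b = X * C.conway b := by
  have := A.finite
  obtain ⟨a, ha, hsign, ⟨hBn, hBa⟩, hCn, hCa⟩ := h
  have haY := mem_crossings.2 ha
  have hC : C.crossings = A.crossings.erase a := by
    ext x
    simp [mem_crossings, hCa, and_comm]
  have hchange : a.change ∉ A.arrows := fun h => A.tail_ne_head _ h a ha rfl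
  set φ := Equiv.swap a a.change with hφ
  have hφ' : ∀ x ∈ A.crossings, x ≠ a → φ x = x := fun x hx hxa =>
    Equiv.swap_apply_of_ne_of_ne hxa fun e => hchange (e ▸ mem_crossings.1 hx)
  have hφa : φ a = a.change := Equiv.swap_apply_left ..
  have hB : B.crossings = A.crossings.image φ := by
    ext x
    simp only [mem_crossings, hBa, Finset.mem_image, Set.mem_insert_iff, Set.mem_sdiff,
      Set.mem_singleton_iff]
    constructor
    · rintro (rfl | ⟨h1, h2⟩)
      exacts [⟨a, ha, hφa⟩, ⟨x, h1, hφ' x (mem_crossings.2 h1) h2⟩]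
    · rintro ⟨y, hy, rfl⟩
      by_cases hya : y = a
      · rw [hya, hφa]; exact .inl rfl
      · rw [hφ' y (mem_crossings.2 hy) hya]; exact .inr ⟨hy, hya⟩
  have hdist := B.distinct_tail_head
  rw [hB] at hdist
  unfold conway
  rw [hB, stateSum_image φ.injective hdist, hBn, hCn, hC]
  refine stateSum_skein A.distinct_tail_head haY (fun j hj hja => ?_) ?_ ?_ hsign ?_
  · simp only [Function.comp_apply, hφ' j hj hja, and_self]
  · simp only [Function.comp_apply, hφa]; rfl
  · simp only [Function.comp_apply, hφa]; rfl
  · simp only [Function.comp_apply, hφa]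
    exact congrArg Neg.neg hsign

theorem IsKnot.covers (h : D.IsKnot) (b : P) : Covers D.next b := by
  have := D.finite
  intro p
  have h1 := h.2.2 (Set.mem_univ b) (Set.mem_univ p)
  obtain ⟨n, -, hn⟩ := h1.exists_pow_eq'
  exact path_empty_iff.2 ⟨n, by rw [← Equiv.Perm.coe_pow]; exact hn⟩

/-- The Conway polynomial is the state sum. -/
theorem HasConwayPolynomial.eq_conway {P : Type} {D : LinkDiagram P} {p : ℤ[X]}
    (h : HasConwayPolynomial D p) : Nonempty P ∧ ∀ b, D.conway b = p := by
  induction h with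
  | unknot hD h0 =>
    refine ⟨hD.1, fun b => stateSum_eq_one (hD.covers b) fun a ha => ?_⟩
    rw [mem_crossings, h0] at ha
    exact ha.elim
  | sameLink h _ ih =>
    refine ⟨h.conway_eq.1.1 ih.1, fun b => ?_⟩
    obtain ⟨x⟩ := ih.1
    rw [← h.conway_eq.2 x b, ih.2]
  | positive h _ _ hpq ihB ihC =>
    refine ⟨ihB.1, fun b => ?_⟩
    have := h.conway_sub b
    rw [ihB.2, ihC.2] at this
    linear_combination this - hpq
  | negative h _ _ hpq ihA ihC =>
    refine ⟨ihA.1, fun b => ?_⟩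
    have := h.conway_sub b
    rw [ihA.2, ihC.2] at this
    linear_combination hpq - this
  | smoothed h _ _ hpq ihA ihB =>
    refine ⟨ihA.1, fun b => mul_left_cancel₀ (X_ne_zero (R := ℤ)) ?_⟩
    rw [← h.conway_sub b, ihA.2, ihB.2, hpq]

end LinkDiagram

/-! ### States that count in neither order of the passages -/

namespace StateSum
open Walk
open scoped Classical

variable {P ι : Type*} {σ : Equiv.Perm P} {tl hd : ι → P} {w : ι → ℤˣ} {Y : Finset ι} {b : P}

theorem coeff_stateSum (k : ℕ) : (stateSum (X : ℤ[X]) σ tl hd w Y b).coeff k =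
    ∑ S ∈ Y.powersetCard k with Good σ tl hd b S, ∏ i ∈ S, (w i : ℤ) := by
  unfold stateSum
  rw [finsetSum_coeff, Finset.powersetCard_eq_filter, Finset.filter_filter, Finset.sum_filter]
  refine Finset.sum_congr rfl fun S _ => ?_
  rw [Finset.prod_mul_distrib, Finset.prod_const]
  have h : (∏ i ∈ S, ((w i : ℤ) : ℤ[X])) = C (∏ i ∈ S, (w i : ℤ)) := by
    simp
  by_cases h1 : Good σ tl hd b S
  · rw [if_pos h1, h, coeff_C_mul, coeff_X_pow]
    by_cases h2 : S.card = k
    · rw [if_pos h2.symm, if_pos ⟨h2, h1⟩, mul_one]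
    · rw [if_neg (Ne.symm h2), if_neg fun h => h2 h.1, mul_zero]
  · rw [if_neg h1, if_neg fun h => h1 h.2, coeff_zero]

theorem abs_coeff_stateSum_le (k : ℕ) : |(stateSum (X : ℤ[X]) σ tl hd w Y b).coeff k| ≤
    ((Y.powersetCard k).filter fun S => Good σ tl hd b S).card := by
  rw [coeff_stateSum]
  refine (Finset.abs_sum_le_sum_abs _ _).trans ?_
  rw [Finset.card_eq_sum_ones, Nat.cast_sum]
  refine Finset.sum_le_sum fun S _ => ?_
  rw [Finset.abs_prod]
  refine (Finset.prod_eq_one fun i _ => ?_).le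
  rcases Int.units_eq_one_or (w i) with h | h <;> simp [h]

theorem coeff_stateSum_eq_zero {k : ℕ} (hk : Y.card < k) :
    (stateSum (X : ℤ[X]) σ tl hd w Y b).coeff k = 0 := by
  rw [coeff_stateSum, Finset.powersetCard_eq_empty.2 hk]
  simp

theorem coeff_zero_stateSum :
    (stateSum (X : ℤ[X]) σ tl hd w Y b).coeff 0 = if Covers σ b then 1 else 0 := by
  have h : Good σ tl hd b ∅ ↔ Covers σ b := by simp [Good, pairing_empty]
  rw [coeff_stateSum, Finset.powersetCard_zero, Finset.filter_singleton]
  simp only [h]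
  split_ifs <;> simp

/-- The passages cannot be met both in the order `tl`, `hd` and in the order `hd`, `tl`. -/
theorem Good.not_swap {S : Finset ι} (hS : S.Nonempty) (hY : Distinct tl hd Y) (hSY : S ⊆ Y)
    (h : Good σ tl hd b S) : ¬ Good σ hd tl b S := by
  rintro ⟨-, h'⟩
  obtain ⟨i, hi⟩ := hS
  have h1 := h' i hi
  rw [pairing_swap, before_or_before h.1 (hY.ne i (hSY hi) i (hSY hi)).symm] at h1
  exact h1 (h.2 i hi)

/-- If the two state sums for the two orders of the passages agree, then every state that counts in
neither of them lowers the bound for the coefficients. -/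
theorem two_mul_abs_coeff_add_card_le {k : ℕ} (hk : 1 ≤ k) (hY : Distinct tl hd Y)
    (hflip : stateSum (X : ℤ[X]) σ hd tl w Y b = stateSum X σ tl hd w Y b) {N : Finset (Finset ι)}
    (hN : N ⊆ Y.powersetCard k) (hbad : ∀ S ∈ N, ¬ Good σ tl hd b S ∧ ¬ Good σ hd tl b S) :
    2 * |(stateSum (X : ℤ[X]) σ tl hd w Y b).coeff k| + N.card ≤ Y.card.choose k := by
  have h1 := abs_coeff_stateSum_le (σ := σ) (tl := tl) (hd := hd) (w := w) (Y := Y) (b := b) k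
  have h2 := abs_coeff_stateSum_le (σ := σ) (tl := hd) (hd := tl) (w := w) (Y := Y) (b := b) k
  rw [hflip] at h2
  set A := (Y.powersetCard k).filter fun S => Good σ tl hd b S
  set B := (Y.powersetCard k).filter fun S => Good σ hd tl b S
  have hAB : Disjoint A B := by
    refine Finset.disjoint_left.2 fun S hA hB => ?_
    obtain ⟨hS, hA⟩ := Finset.mem_filter.1 hA
    obtain ⟨hSY, hS⟩ := Finset.mem_powersetCard.1 hS
    exact hA.not_swap (Finset.card_pos.1 (by omega)) hY hSY (Finset.mem_filter.1 hB).2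
  have hABN : Disjoint (A ∪ B) N := by
    refine Finset.disjoint_left.2 fun S h hN => ?_
    rcases Finset.mem_union.1 h with h | h
    · exact (hbad S hN).1 (Finset.mem_filter.1 h).2
    · exact (hbad S hN).2 (Finset.mem_filter.1 h).2
  have h3 := Finset.card_le_card (Finset.union_subset (Finset.union_subset
    (Finset.filter_subset _ _ : A ⊆ _) (Finset.filter_subset _ _ : B ⊆ _)) hN)
  rw [Finset.card_union_of_disjoint hABN, Finset.card_union_of_disjoint hAB,
    Finset.card_powersetCard] at h3
  have h4 : (A.card : ℤ) + B.card + N.card ≤ Y.card.choose k := by exact_mod_cast h3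
  linarith

/-- The states whose crossings are all met in the same order count in neither state sum. -/
theorem two_mul_abs_coeff_add_choose_le {k : ℕ} (hk : 1 ≤ k) (hY : Distinct tl hd Y)
    (hflip : stateSum (X : ℤ[X]) σ hd tl w Y b = stateSum X σ tl hd w Y b) (hcov : Covers σ b) :
    ∃ t u, t + u = Y.card ∧
      2 * |(stateSum (X : ℤ[X]) σ tl hd w Y b).coeff k| + (t.choose k + u.choose k : ℕ) ≤
        Y.card.choose k := by
  set T := Y.filter fun i => Before σ b (tl i) (hd i) with hT
  set U := Y.filter fun i => ¬ Before σ b (tl i) (hd i) with hU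
  have hTU : Disjoint (T.powersetCard k) (U.powersetCard k) := by
    refine Finset.disjoint_left.2 fun S h1 h2 => ?_
    obtain ⟨h1, hS⟩ := Finset.mem_powersetCard.1 h1
    obtain ⟨i, hi⟩ := Finset.card_pos.1 (show 0 < S.card by omega)
    exact (Finset.mem_filter.1 ((Finset.mem_powersetCard.1 h2).1 hi)).2 (Finset.mem_filter.1 (h1 hi)).2
  refine ⟨T.card, U.card, Finset.card_filter_add_card_filter_not _, ?_⟩
  have := two_mul_abs_coeff_add_card_le (w := w) (N := T.powersetCard k ∪ U.powersetCard k) hk hY hflip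
    ?_ ?_
  · rwa [Finset.card_union_of_disjoint hTU, Finset.card_powersetCard, Finset.card_powersetCard] at this
  · exact Finset.union_subset (Finset.powersetCard_mono (Finset.filter_subset _ _))
      (Finset.powersetCard_mono (Finset.filter_subset _ _))
  · intro S hS
    rcases Finset.mem_union.1 hS with h | h <;> obtain ⟨hST, hS⟩ := Finset.mem_powersetCard.1 h <;>
      have hne : S.Nonempty := Finset.card_pos.1 (by omega)
    · have hfirst : ∀ i ∈ S, Before σ b (tl i) (hd i) := fun i hi => (Finset.mem_filter.1 (hST hi)).2
      have hSY := hST.trans (Finset.filter_subset _ _)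
      exact ⟨not_good_of_tl_first (hY.mono hSY) hne hcov hfirst, not_good_of_hd_first hne hcov hfirst⟩
    · have hSY := hST.trans (Finset.filter_subset _ _)
      have hfirst : ∀ i ∈ S, Before σ b (hd i) (tl i) := fun i hi =>
        (before_or_before hcov (hY.ne i (hSY hi) i (hSY hi)).symm).2 (Finset.mem_filter.1 (hST hi)).2
      exact ⟨not_good_of_hd_first hne hcov hfirst,
        not_good_of_tl_first (hY.mono hSY).swap hne hcov hfirst⟩

/-- Suppose that the walk passes from `hd y` to `tl x` without meeting other endpoints of crossings.
With the base point at `tl x`, a state that contains `x` and `y` counts in neither state sum: `tl x` is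
met before `hd x`, and `tl y` is followed by the return to the base point, so that `hd y` would have
to be met before `tl y`. -/
theorem not_good_of_adjacent (hY : Distinct tl hd Y) {S : Finset ι} (hS : S ⊆ Y) {x y : ι} (hx : x ∈ S)
    (hy : y ∈ S) {n : ℕ} (hn : (⇑σ)^[n + 1] (hd y) = tl x)
    (hplain : ∀ j < n, ∀ i ∈ Y, σ^[j + 1] (hd y) ≠ tl i ∧ σ^[j + 1] (hd y) ≠ hd i) :
    ¬ Good σ tl hd (tl x) S ∧ ¬ Good σ hd tl (tl x) S := by
  refine ⟨?_, fun h => (h.2 x hx).1 rfl⟩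
  rintro ⟨hcov, hbef⟩
  set g := σ * pairing tl hd S with hg
  have hwalk : ∀ j ≤ n, g^[j + 1] (tl y) = σ^[j + 1] (hd y) := by
    intro j hj
    induction j with
    | zero => simp [hg, pairing_tl (hY.mono hS) hy]
    | succ j ih =>
      have h := pairing_of_ne fun i hi => hplain j (by omega) i (hS hi)
      rw [Function.iterate_succ_apply', ih (by omega), Function.iterate_succ_apply' σ (j + 1), hg,
        Equiv.Perm.mul_apply, h]
  have hlt := (before_iff_arrival_lt (hcov _) (hcov _)).1 (hbef y hy)
  set A := arrival g (tl x) (tl y) with hA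
  set B := arrival g (tl x) (hd y) with hB
  have h1 : g^[A] (tl x) = tl y := iterate_arrival (hcov _)
  have h2 : g^[B] (tl x) = hd y := iterate_arrival (hcov _)
  by_cases hle : B ≤ A + (n + 1)
  · have h3 : g^[(B - A - 1) + 1] (tl y) = hd y := by
      rw [← h1, ← Function.iterate_add_apply, ← h2]
      congr 1
      omega
    rw [hwalk _ (by omega)] at h3
    by_cases hlast : B - A - 1 = n
    · rw [hlast, hn] at h3
      exact hY.ne x (hS hx) y (hS hy) h3
    · exact (hplain _ (by omega) y (hS hy)).2 h3
  · have h3 : g^[B - A - (n + 1)] (tl x) = hd y := by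
      rw [← hn, ← hwalk n le_rfl, ← h1, ← Function.iterate_add_apply,
        ← Function.iterate_add_apply, ← h2]
      congr 1
      omega
    have := arrival_le h3
    omega

/-- On a diagram with one component and at least one crossing, some `hd` is directly followed by some
`tl`. -/
theorem exists_adjacent {b : P} [Finite P] (hcov : Covers σ b) (hY : Distinct tl hd Y) {a : ι}
    (ha : a ∈ Y) : ∃ x ∈ Y, ∃ y ∈ Y, ∃ n, (⇑σ)^[n + 1] (hd y) = tl x ∧
      ∀ j < n, ∀ i ∈ Y, σ^[j + 1] (hd y) ≠ tl i ∧ σ^[j + 1] (hd y) ≠ hd i := by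
  have hex : ∃ j, ∃ x ∈ Y, σ^[j] (hd a) = tl x := by
    obtain ⟨k, hk⟩ := path_empty_iff.1 (hcov.symm (hd a) (tl a))
    exact ⟨k, a, ha, hk⟩
  obtain ⟨x, hx, hj⟩ := Nat.find_spec hex
  set j := Nat.find hex with hjdef
  have hmin : ∀ i < j, ∀ x ∈ Y, σ^[i] (hd a) ≠ tl x := fun i hi x hx h =>
    Nat.find_min hex hi ⟨x, hx, h⟩
  have hj0 : j ≠ 0 := by
    intro h0
    rw [h0] at hj
    exact hY.ne x hx a ha hj.symm
  obtain ⟨i, hi, hmax⟩ := ((Finset.range j).filter fun i => ∃ y ∈ Y, σ^[i] (hd a) = hd y).exists_max_image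
    id ⟨0, by simpa [Nat.pos_of_ne_zero hj0] using ⟨a, ha, rfl⟩⟩
  obtain ⟨hij, y, hy, hiy⟩ := Finset.mem_filter.1 hi
  rw [Finset.mem_range] at hij
  have hit : ∀ r, σ^[r] (hd y) = σ^[i + r] (hd a) := fun r => by
    rw [add_comm, Function.iterate_add_apply, hiy]
  refine ⟨x, hx, y, hy, j - i - 1, ?_, fun r hr l hl => ⟨fun h => ?_, fun h => ?_⟩⟩
  · rw [hit, ← hj]
    congr 1
    omega
  · rw [hit] at h
    exact hmin _ (by omega) l hl h
  · rw [hit] at h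
    have := hmax (i + (r + 1)) (Finset.mem_filter.2 ⟨Finset.mem_range.2 (by omega), l, hl, h⟩)
    simp only [id] at this
    omega

end StateSum

/-! ### Binomial coefficients of half-integers -/

namespace Binomial

theorem choose_add_choose_le_of_le {t u : ℕ} (h : t ≤ u) (k : ℕ) :
    (t + 1).choose k + u.choose k ≤ t.choose k + (u + 1).choose k := by
  cases k with
  | zero => simp
  | succ k =>
    have := Nat.choose_le_choose k h
    rw [Nat.choose_succ_succ', Nat.choose_succ_succ']
    omega

theorem choose_add_choose_le (s d e k : ℕ) :
    (s + d).choose k + (s + d + e).choose k ≤ s.choose k + (s + 2 * d + e).choose k := by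
  induction d generalizing s with
  | zero => simp
  | succ d ih =>
    have h1 := ih (s + 1)
    have h2 := choose_add_choose_le_of_le (show s ≤ s + 1 + 2 * d + e by omega) k
    rw [show s + (d + 1) = s + 1 + d by omega,
      show s + 2 * (d + 1) + e = s + 1 + 2 * d + e + 1 by omega]
    omega

/-- Among all sums of two binomial coefficients `t.choose k + u.choose k` with given `t + u`, the
smallest one has `t` and `u` as close to each other as possible. -/
theorem choose_half_add_choose_half_le (t u k : ℕ) :
    ((t + u) / 2).choose k + ((t + u + 1) / 2).choose k ≤ t.choose k + u.choose k := by
  wlog h : t ≤ u generalizing t u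
  · have := this u t (by omega)
    rwa [add_comm u t, add_comm (u.choose k)] at this
  obtain ⟨r, rfl⟩ := Nat.exists_eq_add_of_le h
  have := choose_add_choose_le t (r / 2) (r % 2) k
  rw [show (t + (t + r)) / 2 = t + r / 2 by omega,
    show (t + (t + r) + 1) / 2 = t + r / 2 + r % 2 by omega]
  rwa [show t + 2 * (r / 2) + r % 2 = t + r by omega] at this

theorem succ_mul_choose_succ (x : ℝ) (k : ℕ) :
    ((k : ℝ) + 1) * Ring.choose x (k + 1) = Ring.choose x k * (x - k) := by
  have h := Ring.choose_smul_choose x (Nat.le_succ k)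
  rw [Nat.succ_eq_add_one, Nat.choose_succ_self_right, Nat.add_sub_cancel_left, Ring.choose_one_right,
    nsmul_eq_mul] at h
  exact_mod_cast h

theorem succ_mul_choose_add_one (x : ℝ) (k : ℕ) :
    ((k : ℝ) + 1) * Ring.choose (x + 1) (k + 1) = (x + 1) * Ring.choose x k := by
  have h := Ring.choose_smul_choose (x + 1) (show 1 ≤ k + 1 by omega)
  rw [Nat.choose_one_right, Nat.add_sub_cancel, Ring.choose_one_right, nsmul_eq_mul, Nat.cast_one,
    add_sub_cancel_right] at h
  exact_mod_cast h

theorem abs_choose_add_half_le {m k : ℕ} (h : m < k) : |Ring.choose ((m : ℝ) + 1 / 2) k| ≤ 1 / 2 := by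
  obtain ⟨k, rfl⟩ := Nat.exists_eq_add_of_lt h
  clear h
  induction k with
  | zero =>
    rw [add_zero]
    induction m with
    | zero => norm_num [Ring.choose_one_right, abs_of_pos]
    | succ m ih =>
      have h := succ_mul_choose_add_one ((m : ℝ) + 1 / 2) (m + 1)
      push_cast at h ⊢
      rw [show (m : ℝ) + 1 + 1 / 2 = m + 1 / 2 + 1 by ring]
      have h1 := congrArg abs h
      rw [abs_mul, abs_mul, abs_of_pos (show (0 : ℝ) < m + 1 + 1 by positivity),
        abs_of_pos (show (0 : ℝ) < m + 1 / 2 + 1 by positivity)] at h1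
      have hm : (0 : ℝ) ≤ m := Nat.cast_nonneg m
      have h3 : (0 : ℝ) < m + 1 + 1 := by positivity
      nlinarith [abs_nonneg (Ring.choose ((m : ℝ) + 1 / 2) (m + 1))]
  | succ k ih =>
    have h := succ_mul_choose_succ ((m : ℝ) + 1 / 2) (m + k + 1)
    push_cast at h
    have h1 := congrArg abs h
    rw [abs_mul, abs_mul, abs_of_pos (by positivity)] at h1
    have h2 : |(m : ℝ) + 1 / 2 - (m + k + 1)| ≤ m + k + 1 + 1 := by
      have hm : (0 : ℝ) ≤ m := Nat.cast_nonneg m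
      have hk : (0 : ℝ) ≤ k := Nat.cast_nonneg k
      rw [abs_le]
      constructor <;> linarith
    have h3 : (0 : ℝ) < m + k + 1 + 1 := by positivity
    rw [← add_assoc]
    nlinarith [abs_nonneg (Ring.choose ((m : ℝ) + 1 / 2) (m + k + 1))]

/-- As a function of its upper argument, the binomial coefficient is midpoint convex at half-integers
that are not too small. -/
theorem two_mul_choose_add_half_le {m k : ℕ} (h : k ≤ m + 1) :
    2 * Ring.choose ((m : ℝ) + 1 / 2) k ≤ m.choose k + (m + 1).choose k := by
  have base : ∀ m : ℕ, 2 * Ring.choose ((m : ℝ) + 1 / 2) (m + 1) ≤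
      m.choose (m + 1) + (m + 1).choose (m + 1) := by
    intro m
    have := (abs_le.1 (abs_choose_add_half_le (Nat.lt_succ_self m))).2
    rw [Nat.choose_succ_self, Nat.choose_self]
    push_cast
    linarith
  induction m generalizing k with
  | zero =>
    rcases Nat.le_one_iff_eq_zero_or_eq_one.1 h with rfl | rfl
    · norm_num [Ring.choose_zero_right]
    · exact base 0
  | succ m ih =>
    rcases Nat.lt_or_ge (m + 1) k with hk | hk
    · obtain rfl : k = m + 1 + 1 := by omega
      exact base (m + 1)
    · cases k with
      | zero => norm_num [Ring.choose_zero_right]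
      | succ k =>
        have h1 := ih (k := k) (by omega)
        have h2 := ih (k := k + 1) (by omega)
        have h3 := Ring.choose_succ_succ ((m : ℝ) + 1 / 2) k
        rw [Nat.choose_succ_succ' m, Nat.choose_succ_succ' (m + 1)]
        push_cast
        rw [show (m : ℝ) + 1 + 1 / 2 = m + 1 / 2 + 1 by ring, h3]
        linarith

/-- The bound by convexity.  It fails if `t + u` is odd and less than `2 * k - 1`: then the right-hand
side can vanish, while the left-hand side is positive for some `k`. -/
theorem two_mul_choose_half_le {t u k : ℕ} (h : Even (t + u) ∨ 2 * k ≤ t + u + 1) :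
    2 * Ring.choose (((t + u : ℕ) : ℝ) / 2) k ≤ (t.choose k + u.choose k : ℕ) := by
  refine le_trans ?_ (Nat.cast_le.2 (choose_half_add_choose_half_le t u k))
  rcases Nat.even_or_odd' (t + u) with ⟨m, hm | hm⟩
  · rw [hm, show (2 * m + 1) / 2 = m by omega, show 2 * m / 2 = m by omega,
      show ((2 * m : ℕ) : ℝ) / 2 = m by push_cast; ring, Ring.choose_natCast]
    push_cast
    linarith
  · rw [hm, show (2 * m + 1 + 1) / 2 = m + 1 by omega, show (2 * m + 1) / 2 = m by omega,
      show ((2 * m + 1 : ℕ) : ℝ) / 2 = m + 1 / 2 by push_cast; ring]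
    push_cast
    refine two_mul_choose_add_half_le ?_
    rcases h with h | h
    · rw [hm] at h
      exact absurd h (by simp)
    · omega

theorem two_mul_choose_half_le_one {c k : ℕ} (hc : Odd c) (h : c + 1 < 2 * k) :
    2 * Ring.choose ((c : ℝ) / 2) k ≤ 1 := by
  obtain ⟨m, rfl⟩ := hc
  have := (abs_le.1 (abs_choose_add_half_le (show m < k by omega))).2
  rw [show ((2 * m + 1 : ℕ) : ℝ) / 2 = m + 1 / 2 by push_cast; ring]
  linarith

theorem choose_two (c : ℕ) :
    1 / 2 * ((c.choose 2 : ℝ) - 2 * Ring.choose ((c : ℝ) / 2) 2) = (c : ℝ) ^ 2 / 8 := by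
  have h1 := succ_mul_choose_succ ((c : ℝ) / 2) 1
  rw [Ring.choose_one_right] at h1
  norm_num at h1
  rw [Nat.cast_choose_two]
  linarith

end Binomial

/-! ### The bound for the coefficients -/

namespace LinkDiagram
open StateSum Walk GaussDiagram Binomial
open scoped Classical

variable {P : Type} {D : LinkDiagram P}

theorem conway_flip (D : LinkDiagram P) (b : P) :
    stateSum (X : ℤ[X]) D.next SignedArrow.head SignedArrow.tail SignedArrow.sign D.crossings b =
      D.conway b := by
  have := D.finite
  have h := stateSum_flip D.distinct_east_north D.planar.hasPotentials SignedArrow.sign (X : ℤ[X]) b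
  rwa [upper_east_north.1, upper_east_north.2] at h

theorem abs_coeff_conway_le (hD : ∀ b, Covers D.next b) {k : ℕ} (hk : 2 ≤ k) (hkc : k ≤ D.numCrossings)
    (b : P) : (2 * |(D.conway b).coeff k| : ℝ) ≤ (D.numCrossings.choose k : ℝ) -
      2 * Ring.choose ((D.numCrossings : ℝ) / 2) k := by
  have := D.finite
  rw [← card_crossings] at hkc ⊢
  by_cases hc : Even D.crossings.card ∨ 2 * k ≤ D.crossings.card + 1
  · obtain ⟨t, u, htu, h⟩ := two_mul_abs_coeff_add_choose_le (w := SignedArrow.sign) (k := k) (by omega)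
      D.distinct_tail_head (D.conway_flip b) (hD b)
    have h1 := two_mul_choose_half_le (t := t) (u := u) (k := k) (by rwa [htu])
    rw [htu] at h1
    have h2 : (2 * |(D.conway b).coeff k| : ℝ) + (t.choose k + u.choose k : ℕ) ≤
        (D.crossings.card.choose k : ℝ) := by exact_mod_cast h
    linarith
  · rw [not_or, Nat.not_even_iff_odd, not_le] at hc
    have h1 := two_mul_choose_half_le_one hc.1 hc.2
    obtain ⟨a, ha⟩ := Finset.card_pos.1 (show 0 < D.crossings.card by omega)
    obtain ⟨x, hx, y, hy, n, hn, hplain⟩ := exists_adjacent (hD b) D.distinct_tail_head ha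
    obtain ⟨S, hxyS, hSY, hS⟩ := Finset.exists_subsuperset_card_eq (s := {x, y}) (t := D.crossings)
      (n := k) (by simp [Finset.insert_subset_iff, hx, hy]) (Finset.card_le_two.trans hk) hkc
    have hbad := not_good_of_adjacent D.distinct_tail_head hSY (hxyS (by simp)) (hxyS (by simp)) hn hplain
    have h := two_mul_abs_coeff_add_card_le (w := SignedArrow.sign) (k := k) (N := {S}) (by omega)
      D.distinct_tail_head (D.conway_flip x.tail) (by simpa using ⟨hSY, hS⟩)
      (by simpa using hbad)
    rw [Finset.card_singleton] at h
    have h2 : (2 * |(D.conway x.tail).coeff k| : ℝ) + 1 ≤ (D.crossings.card.choose k : ℝ) := by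
      exact_mod_cast h
    rw [D.planar.conway_base b x.tail]
    linarith

theorem exists_minimal (D : LinkDiagram P) : ∃ (Q : Type) (E : LinkDiagram Q), SameLink D E ∧
    E.numCrossings = D.crossingNumber := by
  have hrefl : SameLink D D := .relabel ⟨Equiv.refl P, fun _ => rfl, by
    have : SignedArrow.map (Equiv.refl P) = id := rfl
    rw [this, Set.image_id]⟩
  exact Nat.sInf_mem (s := {c | ∃ (Q : Type) (E : LinkDiagram Q), SameLink D E ∧ E.numCrossings = c})
    ⟨_, P, D, hrefl, rfl⟩

end LinkDiagram

theorem proposition3p1 {P : Type} (K : LinkDiagram P) (hK : K.IsKnot)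
    (p : ℤ[X]) (hp : K.HasConwayPolynomial p) :
    (∀ n : ℕ, 1 ≤ n → 2 * n ≤ K.crossingNumber →
      |(p.coeff (2 * n) : ℝ)| ≤ 1 / 2 * ((K.crossingNumber.choose (2 * n) : ℝ) -
        2 * Ring.choose ((K.crossingNumber : ℝ) / 2) (2 * n))) ∧
    (∀ n : ℕ, K.crossingNumber < 2 * n → p.coeff (2 * n) = 0) ∧
    (p.coeff 2 : ℝ) ≤ (K.crossingNumber : ℝ) ^ 2 / 8 := by
  obtain ⟨⟨b⟩, hconway⟩ := hp.eq_conway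
  obtain ⟨Q, E, hE, hcr⟩ := K.exists_minimal
  obtain ⟨b'⟩ := hE.conway_eq.1.1 ⟨b⟩
  have hpE : ∀ q, E.conway q = p := fun q => by rw [← hE.conway_eq.2 b q, hconway]
  -- the constant coefficient detects knots
  have hknot : ∀ q, Walk.Covers E.next q := by
    intro q
    have h := congrArg (fun f : ℤ[X] => f.coeff 0) ((hpE q).trans (hconway b).symm)
    simp only [GaussDiagram.conway, StateSum.coeff_zero_stateSum, if_pos (hK.covers b)] at h
    by_contra hq
    rw [if_neg hq] at h
    exact zero_ne_one h
  have main : ∀ n : ℕ, 1 ≤ n → 2 * n ≤ K.crossingNumber →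
      |(p.coeff (2 * n) : ℝ)| ≤ 1 / 2 * ((K.crossingNumber.choose (2 * n) : ℝ) -
        2 * Ring.choose ((K.crossingNumber : ℝ) / 2) (2 * n)) := by
    intro n hn hnc
    have h := LinkDiagram.abs_coeff_conway_le hknot (k := 2 * n) (by omega) (by omega) b'
    rw [hpE, hcr, Int.cast_abs] at h
    linarith
  have hzero : ∀ k, K.crossingNumber < k → p.coeff k = 0 := by
    intro k hk
    rw [← hpE b']
    exact StateSum.coeff_stateSum_eq_zero (by rwa [GaussDiagram.card_crossings, hcr])
  refine ⟨main, fun n => hzero (2 * n), ?_⟩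
  by_cases h2 : 2 ≤ K.crossingNumber
  · have h := main 1 le_rfl (by omega)
    rw [mul_one, Binomial.choose_two] at h
    exact (le_abs_self _).trans h
  · rw [hzero 2 (by omega)]
    simpa using by positivity
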